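/- Let $G$ be a connected real Lie group with Lie algebra $\mathfrak g$ of dimension $n$, fix a basis $e_1,\dots,e_n$ of $\mathfrak g$, let $X_1,\dots,X_n$ be the corresponding left invariant vector fields, and let $R\ge 0$, $R'\ge 0$. Definitions. A real analytic function $\phi\colon G\to\mathbb C$ is called $R$-entire if $$q_{R,c}(\phi)=\sum_{k=0}^\infty k!^{\,R-1}c^k\sum_{\alpha\in\{1,\dots,n\}^k}\bigl|(X_{\alpha_1}\cdots X_{\alpha_k}\phi)(e)\bigr|<\infty\quad\text{for all }c\ge 0 .$$ Let $\mathcal E_R(G)$ be the space of these functions with the seminorms $q_{R,c}$. For a function on $\mathfrak g^*$, "$R'$-entire" is defined in the same way for the abelian Lie group $\mathfrak g^*$ (partial derivatives at $0$ with respect to the dual basis). On the complexified symmetric algebra $\mathrm{Sym}^\bullet(\mathfrak g)=\bigoplus_k \mathrm{Sym}^k(\mathfrak g)$, with $\mathrm{Sym}^k(\mathfrak g)$ realized as the symmetric tensors in the $k$-th tensor power, consider the seminorms $p_{R',c}(v)=\sum_k k!^{\,R'}c^k\,p^k(v_k)$, $c\ge0$, where $p^k$ is the $k$-th projective tensor power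 of the $\ell^1$-norm with respect to the basis; write $\mathrm{Sym}_{R'}(\mathfrak g)$ for the resulting locally convex space. Elements of $\mathrm{Sym}^\bullet(\mathfrak g)$ are viewed as polynomial functions on $\mathfrak g^*$. Let $\mathrm{Pol}_{R,R'}(T^*G)=\mathcal E_R(G)\otimes \mathrm{Sym}_{R'}(\mathfrak g)$ with the projective tensor product topology, let $\widehat{\mathrm{Pol}}_{R,R'}(T^*G)$ be its Hausdorff completion, and identify $T^*G\cong G\times\mathfrak g^*$ by left translation, so that $\phi\otimes v$ is the function $(g,\eta)\mapsto\phi(g)v(\eta)$. Statement. The inclusion of $\mathrm{Pol}_{R,R'}(T^*G)$ into the functions on $G\times\mathfrak g^*$ extends to an injective linear map from $\widehat{\mathrm{Pol}}_{R,R'}(T^*G)$ into the functions on $G\times\mathfrak g^*$ which is continuous for pointwise convergence; in this way every $\chi\in\widehat{\mathrm{Pol}}_{R,R'}(T^*G)$ is regarded as a function on $T^*G$. For every such $\chi$: 1. $\chi$ is smooth on $G\times\mathfrak g^*$. 2. There is a unique family of $R$-entire functions $c_\alpha\colon G\to\mathbb C$, indexed by $\alpha\in\{1,\dots,n\}^k$,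 $k\ge 0$, with $c_\alpha$ independent of the order of the entries of $\alpha$, such that $$\chi(g,\eta)=\sum_{k=0}^\infty\ \sum_{\alpha\in\{1,\dots,n\}^k}c_\alpha(g)\,\eta_{\alpha_1}\cdots\eta_{\alpha_k}$$ with absolute convergence for all $g\in G$ and $\eta\in\mathfrak g^*$, where $\eta_i=\eta(e_i)$. 3. For every $g\in G$ the function $\eta\mapsto\chi(g,\eta)$ on $\mathfrak g^*$ is $R'$-entire. -/

import Mathlib

open scoped Manifold ContDiff TensorProduct NNReal
open Module

noncomputable section

namespace LieObs

/-! ### Lie derivatives, majorant coefficients and `R`-entire functions -/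

section Entire

variable {E : Type*} [NormedAddCommGroup E] [NormedSpace ℝ E]
  {M : Type*} [TopologicalSpace M] [ChartedSpace E M] {n : ℕ}

/-- The Lie derivative of `f : M → ℂ` along the vector field `X`. -/
def lieDeriv (X : ∀ x : M, TangentSpace 𝓘(ℝ, E) x) (f : M → ℂ) : M → ℂ :=
  fun x => (mfderiv 𝓘(ℝ, E) 𝓘(ℝ, ℂ) f x (X x) : ℂ)

/-- For a frame `X₁, …, Xₙ` and a word `α = [α₁, …, αₖ]`, the iterated derivative
`L_{X_{α₁}} ⋯ L_{X_{αₖ}} f`. -/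
def iterLieDeriv (X : Fin n → ∀ x : M, TangentSpace 𝓘(ℝ, E) x) (α : List (Fin n))
    (f : M → ℂ) : M → ℂ :=
  α.foldr (fun i h => lieDeriv (X i) h) f

/-- The majorant coefficient
`c_k(f) = (1 / k!) ∑_{α ∈ {1, …, n}ᵏ} |(L_{X_{α₁}} ⋯ L_{X_{αₖ}} f)(e)|`. -/
def majCoeff (X : Fin n → ∀ x : M, TangentSpace 𝓘(ℝ, E) x) (e : M) (k : ℕ) (f : M → ℂ) : ℝ :=
  ((k.factorial : ℝ))⁻¹ * ∑ α : Fin k → Fin n, ‖iterLieDeriv X (List.ofFn α) f e‖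

/-- `f` is `R`-entire with respect to the frame `X` and the base point `e`: it is real analytic and
`q_{R,c}(f) = ∑_k k!^R c_k(f) c^k` is finite for every `c ≥ 0`.  For `R = 0` this says that the
majorant `∑_k c_k(f) z^k` is an entire function of `z`; for `R > 0` it says that the majorant is
entire of order `≤ 1 / R` and minimal type, see `isREntire_iff_minimalType`. -/
def IsREntire (X : Fin n → ∀ x : M, TangentSpace 𝓘(ℝ, E) x) (e : M) (R : ℝ) (f : M → ℂ) : Prop :=
  ContMDiff 𝓘(ℝ, E) 𝓘(ℝ, ℂ) ω f ∧
    ∀ c : ℝ, 0 ≤ c → Summable fun k : ℕ => (k.factorial : ℝ) ^ R * majCoeff X e k f * c ^ k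

theorem majCoeff_nonneg (X : Fin n → ∀ x : M, TangentSpace 𝓘(ℝ, E) x) (e : M) (k : ℕ)
    (f : M → ℂ) : 0 ≤ majCoeff X e k f := by
  unfold majCoeff; positivity

/-- Power series with nonnegative coefficients: finiteness of all the weighted sums means order
`≤ 1 / R` and minimal type. -/
theorem summable_iff_minimalType {R : ℝ} (hR : 0 < R) {a : ℕ → ℝ} (ha : ∀ k, 0 ≤ a k) :
    (∀ c : ℝ, 0 ≤ c → Summable fun k : ℕ => (k.factorial : ℝ) ^ R * a k * c ^ k) ↔
      (∀ z : ℂ, Summable fun k : ℕ => (a k : ℂ) * z ^ k) ∧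
        ∀ ε : ℝ, 0 < ε → ∃ C : ℝ, ∀ z : ℂ,
          ‖∑' k : ℕ, (a k : ℂ) * z ^ k‖ * Real.exp (-ε * ‖z‖ ^ (1 / R)) ≤ C := by
  have hnorm : ∀ (z : ℂ) (k : ℕ), ‖(a k : ℂ) * z ^ k‖ = a k * ‖z‖ ^ k := fun z k => by
    rw [norm_mul, norm_pow, Complex.norm_real, Real.norm_of_nonneg (ha k)]
  have hfac : ∀ k : ℕ, (1 : ℝ) ≤ (k.factorial : ℝ) ^ R := fun k =>
    Real.one_le_rpow (by exact_mod_cast Nat.one_le_iff_ne_zero.2 k.factorial_ne_zero) hR.le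
  constructor
  · intro h
    have hs : ∀ z : ℂ, Summable fun k : ℕ => a k * ‖z‖ ^ k := fun z =>
      (h ‖z‖ (norm_nonneg z)).of_nonneg_of_le (fun k => mul_nonneg (ha k) (by positivity))
        fun k => by
          have : 0 ≤ a k * ‖z‖ ^ k := mul_nonneg (ha k) (by positivity)
          nlinarith [hfac k]
    refine ⟨fun z => Summable.of_norm (by simpa only [hnorm] using hs z), fun ε hε => ?_⟩
    set c : ℝ := (R / ε) ^ R with hc
    have hc0 : 0 < c := by positivity
    have hcR : c ^ (1 / R) = R / ε := by
      rw [hc, ← Real.rpow_mul (by positivity), mul_one_div_cancel hR.ne', Real.rpow_one]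
    refine ⟨∑' k : ℕ, (k.factorial : ℝ) ^ R * a k * c ^ k, fun z => ?_⟩
    have key : ∀ k : ℕ, a k * ‖z‖ ^ k ≤
        ((k.factorial : ℝ) ^ R * a k * c ^ k) * Real.exp (ε * ‖z‖ ^ (1 / R)) := by
      intro k
      set t : ℝ := (‖z‖ / c) ^ (1 / R) with ht
      have ht0 : 0 ≤ t := by positivity
      have htR : t ^ R = ‖z‖ / c := by
        rw [ht, ← Real.rpow_mul (by positivity), one_div_mul_cancel hR.ne', Real.rpow_one]
      have h1 : R * t = ε * ‖z‖ ^ (1 / R) := by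
        rw [ht, Real.div_rpow (norm_nonneg z) hc0.le, hcR]; field_simp
      have h2 : t ^ k / k.factorial ≤ Real.exp t := Real.pow_div_factorial_le_exp t ht0 k
      have h3 : (t ^ k / k.factorial) ^ R ≤ Real.exp (R * t) := by
        rw [mul_comm, Real.exp_mul]
        exact Real.rpow_le_rpow (by positivity) h2 hR.le
      have h4 : (t ^ k / k.factorial) ^ R = (‖z‖ / c) ^ k / (k.factorial : ℝ) ^ R := by
        rw [Real.div_rpow (by positivity) (by positivity), ← htR, ← Real.rpow_natCast,
          ← Real.rpow_natCast, ← Real.rpow_mul ht0, ← Real.rpow_mul ht0, mul_comm R]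
      rw [h4, h1, div_le_iff₀ (by positivity), div_pow, div_le_iff₀ (by positivity)] at h3
      calc a k * ‖z‖ ^ k ≤ a k * (Real.exp (ε * ‖z‖ ^ (1 / R)) * (k.factorial : ℝ) ^ R * c ^ k) :=
            mul_le_mul_of_nonneg_left h3 (ha k)
        _ = _ := by ring
    have h5 : ‖∑' k : ℕ, (a k : ℂ) * z ^ k‖ ≤
        (∑' k : ℕ, (k.factorial : ℝ) ^ R * a k * c ^ k) * Real.exp (ε * ‖z‖ ^ (1 / R)) := by
      refine tsum_of_norm_bounded ((h c hc0.le).hasSum.mul_right _) fun k => ?_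
      rw [hnorm]; exact key k
    calc _ ≤ (∑' k : ℕ, (k.factorial : ℝ) ^ R * a k * c ^ k) * Real.exp (ε * ‖z‖ ^ (1 / R)) *
          Real.exp (-ε * ‖z‖ ^ (1 / R)) := mul_le_mul_of_nonneg_right h5 (Real.exp_pos _).le
      _ = _ := by rw [mul_assoc, ← Real.exp_add]; simp
  · rintro ⟨hs, hb⟩ c hc
    set ε : ℝ := R / Real.exp 1 * (2 * (c + 1)) ^ (-(1 / R)) with hε
    have hε0 : 0 < ε := by positivity
    have hεR : (R / (Real.exp 1 * ε)) ^ R = 2 * (c + 1) := by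
      have : R / (Real.exp 1 * ε) = (2 * (c + 1)) ^ (1 / R) := by
        rw [hε, Real.rpow_neg (by positivity)]; field_simp
      rw [this, ← Real.rpow_mul (by positivity), one_div_mul_cancel hR.ne', Real.rpow_one]
    obtain ⟨C, hC⟩ := hb ε hε0
    refine Summable.of_nonneg_of_le (fun k => mul_nonneg (mul_nonneg (by positivity) (ha k))
      (by positivity)) (f := fun k : ℕ => C * (1 / 2 : ℝ) ^ k) ?_
      (summable_geometric_two.mul_left C)
    intro k
    set r : ℝ := ((k : ℝ) * R / ε) ^ R with hr
    have hr0 : 0 ≤ r := by positivity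
    have hrR : r ^ (1 / R) = k * R / ε := by
      rw [hr, ← Real.rpow_mul (by positivity), mul_one_div_cancel hR.ne', Real.rpow_one]
    have h1 : a k * r ^ k ≤ C * Real.exp (k * R) := by
      have h2 := hC (r : ℂ)
      rw [Complex.norm_real, Real.norm_of_nonneg hr0, hrR] at h2
      have h3 : a k * r ^ k ≤ ‖∑' k : ℕ, (a k : ℂ) * (r : ℂ) ^ k‖ := by
        have h4 : (∑' k : ℕ, (a k : ℂ) * (r : ℂ) ^ k) = ((∑' k : ℕ, a k * r ^ k : ℝ) : ℂ) := by
          push_cast; rfl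
        have h5 : Summable fun k : ℕ => a k * r ^ k := by
          have := (hs (r : ℂ))
          exact_mod_cast this
        rw [h4, Complex.norm_real]
        exact (h5.le_tsum k fun j _ => mul_nonneg (ha j) (by positivity)).trans (le_abs_self _)
      have h6 : -ε * (k * R / ε) = -(k * R) := by field_simp
      rw [h6, Real.exp_neg, ← div_eq_mul_inv, div_le_iff₀ (Real.exp_pos _)] at h2
      exact h3.trans h2
    have h7 : (k.factorial : ℝ) ^ R * c ^ k ≤ (1 / 2) ^ k * Real.exp (-(k * R)) * r ^ k := by
      have h8 : (k.factorial : ℝ) ^ R ≤ ((k : ℝ) ^ R) ^ k := by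
        rw [← Real.rpow_natCast, ← Real.rpow_mul (by positivity), mul_comm R,
          Real.rpow_mul (by positivity), Real.rpow_natCast]
        exact Real.rpow_le_rpow (by positivity) (by exact_mod_cast Nat.factorial_le_pow k) hR.le
      have h9 : c ^ k ≤ ((1 / 2) * (R / (Real.exp 1 * ε)) ^ R) ^ k := by
        rw [hεR]; gcongr; linarith
      have h10 : (k : ℝ) ^ R * ((1 / 2) * (R / (Real.exp 1 * ε)) ^ R) =
          (1 / 2) * Real.exp (-R) * r := by
        have : (k : ℝ) * R / ε = k * (R / (Real.exp 1 * ε)) * Real.exp 1 := by field_simp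
        rw [hr, this, Real.mul_rpow (by positivity) (by positivity),
          Real.mul_rpow (by positivity) (by positivity), ← Real.exp_mul, one_mul]
        have : Real.exp (-R) * Real.exp R = 1 := by rw [← Real.exp_add]; simp
        linear_combination (-(1 / 2) * (k : ℝ) ^ R * (R / (Real.exp 1 * ε)) ^ R) * this
      calc (k.factorial : ℝ) ^ R * c ^ k
          ≤ ((k : ℝ) ^ R) ^ k * ((1 / 2) * (R / (Real.exp 1 * ε)) ^ R) ^ k :=
            mul_le_mul h8 h9 (by positivity) (by positivity)
        _ = ((1 / 2) * Real.exp (-R) * r) ^ k := by rw [← mul_pow, h10]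
        _ = _ := by rw [mul_pow, mul_pow, ← Real.exp_nat_mul, mul_neg]
    calc (k.factorial : ℝ) ^ R * a k * c ^ k = a k * ((k.factorial : ℝ) ^ R * c ^ k) := by ring
      _ ≤ a k * ((1 / 2) ^ k * Real.exp (-(k * R)) * r ^ k) :=
          mul_le_mul_of_nonneg_left h7 (ha k)
      _ = (a k * r ^ k) * ((1 / 2) ^ k * Real.exp (-(k * R))) := by ring
      _ ≤ (C * Real.exp (k * R)) * ((1 / 2) ^ k * Real.exp (-(k * R))) :=
          mul_le_mul_of_nonneg_right h1 (by positivity)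
      _ = C * (1 / 2) ^ k * (Real.exp (k * R) * Real.exp (-(k * R))) := by ring
      _ = _ := by rw [← Real.exp_add]; simp

/-- For `R > 0`, being `R`-entire means that the function is analytic and that its majorant
`z ↦ ∑_k c_k(f) z^k` is an entire function of order `≤ 1 / R` and minimal type. -/
theorem isREntire_iff_minimalType (X : Fin n → ∀ x : M, TangentSpace 𝓘(ℝ, E) x) (e : M) {R : ℝ}
    (hR : 0 < R) (f : M → ℂ) :
    IsREntire X e R f ↔ ContMDiff 𝓘(ℝ, E) 𝓘(ℝ, ℂ) ω f ∧
      (∀ z : ℂ, Summable fun k : ℕ => (majCoeff X e k f : ℂ) * z ^ k) ∧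
        ∀ ε : ℝ, 0 < ε → ∃ C : ℝ, ∀ z : ℂ,
          ‖∑' k : ℕ, (majCoeff X e k f : ℂ) * z ^ k‖ * Real.exp (-ε * ‖z‖ ^ (1 / R)) ≤ C :=
  and_congr_right fun _ => summable_iff_minimalType hR fun k => majCoeff_nonneg X e k f

theorem iterLieDeriv_cons (X : Fin n → ∀ x : M, TangentSpace 𝓘(ℝ, E) x) (i : Fin n)
    (α : List (Fin n)) (f : M → ℂ) :
    iterLieDeriv X (i :: α) f = lieDeriv (X i) (iterLieDeriv X α f) := rfl

theorem lieDeriv_add (X : ∀ x : M, TangentSpace 𝓘(ℝ, E) x) {f h : M → ℂ}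
    (hf : MDifferentiable 𝓘(ℝ, E) 𝓘(ℝ, ℂ) f) (hh : MDifferentiable 𝓘(ℝ, E) 𝓘(ℝ, ℂ) h) :
    lieDeriv X (f + h) = lieDeriv X f + lieDeriv X h := by
  funext x
  have := mfderiv_add (hf x) (hh x)
  simp only [lieDeriv, Pi.add_apply]
  exact congrArg (fun L : E →L[ℝ] ℂ => L (X x)) this

theorem lieDeriv_smul (X : ∀ x : M, TangentSpace 𝓘(ℝ, E) x) (a : ℂ) {f : M → ℂ}
    (hf : MDifferentiable 𝓘(ℝ, E) 𝓘(ℝ, ℂ) f) :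
    lieDeriv X (a • f) = a • lieDeriv X f := by
  funext x
  have h1 : HasMFDerivAt 𝓘(ℝ, ℂ) 𝓘(ℝ, ℂ) (fun z : ℂ => a • z) (f x)
      (a • ContinuousLinearMap.id ℝ ℂ) :=
    HasFDerivAt.hasMFDerivAt ((a • ContinuousLinearMap.id ℝ ℂ).hasFDerivAt)
  have h2 := (h1.comp x (hf x).hasMFDerivAt).mfderiv
  exact congrArg (fun L : E →L[ℝ] ℂ => L (X x)) h2

theorem contMDiff_lieDeriv [IsManifold 𝓘(ℝ, E) ω M] {X : ∀ x : M, TangentSpace 𝓘(ℝ, E) x}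
    (hX : ContMDiff 𝓘(ℝ, E) 𝓘(ℝ, E).tangent ω (fun x => (⟨x, X x⟩ : TangentBundle 𝓘(ℝ, E) M)))
    {f : M → ℂ} (hf : ContMDiff 𝓘(ℝ, E) 𝓘(ℝ, ℂ) ω f) :
    ContMDiff 𝓘(ℝ, E) 𝓘(ℝ, ℂ) ω (lieDeriv X f) := by
  have h1 := (hf.contMDiff_tangentMap (m := ω) le_rfl).comp hX
  exact (contMDiff_snd_tangentBundle_modelSpace ℂ 𝓘(ℝ, ℂ)).comp h1

theorem contMDiff_iterLieDeriv [IsManifold 𝓘(ℝ, E) ω M]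
    {X : Fin n → ∀ x : M, TangentSpace 𝓘(ℝ, E) x}
    (hX : ∀ i, ContMDiff 𝓘(ℝ, E) 𝓘(ℝ, E).tangent ω
      (fun x => (⟨x, X i x⟩ : TangentBundle 𝓘(ℝ, E) M)))
    {f : M → ℂ} (hf : ContMDiff 𝓘(ℝ, E) 𝓘(ℝ, ℂ) ω f) (α : List (Fin n)) :
    ContMDiff 𝓘(ℝ, E) 𝓘(ℝ, ℂ) ω (iterLieDeriv X α f) := by
  induction α with
  | nil => exact hf
  | cons i α ih => exact contMDiff_lieDeriv (hX i) ih

theorem iterLieDeriv_add [IsManifold 𝓘(ℝ, E) ω M]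
    {X : Fin n → ∀ x : M, TangentSpace 𝓘(ℝ, E) x}
    (hX : ∀ i, ContMDiff 𝓘(ℝ, E) 𝓘(ℝ, E).tangent ω
      (fun x => (⟨x, X i x⟩ : TangentBundle 𝓘(ℝ, E) M)))
    {f h : M → ℂ} (hf : ContMDiff 𝓘(ℝ, E) 𝓘(ℝ, ℂ) ω f) (hh : ContMDiff 𝓘(ℝ, E) 𝓘(ℝ, ℂ) ω h)
    (α : List (Fin n)) :
    iterLieDeriv X α (f + h) = iterLieDeriv X α f + iterLieDeriv X α h := by
  induction α with
  | nil => rfl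
  | cons i α ih =>
    rw [iterLieDeriv_cons, ih, lieDeriv_add _
      ((contMDiff_iterLieDeriv hX hf α).mdifferentiable (by simp))
      ((contMDiff_iterLieDeriv hX hh α).mdifferentiable (by simp))]
    rfl

theorem iterLieDeriv_smul [IsManifold 𝓘(ℝ, E) ω M]
    {X : Fin n → ∀ x : M, TangentSpace 𝓘(ℝ, E) x}
    (hX : ∀ i, ContMDiff 𝓘(ℝ, E) 𝓘(ℝ, E).tangent ω
      (fun x => (⟨x, X i x⟩ : TangentBundle 𝓘(ℝ, E) M)))
    {f : M → ℂ} (hf : ContMDiff 𝓘(ℝ, E) 𝓘(ℝ, ℂ) ω f) (a : ℂ) (α : List (Fin n)) :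
    iterLieDeriv X α (a • f) = a • iterLieDeriv X α f := by
  induction α with
  | nil => rfl
  | cons i α ih =>
    rw [iterLieDeriv_cons, ih, lieDeriv_smul _ _
      ((contMDiff_iterLieDeriv hX hf α).mdifferentiable (by simp))]
    rfl

theorem majCoeff_add_le [IsManifold 𝓘(ℝ, E) ω M]
    {X : Fin n → ∀ x : M, TangentSpace 𝓘(ℝ, E) x}
    (hX : ∀ i, ContMDiff 𝓘(ℝ, E) 𝓘(ℝ, E).tangent ω
      (fun x => (⟨x, X i x⟩ : TangentBundle 𝓘(ℝ, E) M))) (e : M) (k : ℕ)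
    {f h : M → ℂ} (hf : ContMDiff 𝓘(ℝ, E) 𝓘(ℝ, ℂ) ω f)
    (hh : ContMDiff 𝓘(ℝ, E) 𝓘(ℝ, ℂ) ω h) :
    majCoeff X e k (f + h) ≤ majCoeff X e k f + majCoeff X e k h := by
  unfold majCoeff
  rw [← mul_add, ← Finset.sum_add_distrib]
  gcongr with α
  rw [iterLieDeriv_add hX hf hh]
  exact norm_add_le _ _

theorem majCoeff_smul [IsManifold 𝓘(ℝ, E) ω M]
    {X : Fin n → ∀ x : M, TangentSpace 𝓘(ℝ, E) x}
    (hX : ∀ i, ContMDiff 𝓘(ℝ, E) 𝓘(ℝ, E).tangent ω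
      (fun x => (⟨x, X i x⟩ : TangentBundle 𝓘(ℝ, E) M))) (e : M) (k : ℕ)
    {f : M → ℂ} (hf : ContMDiff 𝓘(ℝ, E) 𝓘(ℝ, ℂ) ω f) (a : ℂ) :
    majCoeff X e k (a • f) = ‖a‖ * majCoeff X e k f := by
  unfold majCoeff
  rw [mul_left_comm]
  congr 1
  rw [Finset.mul_sum]
  refine Finset.sum_congr rfl fun α _ => ?_
  rw [iterLieDeriv_smul hX hf, Pi.smul_apply, norm_smul]

end Entire

/-! ### The space of `R`-entire functions on a Lie group -/

section Group

variable {E : Type*} [NormedAddCommGroup E] [NormedSpace ℝ E]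
  {G : Type*} [TopologicalSpace G] [ChartedSpace E G] [Group G]

theorem contMDiff_invariantField [LieGroup 𝓘(ℝ, E) ω G] (v : GroupLieAlgebra 𝓘(ℝ, E) G) :
    ContMDiff 𝓘(ℝ, E) 𝓘(ℝ, E).tangent ω
      (fun g => (⟨g, mulInvariantVectorField v g⟩ : TangentBundle 𝓘(ℝ, E) G)) := by
  let fg : G → TangentBundle 𝓘(ℝ, E) G := fun g ↦ Bundle.TotalSpace.mk' E g 0
  have sfg : ContMDiff 𝓘(ℝ, E) 𝓘(ℝ, E).tangent ω fg := Bundle.contMDiff_zeroSection _ _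
  let fv : G → TangentBundle 𝓘(ℝ, E) G := fun _ ↦ Bundle.TotalSpace.mk' E 1 v
  have sfv : ContMDiff 𝓘(ℝ, E) 𝓘(ℝ, E).tangent ω fv := contMDiff_const
  let F₁ : G → (TangentBundle 𝓘(ℝ, E) G × TangentBundle 𝓘(ℝ, E) G) := fun g ↦ (fg g, fv g)
  have S₁ : ContMDiff 𝓘(ℝ, E) (𝓘(ℝ, E).tangent.prod 𝓘(ℝ, E).tangent) ω F₁ := sfg.prodMk sfv
  let F₂ : (TangentBundle 𝓘(ℝ, E) G × TangentBundle 𝓘(ℝ, E) G) →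
      TangentBundle (𝓘(ℝ, E).prod 𝓘(ℝ, E)) (G × G) :=
    (equivTangentBundleProd 𝓘(ℝ, E) G 𝓘(ℝ, E) G).symm
  have S₂ : ContMDiff (𝓘(ℝ, E).tangent.prod 𝓘(ℝ, E).tangent)
      (𝓘(ℝ, E).prod 𝓘(ℝ, E)).tangent ω F₂ := contMDiff_equivTangentBundleProd_symm
  let F₃ : TangentBundle (𝓘(ℝ, E).prod 𝓘(ℝ, E)) (G × G) → TangentBundle 𝓘(ℝ, E) G :=
    tangentMap (𝓘(ℝ, E).prod 𝓘(ℝ, E)) 𝓘(ℝ, E) (fun (p : G × G) ↦ p.1 * p.2)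
  have S₃ : ContMDiff (𝓘(ℝ, E).prod 𝓘(ℝ, E)).tangent 𝓘(ℝ, E).tangent ω F₃ :=
    (contMDiff_mul 𝓘(ℝ, E) ω).contMDiff_tangentMap (m := ω) le_rfl
  let S := (S₃.comp S₂).comp S₁
  convert! S with g
  · simp [F₁, F₂, F₃, fg, fv]
  · simp only [Function.comp_apply, tangentMap, F₃, F₂, F₁, fg, fv]
    rw [mfderiv_prod_eq_add_apply ((contMDiff_mul 𝓘(ℝ, E) ω).mdifferentiableAt (by simp))]
    change mfderiv 𝓘(ℝ, E) 𝓘(ℝ, E) (fun x => g * x) 1 v =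
      mfderiv 𝓘(ℝ, E) 𝓘(ℝ, E) (fun z : G => z * 1) g 0 +
        mfderiv 𝓘(ℝ, E) 𝓘(ℝ, E) (fun z => g * z) 1 v
    rw [ContinuousLinearMap.map_zero, zero_add]

variable {n : ℕ} (b : Basis (Fin n) ℝ (GroupLieAlgebra 𝓘(ℝ, E) G))

/-- The frame of left invariant vector fields on `G` given by a basis of the Lie algebra. -/
def leftFrame (i : Fin n) : ∀ g : G, TangentSpace 𝓘(ℝ, E) g :=
  mulInvariantVectorField (b i)

/-- The complex vector space of `R`-entire functions on the Lie group `G`. -/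
def EntireSpace [LieGroup 𝓘(ℝ, E) ω G] (R : ℝ) : Submodule ℂ (G → ℂ) where
  carrier := {f | IsREntire (leftFrame b) 1 R f}
  add_mem' {f h} hf hh := by
    refine ⟨hf.1.add hh.1, fun c hc => ?_⟩
    refine Summable.of_nonneg_of_le
      (fun k => mul_nonneg (mul_nonneg (by positivity) (majCoeff_nonneg _ _ _ _)) (by positivity))
      (fun k => ?_) ((hf.2 c hc).add (hh.2 c hc))
    rw [← add_mul, ← mul_add]
    gcongr
    exact majCoeff_add_le (fun i => contMDiff_invariantField (b i)) 1 k hf.1 hh.1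
  zero_mem' := by
    refine ⟨contMDiff_const, fun c hc => ?_⟩
    have h0 : ∀ k, majCoeff (leftFrame b) 1 k (0 : G → ℂ) = 0 := fun k => by
      have := majCoeff_smul (fun i => contMDiff_invariantField (b i)) (1 : G) k
        (f := (0 : G → ℂ)) contMDiff_const 0
      rw [norm_zero, zero_mul, zero_smul] at this
      exact this
    simp only [h0, mul_zero, zero_mul]
    exact summable_zero
  smul_mem' a f hf := by
    refine ⟨?_, fun c hc => ?_⟩
    · have h1 : ContMDiff 𝓘(ℝ, ℂ) 𝓘(ℝ, ℂ) ω (fun z : ℂ => a • z) :=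
        (a • ContinuousLinearMap.id ℝ ℂ).contDiff.contMDiff
      exact h1.comp hf.1
    refine ((hf.2 c hc).mul_left ‖a‖).congr fun k => ?_
    have := majCoeff_smul (fun i => contMDiff_invariantField (b i)) (1 : G) k hf.1 a
    unfold leftFrame at *
    rw [this]
    ring

/-- The seminorm `q_{R,c}(f) = ∑_k k!^R c_k(f) c^k` on the space of `R`-entire functions. -/
def entireSeminorm [LieGroup 𝓘(ℝ, E) ω G] (R : ℝ) (c : ℝ≥0) : Seminorm ℂ (EntireSpace b R) :=
  Seminorm.of
    (fun f => ∑' k : ℕ, (k.factorial : ℝ) ^ R * majCoeff (leftFrame b) 1 k (f : G → ℂ) * (c : ℝ) ^ k)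
    (fun f h => by
      rw [← (f.2.2 c c.2).tsum_add (h.2.2 c c.2)]
      refine ((f + h).2.2 c c.2).tsum_le_tsum (fun k => ?_)
        ((f.2.2 c c.2).add (h.2.2 c c.2))
      rw [← add_mul, ← mul_add]
      gcongr
      exact majCoeff_add_le (fun i => contMDiff_invariantField (b i)) 1 k f.2.1 h.2.1)
    (fun a f => by
      rw [← tsum_mul_left]
      refine tsum_congr fun k => ?_
      have := majCoeff_smul (fun i => contMDiff_invariantField (b i)) (1 : G) k f.2.1 a
      unfold leftFrame at *
      rw [Submodule.coe_smul, this]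
      ring)

end Group

/-! ### The symmetric algebra and its seminorms -/

section Sym

/-- The complexified Lie algebra, in coordinates with respect to the chosen basis and with the
corresponding `ℓ¹`-norm. -/
abbrev L1Space (n : ℕ) : Type := PiLp 1 (fun _ : Fin n => ℂ)

/-- The symmetric tensors inside the `k`-th tensor power. -/
def SymPower (n k : ℕ) : Submodule ℂ (⨂[ℂ] _ : Fin k, L1Space n) where
  carrier := {t | ∀ σ : Equiv.Perm (Fin k),
    PiTensorProduct.reindex ℂ (fun _ : Fin k => L1Space n) σ t = t}
  add_mem' ha hb σ := by rw [map_add, ha σ, hb σ]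
  zero_mem' σ := map_zero _
  smul_mem' a t ht σ := by rw [map_smul, ht σ]

/-- The symmetric algebra, as a vector space: the direct sum of the symmetric tensor powers. -/
abbrev SymAlg (n : ℕ) : Type := DirectSum ℕ fun k => SymPower n k

theorem finite_support_symSeminorm (n : ℕ) (R' : ℝ) (c : ℝ≥0) (v : SymAlg n) :
    (Function.support fun k : ℕ =>
      (k.factorial : ℝ) ^ R' * (c : ℝ) ^ k * ‖(v k : ⨂[ℂ] _ : Fin k, L1Space n)‖).Finite := by
  classical
  refine (DFinsupp.support v).finite_toSet.subset fun k hk => ?_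
  rw [Finset.mem_coe, DFinsupp.mem_support_toFun]
  rintro h0
  apply hk
  have h1 : v k = 0 := h0
  simp only [h1, Submodule.coe_zero, norm_zero, mul_zero]

/-- The seminorm `p_{R',c}(v) = ∑_k k!^{R'} c^k p^k(v_k)`, where `p^k` is the restriction to the
symmetric tensors of the `k`-th projective tensor power of the `ℓ¹`-norm. -/
def symSeminorm (n : ℕ) (R' : ℝ) (c : ℝ≥0) : Seminorm ℂ (SymAlg n) :=
  Seminorm.of
    (fun v => ∑ᶠ k : ℕ,
      (k.factorial : ℝ) ^ R' * (c : ℝ) ^ k * ‖(v k : ⨂[ℂ] _ : Fin k, L1Space n)‖)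
    (fun v w => by
      have hv := finite_support_symSeminorm n R' c v
      have hw := finite_support_symSeminorm n R' c w
      have hvw := finite_support_symSeminorm n R' c (v + w)
      rw [← finsum_add_distrib hv hw,
        finsum_eq_sum_of_support_subset (s := (hvw.union (hv.union hw)).toFinset) _ (by simp),
        finsum_eq_sum_of_support_subset (s := (hvw.union (hv.union hw)).toFinset) _ (by
          rw [Set.Finite.coe_toFinset]
          exact (Function.support_add _ _).trans Set.subset_union_right)]
      refine Finset.sum_le_sum fun k _ => ?_
      rw [← mul_add]
      gcongr
      rw [DirectSum.add_apply, Submodule.coe_add]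
      exact norm_add_le _ _)
    (fun a v => by
      rw [← smul_eq_mul, smul_finsum]
      refine finsum_congr fun k => ?_
      rw [DirectSum.smul_apply, Submodule.coe_smul, norm_smul, smul_eq_mul]
      ring)

/-- The linear form on the `k`-th tensor power induced by the linear form with coordinates `y`. -/
def evalTensor {n : ℕ} (y : Fin n → ℝ) (k : ℕ) : (⨂[ℂ] _ : Fin k, L1Space n) →ₗ[ℂ] ℂ :=
  PiTensorProduct.lift ((MultilinearMap.mkPiAlgebra ℂ (Fin k) ℂ).compLinearMap fun _ =>
    ∑ i, (y i : ℂ) • (PiLp.projₗ 1 (fun _ : Fin n => ℂ) i : L1Space n →ₗ[ℂ] ℂ))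

/-- Evaluation of an element of the symmetric algebra, viewed as a polynomial function on the dual
of the Lie algebra, at the linear form with coordinates `y`. -/
def evalSym {n : ℕ} (y : Fin n → ℝ) : SymAlg n →ₗ[ℂ] ℂ :=
  DirectSum.toModule ℂ ℕ ℂ fun k => (evalTensor y k).comp (SymPower n k).subtype

end Sym

/-! ### Projective tensor products -/

section Projective

variable {A B : Type*} [AddCommGroup A] [Module ℂ A] [AddCommGroup B] [Module ℂ B]

theorem projSeminorm_nonempty (t : A ⊗[ℂ] B) :
    Nonempty {l : List (A × B) // (l.map fun x => x.1 ⊗ₜ[ℂ] x.2).sum = t} := by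
  induction t with
  | zero => exact ⟨⟨[], by simp⟩⟩
  | tmul a b => exact ⟨⟨[(a, b)], by simp⟩⟩
  | add s t hs ht =>
    obtain ⟨l, hl⟩ := hs
    obtain ⟨m, hm⟩ := ht
    exact ⟨⟨l ++ m, by rw [List.map_append, List.sum_append, hl, hm]⟩⟩

theorem projSeminorm_nonneg (q : Seminorm ℂ A) (p : Seminorm ℂ B) (l : List (A × B)) :
    0 ≤ (l.map fun x => q x.1 * p x.2).sum := by
  refine List.sum_nonneg fun r hr => ?_
  obtain ⟨x, -, rfl⟩ := List.mem_map.1 hr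
  exact mul_nonneg (apply_nonneg q _) (apply_nonneg p _)

theorem projSeminorm_bddBelow (q : Seminorm ℂ A) (p : Seminorm ℂ B) (t : A ⊗[ℂ] B) :
    BddBelow (Set.range fun l : {l : List (A × B) // (l.map fun x => x.1 ⊗ₜ[ℂ] x.2).sum = t} =>
      (l.1.map fun x => q x.1 * p x.2).sum) :=
  ⟨0, by rintro _ ⟨l, rfl⟩; exact projSeminorm_nonneg q p l.1⟩

/-- The projective tensor product `q ⊗ p` of two seminorms:
`(q ⊗ p)(t) = inf { ∑ᵢ q(aᵢ) p(bᵢ) | t = ∑ᵢ aᵢ ⊗ bᵢ }`. -/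
def projSeminorm (q : Seminorm ℂ A) (p : Seminorm ℂ B) : Seminorm ℂ (A ⊗[ℂ] B) :=
  Seminorm.ofSMulLE
    (fun t => ⨅ l : {l : List (A × B) // (l.map fun x => x.1 ⊗ₜ[ℂ] x.2).sum = t},
      (l.1.map fun x => q x.1 * p x.2).sum)
    (le_antisymm (ciInf_le_of_le (projSeminorm_bddBelow q p 0) ⟨[], by simp⟩ (by simp))
      (Real.iInf_nonneg fun l => projSeminorm_nonneg q p l.1))
    (fun s t => by
      have := projSeminorm_nonempty s
      have := projSeminorm_nonempty t
      refine le_ciInf_add_ciInf fun l m => ?_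
      exact ciInf_le_of_le (projSeminorm_bddBelow q p (s + t))
        ⟨l.1 ++ m.1, by rw [List.map_append, List.sum_append, l.2, m.2]⟩ (by simp))
    (fun a t => by
      have := projSeminorm_nonempty t
      rw [Real.mul_iInf_of_nonneg (norm_nonneg a)]
      refine le_ciInf fun l => ?_
      refine ciInf_le_of_le (projSeminorm_bddBelow q p (a • t))
        ⟨l.1.map fun x => (a • x.1, x.2), ?_⟩ ?_
      · have h := congrArg (fun s => a • s) l.2
        rw [List.smul_sum, List.map_map] at h
        rw [List.map_map, ← h]
        rfl
      · rw [List.map_map, ← List.sum_map_mul_left]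
        refine le_of_eq (congrArg List.sum (List.map_congr_left fun x _ => ?_))
        simp only [Function.comp_apply, map_smul_eq_mul, mul_assoc])

end Projective

/-! ### The observable algebra and its completion -/

section Observables

variable {E : Type*} [NormedAddCommGroup E] [NormedSpace ℝ E]
  {G : Type*} [TopologicalSpace G] [ChartedSpace E G] [Group G] [LieGroup 𝓘(ℝ, E) ω G]
  {n : ℕ} (b : Basis (Fin n) ℝ (GroupLieAlgebra 𝓘(ℝ, E) G)) (R R' : ℝ)

/-- The polynomial observables: the tensor product of the space of `R`-entire functions on `G` and
the symmetric algebra.  Its uniform structure is that of the projective tensor product. -/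
@[nolint unusedArguments]
def Pol (b : Basis (Fin n) ℝ (GroupLieAlgebra 𝓘(ℝ, E) G)) (R _R' : ℝ) : Type _ :=
  EntireSpace b R ⊗[ℂ] SymAlg n

instance : AddCommGroup (Pol b R R') :=
  inferInstanceAs (AddCommGroup (EntireSpace b R ⊗[ℂ] SymAlg n))

instance : Module ℂ (Pol b R R') :=
  inferInstanceAs (Module ℂ (EntireSpace b R ⊗[ℂ] SymAlg n))

/-- The seminorms `q_{R,c} ⊗ p_{R',c'}` on the polynomial observables. -/
def polSeminorm (i : ℝ≥0 × ℝ≥0) : Seminorm ℂ (Pol b R R') :=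
  projSeminorm (entireSeminorm b R i.1) (symSeminorm n R' i.2)

/-- The uniform structure of the projective tensor product, induced by all the seminorms
`q_{R,c} ⊗ p_{R',c'}`. -/
instance : UniformSpace (Pol b R R') :=
  ⨅ i : ℝ≥0 × ℝ≥0, (polSeminorm b R R' i).toSeminormedAddCommGroup.toUniformSpace

instance : IsUniformAddGroup (Pol b R R') :=
  isUniformAddGroup_iInf fun i =>
    @SeminormedAddCommGroup.to_isUniformAddGroup _ (polSeminorm b R R' i).toSeminormedAddCommGroup

theorem pol_withSeminorms : WithSeminorms (polSeminorm b R R') :=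
  (SeminormFamily.withSeminorms_iff_uniformSpace_eq_iInf _).2 rfl

instance : UniformContinuousConstSMul ℂ (Pol b R R') :=
  haveI : ContinuousSMul ℂ (Pol b R R') := (pol_withSeminorms b R R').continuousSMul
  uniformContinuousConstSMul_of_continuousConstSMul ℂ (Pol b R R')

/-- The completed observable algebra: the (Hausdorff) completion of the polynomial observables. -/
abbrev PolCompletion : Type _ := UniformSpace.Completion (Pol b R R')

/-- Evaluation of a polynomial observable at a point `(g, η)` of `G × 𝔤*`, the left trivialized
cotangent bundle of `G`; on `φ ⊗ v` it is `φ(g)` times the value of the polynomial `v` at `η`.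
The Lie algebra `𝔤`, the tangent space at `1`, is by definition the model space `E`. -/
def polEval (g : G) (η : StrongDual ℝ E) : Pol b R R' →ₗ[ℂ] ℂ :=
  LinearMap.mul' ℂ ℂ ∘ₗ TensorProduct.map
    ((LinearMap.proj g : (G → ℂ) →ₗ[ℂ] ℂ) ∘ₗ (EntireSpace b R).subtype)
    (evalSym fun i => η (b i))

/-- The `i`-th vector of the basis of `𝔤*` dual to `b`. -/
def dualVec (i : Fin n) : StrongDual ℝ E :=
  haveI : FiniteDimensional ℝ E := Module.Finite.of_basis (M := E) b
  LinearMap.toContinuousLinearMap (𝕜 := ℝ) (E := E) (b.coord i)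

/-- The constant frame on `𝔤*` given by the dual basis: these are the invariant vector fields of
the abelian Lie group `𝔤*`. -/
def dualFrame (i : Fin n) : ∀ η : StrongDual ℝ E, TangentSpace 𝓘(ℝ, StrongDual ℝ E) η :=
  fun _ => dualVec b i

end Observables

end LieObs

end

noncomputable section

namespace LieObs

open Filter Topology
open scoped ENNReal

/-! ### Fatou's lemma for sums along a filter -/

/-! The completion is identified with a concrete weighted `ℓ¹`-space of coefficient families, and
every claim is read off from the coefficients.

Algebra: the projective tensor power of the `ℓ¹`-norm is the `ℓ¹`-norm of the tensor coefficients. A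
polynomial observable is a finite sum of terms `a_w ⊗ (symmetrized word w)`, and its seminorm
`q_{R,c} ⊗ p_{R',c'}` equals `∑_w k!^{R'} c'^k q_{R,c}(a_w)`, with `k` the length of `w`
(`ofReal_polSeminorm_le_familyNorm`, `familyNorm_polCoeff_le`). Ordinary projective tensor products
might lose injectivity on completion; an `ℓ¹`-factor rules this out.

Analysis: the seminorms on `G` see a function only through its derivatives at `1`, whereas
convergence is needed at every point. In the chart at `1` the left invariant frame has an analytic
dual coframe, so the Taylor majorant is bounded by the majorant along the frame
(`exists_taylorNorm_le_lieNorm`). This bounds values near `1`. Applied to all iterated derivatives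
it bounds the majorant at nearby points by that at `1`, with the radius enlarged by a fixed amount.
Left translation and connectedness spread the bound over `G` (`exists_lieNorm_le`). Hence limits
that are Cauchy for the seminorms are again analytic, and their Lie derivatives converge
(`contMDiff_and_tendsto_iterLieDeriv`).

For a Cauchy filter of observables, Fatou's lemma then gives a limit family with finite weighted
norms to which the coefficients converge in norm (`exists_limit_family`). The limit function is the
power series with these coefficients. Joint analyticity comes from the same Taylor estimates in the
chart times `𝔤*`; entireness on `𝔤*` from the word weights. If the limit function vanishes,
uniqueness of symmetric power series coefficients kills the family, so all seminorms tend to `0`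
along the filter: this is injectivity (`regularity_of_limit`). -/

theorem tsum_le_of_tendsto {ι κ : Type*} {l : Filter ι} [l.NeBot] {u : ι → κ → ℝ≥0∞}
    {v : κ → ℝ≥0∞} {M : ℝ≥0∞} (h : ∀ x, Tendsto (fun i => u i x) l (𝓝 (v x)))
    (hM : ∀ᶠ i in l, ∑' x, u i x ≤ M) : ∑' x, v x ≤ M := by
  rw [ENNReal.tsum_eq_iSup_sum]
  refine iSup_le fun s => ?_
  refine le_of_tendsto (tendsto_finsetSum s fun x _ => h x) ?_
  filter_upwards [hM] with i hi
  exact (ENNReal.sum_le_tsum s).trans hi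

/-! ### The majorant of the Taylor series of a function on a normed space -/

section Taylor

variable {V : Type*} [NormedAddCommGroup V] [NormedSpace ℝ V]
  {W : Type*} [NormedAddCommGroup W] [NormedSpace ℝ W]

/-- The coefficient `r ^ m / m!`. -/
def expCoeff (r : ℝ≥0) (m : ℕ) : ℝ≥0 := r ^ m / m.factorial

theorem expCoeff_ne_zero {r : ℝ≥0} (hr : r ≠ 0) (m : ℕ) : expCoeff r m ≠ 0 := by
  unfold expCoeff; positivity

/-- The value at radius `r` of the majorant `∑ ‖D^m F(x)‖ r ^ m / m!` of the Taylor series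
of `F` at `x`. -/
def taylorNorm (r : ℝ≥0) (F : V → W) (x : V) : ℝ≥0∞ :=
  ∑' m : ℕ, (expCoeff r m : ℝ≥0∞) * ‖iteratedFDeriv ℝ m F x‖ₑ

/-- The Taylor series of `F` at `x`. -/
def taylorFMS (d : ∀ m : ℕ, V [×m]→L[ℝ] W) : FormalMultilinearSeries ℝ V W :=
  fun m => ((m.factorial : ℝ)⁻¹) • d m

theorem enorm_taylorFMS_mul (d : ∀ m : ℕ, V [×m]→L[ℝ] W) (r : ℝ≥0) (m : ℕ) :
    ‖taylorFMS d m‖ₑ * (r : ℝ≥0∞) ^ m = expCoeff r m * ‖d m‖ₑ := by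
  simp only [enorm_eq_nnnorm, taylorFMS, nnnorm_smul, expCoeff]
  rw [← ENNReal.coe_pow, ← ENNReal.coe_mul, ← ENNReal.coe_mul]
  congr 1
  have h : ‖(m.factorial : ℝ)‖₊ = m.factorial := by ext; simp
  rw [nnnorm_inv, h]
  field_simp

theorem summable_of_tsum_enorm_ne_top {κ G : Type*} [SeminormedAddCommGroup G] {a : κ → G}
    (h : ∑' x, ‖a x‖ₑ ≠ ⊤) : Summable fun x => ‖a x‖ := by
  simp only [enorm_eq_nnnorm] at h
  exact NNReal.summable_coe.2 (ENNReal.tsum_coe_ne_top_iff_summable.1 h)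

theorem le_radius_taylorFMS {d : ∀ m : ℕ, V [×m]→L[ℝ] W} {r : ℝ≥0}
    (h : ∑' m, (expCoeff r m : ℝ≥0∞) * ‖d m‖ₑ ≠ ⊤) : (r : ℝ≥0∞) ≤ (taylorFMS d).radius := by
  refine FormalMultilinearSeries.le_radius_of_summable_nnnorm _ ?_
  rw [← ENNReal.tsum_coe_ne_top_iff_summable]
  refine ne_of_eq_of_ne (tsum_congr fun m => ?_) h
  rw [← enorm_taylorFMS_mul, enorm_eq_nnnorm, ENNReal.coe_mul, ENNReal.coe_pow]

theorem enorm_taylorFMS_apply_le (d : ∀ m : ℕ, V [×m]→L[ℝ] W) {r : ℝ≥0} {y : V} (hy : ‖y‖₊ ≤ r)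
    (m : ℕ) : ‖taylorFMS d m (fun _ => y)‖ₑ ≤ expCoeff r m * ‖d m‖ₑ := by
  rw [← enorm_taylorFMS_mul]
  simp only [enorm_eq_nnnorm]
  rw [← ENNReal.coe_pow, ← ENNReal.coe_mul]
  refine ENNReal.coe_le_coe.2 ?_
  have h := (taylorFMS d m).le_opNNNorm (fun _ => y)
  simp only [Finset.prod_const, Finset.card_univ, Fintype.card_fin] at h
  exact h.trans (by gcongr)

/-- An analytic function on a ball whose Taylor majorant is finite is the sum of its Taylor
series. -/
theorem hasFPowerSeriesOnBall_taylorFMS [CompleteSpace W] {F : V → W} {x : V} {r : ℝ≥0}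
    (hr : 0 < r) (hF : AnalyticOnNhd ℝ F (Metric.ball x r)) (h : taylorNorm r F x ≠ ⊤) :
    HasFPowerSeriesOnBall F (taylorFMS fun m => iteratedFDeriv ℝ m F x) x r := by
  set p := taylorFMS fun m => iteratedFDeriv ℝ m F x with hp
  have hrad : (r : ℝ≥0∞) ≤ p.radius := le_radius_taylorFMS h
  have hr' : (0 : ℝ≥0∞) < r := by exact_mod_cast hr
  have hS := (p.hasFPowerSeriesOnBall (hr'.trans_le hrad)).mono hr' hrad
  have hS' : HasFPowerSeriesOnBall (fun y => p.sum (y - x)) p x r := by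
    simpa using hS.comp_sub x
  obtain ⟨q, R, hq⟩ := hF x (Metric.mem_ball_self (by exact_mod_cast hr))
  have hloc : F =ᶠ[𝓝 x] fun y => p.sum (y - x) := by
    have hmem : Metric.eball x (min R r) ∈ 𝓝 x :=
      Metric.eball_mem_nhds _ (lt_min hq.r_pos hr')
    filter_upwards [hmem] with y hy
    have hy1 : y - x ∈ Metric.eball (0 : V) R := by
      have := Metric.eball_subset_eball (min_le_left _ _) hy
      simpa [edist_eq_enorm_sub] using this
    have hy2 : y - x ∈ Metric.eball (0 : V) r := by
      have : y ∈ Metric.eball x r := Metric.eball_subset_eball (min_le_right _ _) hy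
      rw [Metric.eball_coe] at this ⊢
      simpa [dist_eq_norm] using this
    have h1 := hq.hasSum_iteratedFDeriv hy1
    have h2 := hS.hasSum hy2
    simp only [zero_add, add_sub_cancel] at h1 h2
    exact h1.unique h2
  -- So far the Taylor series represents `F` only near `x`; the identity theorem on the convex ball
  -- extends this to the whole ball.
  have heq := hF.eqOn_of_preconnected_of_eventuallyEq (g := fun y => p.sum (y - x)) (by
    intro y hy
    refine hS'.analyticAt_of_mem ?_
    rwa [Metric.eball_coe]) (convex_ball x r).isPreconnected
    (Metric.mem_ball_self (by exact_mod_cast hr)) hloc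
  refine hS'.congr fun y hy => ?_
  rw [Metric.eball_coe] at hy
  exact (heq hy).symm

/-- A finite majorant makes the Taylor series converge to `F` on the ball; an infinite one bounds
everything. This is the passage from derivatives at one point to values nearby. -/
theorem enorm_le_taylorNorm [CompleteSpace W] {F : V → W} {x : V} {r : ℝ≥0}
    (hr : 0 < r) (hF : AnalyticOnNhd ℝ F (Metric.ball x r)) {y : V} (hy : y ∈ Metric.ball x r) :
    ‖F y‖ₑ ≤ taylorNorm r F x := by
  by_cases h : taylorNorm r F x = ⊤
  · simp [h]
  have hs := hasFPowerSeriesOnBall_taylorFMS hr hF h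
  have hy1 : y - x ∈ Metric.eball (0 : V) r := by
    rw [Metric.eball_coe]; simpa [dist_eq_norm] using hy
  have hy2 : ‖y - x‖₊ ≤ r := by
    rw [Metric.mem_ball, dist_eq_norm] at hy; exact_mod_cast hy.le
  have h2 := hs.hasSum hy1
  simp only [add_sub_cancel] at h2
  rw [← h2.tsum_eq]
  exact enorm_tsum_le_tsum_enorm.trans
    (ENNReal.tsum_le_tsum fun m => enorm_taylorFMS_apply_le _ hy2 m)

theorem iteratedFDeriv_sub_of_analyticAt [CompleteSpace W] {F G : V → W} {x : V}
    (hF : AnalyticAt ℝ F x) (hG : AnalyticAt ℝ G x) (m : ℕ) :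
    iteratedFDeriv ℝ m (F - G) x = iteratedFDeriv ℝ m F x - iteratedFDeriv ℝ m G x :=
  iteratedFDeriv_sub_apply (hF.contDiffAt.of_le le_top) (hG.contDiffAt.of_le le_top)

/-- A limit of analytic functions, Cauchy for the Taylor majorant, is analytic, and its first
derivative is the limit of the first derivatives. -/
theorem analyticAt_of_tendsto [CompleteSpace W] {ι : Type*} {l : Filter ι} [l.NeBot]
    {F : ι → V → W} {f : V → W} {x : V} {r : ℝ≥0} (hr : 0 < r)
    (hF : ∀ i, AnalyticOnNhd ℝ (F i) (Metric.ball x r)) (hfin : ∀ i, taylorNorm r (F i) x ≠ ⊤)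
    (hC : Tendsto (fun p : ι × ι => taylorNorm r (F p.1 - F p.2) x) (l ×ˢ l) (𝓝 0))
    (hlim : ∀ y ∈ Metric.ball x r, Tendsto (fun i => F i y) l (𝓝 (f y))) :
    AnalyticAt ℝ f x ∧
      ∀ v, Tendsto (fun i => fderiv ℝ (F i) x v) l (𝓝 (fderiv ℝ f x v)) := by
  have hx : x ∈ Metric.ball x r := Metric.mem_ball_self (by exact_mod_cast hr)
  have hsub : ∀ i j m, iteratedFDeriv ℝ m (F i - F j) x =
      iteratedFDeriv ℝ m (F i) x - iteratedFDeriv ℝ m (F j) x := fun i j m =>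
    iteratedFDeriv_sub_of_analyticAt (hF i x hx) (hF j x hx) m
  -- Each term of the majorant is at most the whole sum, so the `m`-th derivatives at `x` are Cauchy
  -- in a complete space of multilinear maps.
  have hlimd : ∀ m, ∃ d, Tendsto (fun i => iteratedFDeriv ℝ m (F i) x) l (𝓝 d) := by
    intro m
    refine (cauchy_map_iff_exists_tendsto).1 (cauchy_map_iff.2 ⟨inferInstance, ?_⟩)
    have hc0 : (expCoeff r m : ℝ≥0∞) ≠ 0 := by exact_mod_cast expCoeff_ne_zero hr.ne' m
    refine uniformity_basis_edist.tendsto_right_iff.2 fun ε hε => ?_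
    have h0 : (0 : ℝ≥0∞) < expCoeff r m * ε :=
      pos_iff_ne_zero.2 (mul_ne_zero hc0 hε.ne')
    filter_upwards [hC.eventually (gt_mem_nhds h0)] with p hp
    have h1 : (expCoeff r m : ℝ≥0∞) * ‖iteratedFDeriv ℝ m (F p.1 - F p.2) x‖ₑ <
        expCoeff r m * ε := (ENNReal.le_tsum m).trans_lt hp
    rw [hsub] at h1
    have h2 := lt_of_mul_lt_mul_left' h1
    simpa [edist_eq_enorm_sub] using h2
  choose d hd using hlimd
  -- `curry` freezes `i` while `j` runs to the limit; Fatou then replaces `F j` by the limit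
  -- derivatives `d`.
  have hfatou : ∀ ε : ℝ≥0∞, 0 < ε → ∀ᶠ i in l,
      ∑' m, (expCoeff r m : ℝ≥0∞) * ‖iteratedFDeriv ℝ m (F i) x - d m‖ₑ ≤ ε := by
    intro ε hε
    have h1 := (hC.eventually (gt_mem_nhds hε)).curry
    filter_upwards [h1] with i hi
    refine tsum_le_of_tendsto (l := l) (u := fun j m =>
      (expCoeff r m : ℝ≥0∞) * ‖iteratedFDeriv ℝ m (F i) x - iteratedFDeriv ℝ m (F j) x‖ₑ)
      (fun m => ?_) ?_
    · exact ENNReal.Tendsto.const_mul ((tendsto_const_nhds.sub (hd m)).enorm)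
        (Or.inr ENNReal.coe_ne_top)
    · filter_upwards [hi] with j hj
      simp only [← hsub]
      exact hj.le
  have hdfin : ∑' m, (expCoeff r m : ℝ≥0∞) * ‖d m‖ₑ ≠ ⊤ := by
    obtain ⟨i, hi⟩ := (hfatou 1 one_pos).exists
    refine ne_top_of_le_ne_top (ENNReal.add_ne_top.2 ⟨hfin i, ne_top_of_le_ne_top
      ENNReal.one_ne_top hi⟩) ?_
    rw [taylorNorm, ← ENNReal.tsum_add]
    refine ENNReal.tsum_le_tsum fun m => ?_
    rw [← mul_add]
    gcongr
    have := enorm_sub_le (a := iteratedFDeriv ℝ m (F i) x) (b := iteratedFDeriv ℝ m (F i) x - d m)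
    rwa [sub_sub_cancel] at this
  set q := taylorFMS d with hq
  have hrad := le_radius_taylorFMS hdfin
  have hr' : (0 : ℝ≥0∞) < r := by exact_mod_cast hr
  have hS := (q.hasFPowerSeriesOnBall (hr'.trans_le hrad)).mono hr' hrad
  have hS' : HasFPowerSeriesOnBall (fun y => q.sum (y - x)) q x r := by
    simpa using hS.comp_sub x
  have hf : HasFPowerSeriesOnBall f q x r := by
    refine hS'.congr fun y hy => ?_
    have hy0 : y ∈ Metric.ball x r := by rwa [Metric.eball_coe] at hy
    have hy1 : y - x ∈ Metric.eball (0 : V) r := by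
      rw [Metric.eball_coe]; simpa [dist_eq_norm] using hy0
    have hy2 : ‖y - x‖₊ ≤ r := by
      rw [Metric.mem_ball, dist_eq_norm] at hy0; exact_mod_cast hy0.le
    -- Both `f y` and the sum of the series `q` are limits of `F i y`, the latter because the error
    -- at `y` is at most the Taylor majorant bounded in `hfatou`.
    refine tendsto_nhds_unique ?_ (hlim y hy0)
    refine Metric.nhds_basis_eball.tendsto_right_iff.2 fun ε hε => ?_
    obtain ⟨δ, hδ, hδε⟩ := exists_between hε
    filter_upwards [hfatou δ hδ] with i hi
    have h1 := (hasFPowerSeriesOnBall_taylorFMS hr (hF i) (hfin i)).hasSum hy1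
    have h2 := hS.hasSum hy1
    simp only [add_sub_cancel, zero_add] at h1 h2
    have h3 := h1.sub h2
    rw [Metric.mem_eball, edist_eq_enorm_sub, ← h3.tsum_eq]
    refine lt_of_le_of_lt (enorm_tsum_le_tsum_enorm.trans
      ((ENNReal.tsum_le_tsum fun m => ?_).trans hi)) hδε
    have := enorm_taylorFMS_apply_le (fun m => iteratedFDeriv ℝ m (F i) x - d m) hy2 m
    simpa [taylorFMS, smul_sub, hq] using this
  refine ⟨hf.analyticAt, fun v => ?_⟩
  have h1 : fderiv ℝ f x v = d 1 (fun _ => v) := by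
    rw [hf.hasFPowerSeriesAt.fderiv_eq]
    simp only [hq, taylorFMS, Nat.factorial_one, Nat.cast_one, inv_one, one_smul]
    rw [continuousMultilinearCurryFin1_apply]
    congr 1
  have h2 : ∀ i, fderiv ℝ (F i) x v = iteratedFDeriv ℝ 1 (F i) x (fun _ => v) := fun i => by
    rw [iteratedFDeriv_one_apply]
  rw [h1]
  simp only [h2]
  exact ((ContinuousMultilinearMap.apply ℝ (fun _ : Fin 1 => V) W (fun _ => v)).continuous.tendsto
    (d 1)).comp (hd 1)

end Taylor

/-! ### Truncated Taylor majorants: algebraic rules and comparison along a frame. -/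

section TaylorSum

variable {V : Type*} [NormedAddCommGroup V] [NormedSpace ℝ V]
  {W : Type*} [NormedAddCommGroup W] [NormedSpace ℝ W]

/-- The partial sums of the majorant of the Taylor series of `F` at `x`. -/
def taylorSum (m : ℕ) (t : ℝ) (F : V → W) (x : V) : ℝ :=
  ∑ j ∈ Finset.range (m + 1), t ^ j / j.factorial * ‖iteratedFDeriv ℝ j F x‖

theorem taylorSum_nonneg {t : ℝ} (ht : 0 ≤ t) (m : ℕ) (F : V → W) (x : V) :
    0 ≤ taylorSum m t F x := by
  unfold taylorSum; positivity

theorem taylorSum_congr {F G : V → W} {x : V} (h : F =ᶠ[𝓝 x] G) (m : ℕ) (t : ℝ) :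
    taylorSum m t F x = taylorSum m t G x := by
  unfold taylorSum
  refine Finset.sum_congr rfl fun j _ => ?_
  rw [(h.iteratedFDeriv ℝ j).eq_of_nhds]

theorem ofReal_taylorSum (m : ℕ) (r : ℝ≥0) (F : V → W) (x : V) :
    ENNReal.ofReal (taylorSum m r F x) =
      ∑ j ∈ Finset.range (m + 1), (expCoeff r j : ℝ≥0∞) * ‖iteratedFDeriv ℝ j F x‖ₑ := by
  rw [taylorSum, ENNReal.ofReal_sum_of_nonneg fun _ _ => by positivity]
  refine Finset.sum_congr rfl fun j _ => ?_
  rw [ENNReal.ofReal_mul (by positivity), ofReal_norm]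
  congr 1
  rw [ENNReal.ofReal_eq_coe_nnreal (by positivity)]
  congr 1

theorem ofReal_taylorSum_le (m : ℕ) (r : ℝ≥0) (F : V → W) (x : V) :
    ENNReal.ofReal (taylorSum m r F x) ≤ taylorNorm r F x := by
  rw [ofReal_taylorSum]
  exact ENNReal.sum_le_tsum _

theorem taylorNorm_le {r : ℝ≥0} {F : V → W} {x : V} {M : ℝ≥0∞}
    (h : ∀ m, ENNReal.ofReal (taylorSum m r F x) ≤ M) : taylorNorm r F x ≤ M := by
  refine ENNReal.tsum_le_of_sum_range_le fun m => ?_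
  refine le_trans ?_ (h m)
  rw [ofReal_taylorSum]
  exact Finset.sum_le_sum_of_subset (Finset.range_mono (Nat.le_succ m))

/-- The Leibniz estimate is applied on an open neighbourhood where both factors are analytic; there
derivatives within the set are the ordinary ones. -/
theorem norm_iteratedFDeriv_smul_le_of_contDiffAt {F : V → ℂ} [NormedSpace ℂ W]
    [IsScalarTower ℝ ℂ W] {G : V → W} {x : V} (hF : ContDiffAt ℝ ω F x)
    (hG : ContDiffAt ℝ ω G x) (n : ℕ) :
    ‖iteratedFDeriv ℝ n (fun y => F y • G y) x‖ ≤ ∑ i ∈ Finset.range (n + 1),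
      (n.choose i : ℝ) * ‖iteratedFDeriv ℝ i F x‖ * ‖iteratedFDeriv ℝ (n - i) G x‖ := by
  have h := (hF.eventually (by simp)).and (hG.eventually (by simp))
  obtain ⟨u, hu, huo, hxu⟩ := eventually_nhds_iff.1 h
  have := norm_iteratedFDerivWithin_smul_le (𝕜 := ℝ) (s := u) (N := ω)
    (fun y hy => (hu y hy).1.contDiffWithinAt) (fun y hy => (hu y hy).2.contDiffWithinAt)
    huo.uniqueDiffOn hxu (n := n) le_top
  simpa only [iteratedFDerivWithin_of_isOpen _ huo hxu] using this

/-- By Leibniz, dividing by factorials turns the derivatives of a product into a Cauchy product. Its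
truncation runs over a triangle inside the square of the product of truncations. -/
theorem taylorSum_smul_le {F : V → ℂ} [NormedSpace ℂ W] [IsScalarTower ℝ ℂ W] {G : V → W} {x : V}
    (hF : ContDiffAt ℝ ω F x) (hG : ContDiffAt ℝ ω G x) (m : ℕ) {t : ℝ} (ht : 0 ≤ t) :
    taylorSum m t (fun y => F y • G y) x ≤ taylorSum m t F x * taylorSum m t G x := by
  let a : ℕ → ℝ := fun j => t ^ j / j.factorial * ‖iteratedFDeriv ℝ j F x‖
  let b : ℕ → ℝ := fun j => t ^ j / j.factorial * ‖iteratedFDeriv ℝ j G x‖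
  have ha : ∀ j, 0 ≤ a j := fun j => by positivity
  have hb : ∀ j, 0 ≤ b j := fun j => by positivity
  calc taylorSum m t (fun y => F y • G y) x
      ≤ ∑ j ∈ Finset.range (m + 1), ∑ i ∈ Finset.range (j + 1), a i * b (j - i) := by
        refine Finset.sum_le_sum fun j _ => ?_
        refine (mul_le_mul_of_nonneg_left (norm_iteratedFDeriv_smul_le_of_contDiffAt hF hG j)
          (by positivity)).trans (le_of_eq ?_)
        rw [Finset.mul_sum]
        refine Finset.sum_congr rfl fun i hi => ?_
        have hij : i ≤ j := Nat.lt_succ_iff.1 (Finset.mem_range.1 hi)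
        have h1 : t ^ j = t ^ i * t ^ (j - i) := by rw [← pow_add, Nat.add_sub_cancel' hij]
        have h2 : ((j.choose i : ℕ) : ℝ) * (i.factorial * (j - i).factorial) = j.factorial := by
          rw [← mul_assoc]; exact_mod_cast Nat.choose_mul_factorial_mul_factorial hij
        simp only [a, b]
        rw [h1, ← h2]
        have h3 : ((j.choose i : ℕ) : ℝ) ≠ 0 := by exact_mod_cast (Nat.choose_pos hij).ne'
        field_simp
    _ = ∑ i ∈ Finset.range (m + 1), ∑ k ∈ Finset.range (m + 1 - i), a i * b k :=
        Finset.sum_range_diag_flip (m + 1) fun i k => a i * b k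
    _ ≤ ∑ i ∈ Finset.range (m + 1), ∑ k ∈ Finset.range (m + 1), a i * b k := by
        refine Finset.sum_le_sum fun i _ => ?_
        exact Finset.sum_le_sum_of_subset_of_nonneg (Finset.range_mono (Nat.sub_le _ _))
          fun k _ _ => mul_nonneg (ha i) (hb k)
    _ = taylorSum m t F x * taylorSum m t G x := (Finset.sum_mul_sum _ _ _ _).symm

theorem taylorSum_sum_le {κ : Type*} (s : Finset κ) {F : κ → V → W} {x : V}
    (hF : ∀ i ∈ s, ContDiffAt ℝ ω (F i) x) (m : ℕ) {t : ℝ} (ht : 0 ≤ t) :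
    taylorSum m t (fun y => ∑ i ∈ s, F i y) x ≤ ∑ i ∈ s, taylorSum m t (F i) x := by
  unfold taylorSum
  rw [Finset.sum_comm]
  refine Finset.sum_le_sum fun j _ => ?_
  rw [iteratedFDeriv_fun_sum_apply fun i hi => (hF i hi).of_le le_top, ← Finset.mul_sum]
  gcongr
  exact norm_sum_le _ _

theorem taylorNorm_mul_le {F G : V → ℂ} {x : V} (hF : ContDiffAt ℝ ω F x)
    (hG : ContDiffAt ℝ ω G x) (r : ℝ≥0) :
    taylorNorm r (fun y => F y * G y) x ≤ taylorNorm r F x * taylorNorm r G x := by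
  refine taylorNorm_le fun m => ?_
  refine (ENNReal.ofReal_le_ofReal (taylorSum_smul_le hF hG m r.2)).trans ?_
  rw [ENNReal.ofReal_mul (taylorSum_nonneg r.2 _ _ _)]
  exact mul_le_mul' (ofReal_taylorSum_le _ _ _ _) (ofReal_taylorSum_le _ _ _ _)

theorem taylorNorm_sum_le {κ : Type*} (s : Finset κ) {F : κ → V → W} {x : V}
    (hF : ∀ i ∈ s, ContDiffAt ℝ ω (F i) x) (r : ℝ≥0) :
    taylorNorm r (fun y => ∑ i ∈ s, F i y) x ≤ ∑ i ∈ s, taylorNorm r (F i) x := by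
  refine taylorNorm_le fun m => ?_
  refine (ENNReal.ofReal_le_ofReal (taylorSum_sum_le s hF m r.2)).trans ?_
  rw [ENNReal.ofReal_sum_of_nonneg fun _ _ => taylorSum_nonneg r.2 _ _ _]
  exact Finset.sum_le_sum fun i _ => ofReal_taylorSum_le _ _ _ _

theorem taylorNorm_comp_clm_le {U : Type*} [NormedAddCommGroup U] [NormedSpace ℝ U]
    {F : V → W} (L : U →L[ℝ] V) (hL : ‖L‖ ≤ 1) {x : U} (hF : ContDiffAt ℝ ω F (L x)) (r : ℝ≥0) :
    taylorNorm r (fun y => F (L y)) x ≤ taylorNorm r F (L x) := by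
  refine ENNReal.tsum_le_tsum fun m => ?_
  gcongr
  have h := hF.eventually (by simp)
  obtain ⟨u, hu, huo, hxu⟩ := eventually_nhds_iff.1 h
  have h1 := L.iteratedFDerivWithin_comp_right (f := F) (s := u) (n := ω) (i := m)
    (fun y hy => (hu y hy).contDiffWithinAt) huo.uniqueDiffOn
    (huo.preimage L.continuous).uniqueDiffOn (x := x) hxu le_top
  rw [iteratedFDerivWithin_of_isOpen _ huo hxu,
    iteratedFDerivWithin_of_isOpen _ (huo.preimage L.continuous) hxu] at h1
  have h2 : ‖iteratedFDeriv ℝ m (F ∘ L) x‖ ≤ ‖iteratedFDeriv ℝ m F (L x)‖ := by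
    rw [h1]
    refine ((iteratedFDeriv ℝ m F (L x)).norm_compContinuousLinearMap_le _).trans ?_
    refine mul_le_of_le_one_right (norm_nonneg _) ?_
    simp only [Finset.prod_const]
    exact pow_le_one₀ (norm_nonneg _) hL
  rw [← ofReal_norm, ← ofReal_norm]
  exact ENNReal.ofReal_le_ofReal h2

/-- Only the orders zero and one contribute, since the derivative of a linear map is constant. -/
theorem taylorNorm_clm_le (L : V →L[ℝ] W) (x : V) (r : ℝ≥0) :
    taylorNorm r (fun y => L y) x ≤ ‖L x‖ₑ + r * ‖L‖ₑ := by
  have hz : ∀ m, 2 ≤ m → iteratedFDeriv ℝ m (fun y => L y) x = 0 := by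
    intro m hm
    obtain ⟨k, rfl⟩ := Nat.exists_eq_add_of_le' hm
    ext v
    rw [iteratedFDeriv_succ_apply_right]
    have : (fderiv ℝ fun y => L y) = fun _ => L := by ext1 y; exact L.fderiv
    rw [this, iteratedFDeriv_succ_const]
    simp
  rw [taylorNorm, tsum_eq_sum (s := Finset.range 2)]
  · rw [Finset.sum_range_succ, Finset.sum_range_one]
    refine add_le_add (le_of_eq ?_) (le_of_eq ?_)
    · simp only [expCoeff, pow_zero, Nat.factorial_zero, Nat.cast_one, div_one, ENNReal.coe_one,
        one_mul, enorm_eq_nnnorm, ENNReal.coe_inj]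
      ext
      simp
    · simp only [expCoeff, pow_one, Nat.factorial_one, Nat.cast_one, div_one]
      congr 1
      rw [← ofReal_norm, ← ofReal_norm, ← zero_add 1,
        ← norm_iteratedFDeriv_fderiv, norm_iteratedFDeriv_zero]
      congr 2
      exact L.fderiv
  · intro m hm
    rw [hz m (not_lt.1 fun h => hm (Finset.mem_range.2 h)), enorm_eq_nnnorm, nnnorm_zero]
    simp

theorem taylorNorm_const (a : W) (x : V) (r : ℝ≥0) : taylorNorm r (fun _ : V => a) x = ‖a‖ₑ := by
  rw [taylorNorm, tsum_eq_single 0]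
  · simp only [expCoeff, pow_zero, Nat.factorial_zero, Nat.cast_one, div_one, ENNReal.coe_one,
        one_mul, enorm_eq_nnnorm, ENNReal.coe_inj]
    ext
    simp
  · rintro (_ | m) hm
    · exact absurd rfl hm
    · rw [iteratedFDeriv_succ_const, enorm_eq_nnnorm, Pi.zero_apply, nnnorm_zero]; simp

/-- The Taylor majorant of an analytic function is finite for small radii. -/
theorem exists_taylorNorm_ne_top [CompleteSpace W] {F : V → W} {x : V} (hF : AnalyticAt ℝ F x) :
    ∃ r : ℝ≥0, 0 < r ∧ taylorNorm r F x ≠ ⊤ := by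
  obtain ⟨p, R, hp⟩ := hF
  have hR : 0 < p.radius := hp.r_pos.trans_le hp.r_le
  obtain ⟨r, hr0, hr⟩ := ENNReal.lt_iff_exists_nnreal_btwn.1 hR
  refine ⟨r, by exact_mod_cast hr0, ?_⟩
  have hs := p.summable_nnnorm_mul_pow hr
  refine ne_top_of_le_ne_top (ENNReal.tsum_coe_ne_top_iff_summable.2 hs) ?_
  refine ENNReal.tsum_le_tsum fun m => ?_
  -- The `m`-th derivative is `p m` summed over all permutations of its arguments, which gives `m!`
  -- terms even if `p m` is not symmetric.
  have h1 : ‖iteratedFDeriv ℝ m F x‖ ≤ m.factorial * ‖p m‖ := by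
    refine ContinuousMultilinearMap.opNorm_le_bound (by positivity) fun v => ?_
    rw [hp.iteratedFDeriv_eq_sum_of_completeSpace]
    refine (norm_sum_le _ _).trans ?_
    have h2 : ∀ σ ∈ (Finset.univ : Finset (Equiv.Perm (Fin m))),
        ‖p m fun i => v (σ i)‖ ≤ ‖p m‖ * ∏ i, ‖v i‖ := by
      intro σ _
      refine ((p m).le_opNorm _).trans (le_of_eq ?_)
      rw [Equiv.prod_comp σ fun i => ‖v i‖]
    refine (Finset.sum_le_sum h2).trans (le_of_eq ?_)
    rw [Finset.sum_const, Finset.card_univ, Fintype.card_perm, Fintype.card_fin, nsmul_eq_mul]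
    ring
  rw [enorm_eq_nnnorm, ← ENNReal.coe_mul]
  refine ENNReal.coe_le_coe.2 ?_
  rw [← NNReal.coe_le_coe]
  simp only [expCoeff, NNReal.coe_mul, NNReal.coe_div, NNReal.coe_pow, NNReal.coe_natCast,
    coe_nnnorm]
  calc (r : ℝ) ^ m / m.factorial * ‖iteratedFDeriv ℝ m F x‖
      ≤ (r : ℝ) ^ m / m.factorial * (m.factorial * ‖p m‖) := by gcongr
    _ = ‖p m‖ * r ^ m := by field_simp

theorem taylorNorm_mono {r s : ℝ≥0} (h : r ≤ s) (F : V → W) (x : V) :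
    taylorNorm r F x ≤ taylorNorm s F x := by
  refine ENNReal.tsum_le_tsum fun m => ?_
  gcongr
  unfold expCoeff
  gcongr

/-- Differentiating in the radius amounts to differentiating `F`. This allows two majorants to be
compared through a differential inequality in `t`. -/
theorem hasDerivAt_taylorSum (m : ℕ) (F : V → W) (x : V) (t : ℝ) :
    HasDerivAt (fun t => taylorSum (m + 1) t F x) (taylorSum m t (fderiv ℝ F) x) t := by
  have h : ∀ j ∈ Finset.range (m + 1), HasDerivAt
      (fun t : ℝ => t ^ (j + 1) / (j + 1).factorial * ‖iteratedFDeriv ℝ (j + 1) F x‖)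
      (t ^ j / j.factorial * ‖iteratedFDeriv ℝ j (fderiv ℝ F) x‖) t := by
    intro j _
    rw [norm_iteratedFDeriv_fderiv]
    convert! ((hasDerivAt_pow (j + 1) t).div_const ((j + 1).factorial : ℝ)).mul_const
      ‖iteratedFDeriv ℝ (j + 1) F x‖ using 1
    rw [Nat.factorial_succ]
    push_cast
    have h1 : (j : ℝ) + 1 ≠ 0 := by positivity
    have h2 : (j.factorial : ℝ) ≠ 0 := by positivity
    field_simp
  have h2 := (HasDerivAt.fun_sum h).add_const ‖iteratedFDeriv ℝ 0 F x‖
  refine h2.congr_of_eventuallyEq (Eventually.of_forall fun s => ?_)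
  simp [taylorSum, Finset.sum_range_succ' _ (m + 1)]

/-- Comparison of the Taylor majorants of a family of functions that is closed under the
derivatives along a frame, with the values of the iterated derivatives along that frame. -/
theorem taylorSum_le_of_frame {𝓕 : Type*} {n : ℕ} (F : 𝓕 → V → ℂ) (D : Fin n → 𝓕 → 𝓕)
    (θ : Fin n → V → V →L[ℝ] ℂ) {x : V} (hF : ∀ f, ContDiffAt ℝ ω (F f) x)
    (hθ : ∀ i, ContDiffAt ℝ ω (θ i) x)
    (hd : ∀ f, fderiv ℝ (F f) =ᶠ[𝓝 x] fun y => ∑ i, F (D i f) y • θ i y)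
    {r M : ℝ≥0} (hM : ∀ i, taylorNorm r (θ i) x ≤ M) (a : ℕ → 𝓕 → ℝ)
    (ha0 : ∀ f, a 0 f = ‖F f x‖) (ha : ∀ (k : ℕ) f, ((k : ℝ) + 1) * a (k + 1) f = ∑ i, a k (D i f))
    (m : ℕ) : ∀ (f : 𝓕) (t : ℝ), 0 ≤ t → t ≤ r →
      taylorSum m t (F f) x ≤ ∑ k ∈ Finset.range (m + 1), a k f * (M * t) ^ k := by
  induction m with
  | zero => intro f t _ _; simp [taylorSum, ha0]
  | succ m ih =>
    intro f t ht htr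
    have hθM : ∀ i (s : ℝ), 0 ≤ s → s ≤ r → taylorSum m s (θ i) x ≤ M := by
      intro i s hs hsr
      lift s to ℝ≥0 using hs
      have := (ofReal_taylorSum_le m s (θ i) x).trans
        ((taylorNorm_mono (by exact_mod_cast hsr) _ _).trans (hM i))
      rw [← ENNReal.ofReal_coe_nnreal] at this
      exact (ENNReal.ofReal_le_ofReal_iff M.2).1 this
    have hB : ∀ s, HasDerivAt (fun s : ℝ => ∑ k ∈ Finset.range (m + 1 + 1), a k f * (M * s) ^ k)
        (M * ∑ i, ∑ k ∈ Finset.range (m + 1), a k (D i f) * (M * s) ^ k) s := by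
      intro s
      have h : ∀ k ∈ Finset.range (m + 1), HasDerivAt
          (fun s : ℝ => a (k + 1) f * (M * s) ^ (k + 1))
          (M * ∑ i, a k (D i f) * (M * s) ^ k) s := by
        intro k _
        have h1 := ((((hasDerivAt_id s).const_mul (M : ℝ)).pow (k + 1)).const_mul (a (k + 1) f))
        convert! h1 using 1
        rw [← Finset.sum_mul, ← ha]
        simp
        ring
      have h2 := (HasDerivAt.fun_sum h).add_const (a 0 f)
      rw [Finset.sum_comm, Finset.mul_sum]
      refine h2.congr_of_eventuallyEq (Eventually.of_forall fun s => ?_)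
      simp [Finset.sum_range_succ' _ (m + 1)]
    -- Both sides equal `a 0 f` at radius `0`. The frame expansion, the product estimate and the
    -- induction hypothesis bound the derivative of the left side by that of the right side.
    refine image_le_of_deriv_right_le_deriv_boundary (a := 0) (b := r)
      (f := fun t => taylorSum (m + 1) t (F f) x)
      (f' := fun s => taylorSum m s (fderiv ℝ (F f)) x)
      (fun s _ => (hasDerivAt_taylorSum m (F f) x s).continuousAt.continuousWithinAt)
      (fun s _ => (hasDerivAt_taylorSum m (F f) x s).hasDerivWithinAt)
      (B := fun s => ∑ k ∈ Finset.range (m + 1 + 1), a k f * (M * s) ^ k) ?_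
      (fun s _ => (hB s).continuousAt.continuousWithinAt)
      (fun s _ => (hB s).hasDerivWithinAt) (fun s hs => ?_) ⟨ht, htr⟩
    · simp [taylorSum, Finset.sum_range_succ' _ (m + 1), ha0]
    · rw [taylorSum_congr (hd f), Finset.mul_sum]
      refine (taylorSum_sum_le _ (fun i _ => (hF _).smul (hθ i)) m hs.1).trans ?_
      refine Finset.sum_le_sum fun i _ => ?_
      refine (taylorSum_smul_le (hF _) (hθ i) m hs.1).trans ?_
      rw [mul_comm]
      exact mul_le_mul (hθM i s hs.1 hs.2.le) (ih _ s hs.1 hs.2.le)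
        (taylorSum_nonneg hs.1 _ _ _) M.2

end TaylorSum

/-! ### Iterated derivatives indexed by words, and the majorant at a point. -/

section Words

variable {E : Type*} [NormedAddCommGroup E] [NormedSpace ℝ E]
  {M : Type*} [TopologicalSpace M] [ChartedSpace E M] {n : ℕ}
  (X : Fin n → ∀ x : M, TangentSpace 𝓘(ℝ, E) x)

theorem iterLieDeriv_append (α β : List (Fin n)) (f : M → ℂ) :
    iterLieDeriv X (α ++ β) f = iterLieDeriv X α (iterLieDeriv X β f) := by
  simp [iterLieDeriv]

theorem iterLieDeriv_ofFn_snoc {k : ℕ} (α : Fin k → Fin n) (i : Fin n) (f : M → ℂ) :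
    iterLieDeriv X (List.ofFn (Fin.snoc α i : Fin (k + 1) → Fin n)) f =
      iterLieDeriv X (List.ofFn α) (lieDeriv (X i) f) := by
  rw [List.ofFn_succ', List.concat_eq_append, iterLieDeriv_append]
  simp only [Fin.snoc_castSucc, Fin.snoc_last]
  rfl

theorem sum_word_succ {A : Type*} [AddCommMonoid A] {k : ℕ} (F : (Fin (k + 1) → Fin n) → A) :
    ∑ α, F α = ∑ i, ∑ β : Fin k → Fin n, F (Fin.snoc β i) := by
  rw [← Fintype.sum_prod_type' (f := fun (i : Fin n) (β : Fin k → Fin n) => F (Fin.snoc β i))]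
  exact (Fintype.sum_equiv (Fin.snocEquiv fun _ : Fin (k + 1) => Fin n) _ _ fun _ => rfl).symm

theorem majCoeff_zero (g : M) (f : M → ℂ) : majCoeff X g 0 f = ‖f g‖ := by
  simp [majCoeff, iterLieDeriv]

/-- Words are grouped by their last letter, the derivative that acts first on `f`; one factor of the
factorial cancels. This is the recursion required by `taylorSum_le_of_frame`. -/
theorem majCoeff_succ (g : M) (k : ℕ) (f : M → ℂ) :
    ((k : ℝ) + 1) * majCoeff X g (k + 1) f = ∑ i, majCoeff X g k (lieDeriv (X i) f) := by
  simp only [majCoeff]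
  rw [sum_word_succ, ← Finset.mul_sum, Nat.factorial_succ]
  simp only [iterLieDeriv_ofFn_snoc]
  push_cast
  field_simp

/-- Every word of length `j + k` is uniquely a word of length `j` followed by one of length `k`; the
quotient of factorials corrects the normalizations. -/
theorem sum_majCoeff_iterLieDeriv (g : M) (j k : ℕ) (f : M → ℂ) :
    ∑ α : Fin k → Fin n, majCoeff X g j (iterLieDeriv X (List.ofFn α) f) =
      (j + k).factorial / j.factorial * majCoeff X g (j + k) f := by
  induction k generalizing f with
  | zero =>
    have h : (j.factorial : ℝ) ≠ 0 := by positivity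
    simp [iterLieDeriv, div_self h]
  | succ k ih =>
    rw [sum_word_succ]
    simp only [iterLieDeriv_ofFn_snoc, ih]
    rw [← Finset.mul_sum, ← majCoeff_succ, ← add_assoc, Nat.factorial_succ]
    push_cast
    ring

/-- The majorant of `f` at `g`. -/
def lieNorm (c : ℝ≥0) (f : M → ℂ) (g : M) : ℝ≥0∞ :=
  ∑' k : ℕ, ENNReal.ofReal (majCoeff X g k f * (c : ℝ) ^ k)

theorem enorm_le_lieNorm (c : ℝ≥0) (f : M → ℂ) (g : M) : ‖f g‖ₑ ≤ lieNorm X c f g := by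
  have h := ENNReal.le_tsum (f := fun k : ℕ => ENNReal.ofReal (majCoeff X g k f * (c : ℝ) ^ k)) 0
  rw [majCoeff_zero, pow_zero, mul_one, ofReal_norm] at h
  exact h

/-- A derivative shifts the coefficients and costs a factor `k + 1`. A larger radius absorbs it,
because `(k + 1) c ^ k` is one term of the binomial expansion of `(c + 1) ^ (k + 1)`. -/
theorem lieNorm_lieDeriv_le (c : ℝ≥0) (f : M → ℂ) (g : M) (i : Fin n) :
    lieNorm X c (lieDeriv (X i) f) g ≤ lieNorm X (c + 1) f g := by
  have h1 : ∀ k, ENNReal.ofReal (majCoeff X g k (lieDeriv (X i) f) * (c : ℝ) ^ k) ≤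
      ENNReal.ofReal (majCoeff X g (k + 1) f * ((c + 1 : ℝ≥0) : ℝ) ^ (k + 1)) := by
    intro k
    refine ENNReal.ofReal_le_ofReal ?_
    have h2 : majCoeff X g k (lieDeriv (X i) f) ≤ ((k : ℝ) + 1) * majCoeff X g (k + 1) f := by
      rw [majCoeff_succ]
      exact Finset.single_le_sum (f := fun i => majCoeff X g k (lieDeriv (X i) f))
        (fun j _ => majCoeff_nonneg X g k _) (Finset.mem_univ i)
    have h3 : ((k : ℝ) + 1) * (c : ℝ) ^ k ≤ ((c + 1 : ℝ≥0) : ℝ) ^ (k + 1) := by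
      have hc : (0 : ℝ) ≤ c := c.2
      push_cast
      rw [add_pow]
      refine le_trans (le_of_eq ?_) (Finset.single_le_sum (f := fun m =>
        (c : ℝ) ^ m * 1 ^ (k + 1 - m) * ((k + 1).choose m : ℝ)) (fun m _ => by positivity)
        (Finset.mem_range.2 (show k < k + 1 + 1 by omega)))
      simp [mul_comm]
    calc majCoeff X g k (lieDeriv (X i) f) * (c : ℝ) ^ k
        ≤ (((k : ℝ) + 1) * majCoeff X g (k + 1) f) * (c : ℝ) ^ k := by gcongr
      _ = majCoeff X g (k + 1) f * (((k : ℝ) + 1) * (c : ℝ) ^ k) := by ring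
      _ ≤ _ := mul_le_mul_of_nonneg_left h3 (majCoeff_nonneg X g _ f)
  refine (ENNReal.tsum_le_tsum h1).trans ?_
  exact ENNReal.tsum_comp_le_tsum_of_injective (add_left_injective 1)
    fun k => ENNReal.ofReal (majCoeff X g k f * ((c + 1 : ℝ≥0) : ℝ) ^ k)

/-- If the values at `g` of the iterated derivatives of `f` are bounded by their majorants at `e`,
then so is the majorant of `f` at `g`. -/
theorem lieNorm_le_of_iterLieDeriv {f : M → ℂ} {g e : M} {d : ℝ≥0}
    (h : ∀ α, ‖iterLieDeriv X α f g‖ₑ ≤ lieNorm X d (iterLieDeriv X α f) e) (c : ℝ≥0) :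
    lieNorm X c f g ≤ lieNorm X (c + d) f e := by
  have h1 : ∀ k : ℕ, ENNReal.ofReal (majCoeff X g k f * (c : ℝ) ^ k) ≤
      ∑' j : ℕ, ENNReal.ofReal (((j + k).choose k : ℝ) * d ^ j * c ^ k *
        majCoeff X e (j + k) f) := by
    intro k
    have h2 : ENNReal.ofReal (∑ α : Fin k → Fin n, ‖iterLieDeriv X (List.ofFn α) f g‖) ≤
        ∑' j : ℕ, ENNReal.ofReal ((j + k).factorial / j.factorial * majCoeff X e (j + k) f *
          d ^ j) := by
      rw [ENNReal.ofReal_sum_of_nonneg fun _ _ => norm_nonneg _]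
      simp only [ofReal_norm]
      refine (Finset.sum_le_sum fun α _ => h (List.ofFn α)).trans ?_
      simp only [lieNorm]
      rw [← Summable.tsum_finsetSum fun _ _ => ENNReal.summable]
      refine ENNReal.tsum_le_tsum fun j => ?_
      rw [← ENNReal.ofReal_sum_of_nonneg fun _ _ =>
        mul_nonneg (majCoeff_nonneg _ _ _ _) (by positivity), ← Finset.sum_mul,
        sum_majCoeff_iterLieDeriv]
    have h3 : majCoeff X g k f * (c : ℝ) ^ k = ((k.factorial : ℝ)⁻¹ * (c : ℝ) ^ k) *
        ∑ α : Fin k → Fin n, ‖iterLieDeriv X (List.ofFn α) f g‖ := by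
      rw [majCoeff]; ring
    rw [h3, ENNReal.ofReal_mul (by positivity)]
    refine (mul_le_mul_right h2 _).trans ?_
    rw [← ENNReal.tsum_mul_left]
    refine ENNReal.tsum_le_tsum fun j => ?_
    rw [← ENNReal.ofReal_mul (by positivity)]
    refine ENNReal.ofReal_le_ofReal (le_of_eq ?_)
    rw [Nat.cast_choose ℝ (Nat.le_add_left k j), Nat.add_sub_cancel]
    field_simp
  refine (ENNReal.tsum_le_tsum h1).trans ?_
  -- Regrouped along the antidiagonals `j + k = m`, the weights `(j + k choose k) d ^ j c ^ k` add
  -- up to `(c + d) ^ m`.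
  rw [← ENNReal.tsum_prod (f := fun k j : ℕ => ENNReal.ofReal (((j + k).choose k : ℝ) *
    d ^ j * c ^ k * majCoeff X e (j + k) f)),
    ← (Finset.HasAntidiagonal.sigmaAntidiagonalEquivProd (A := ℕ)).tsum_eq, ENNReal.tsum_sigma']
  refine ENNReal.tsum_le_tsum fun m => ?_
  rw [tsum_fintype, ← ENNReal.ofReal_sum_of_nonneg fun p _ => mul_nonneg (by positivity)
    (majCoeff_nonneg _ _ _ _)]
  refine ENNReal.ofReal_le_ofReal (le_of_eq ?_)
  rw [NNReal.coe_add, (Commute.all (c : ℝ) d).add_pow', Finset.mul_sum]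
  refine Eq.trans ?_ (Finset.sum_coe_sort (Finset.HasAntidiagonal.antidiagonal m) _)
  refine Finset.sum_congr rfl fun p _ => ?_
  have hp : p.1.1 + p.1.2 = m := Finset.HasAntidiagonal.mem_antidiagonal.1 p.2
  have hp' : p.1.2 + p.1.1 = m := by rw [add_comm, hp]
  simp only [Finset.HasAntidiagonal.sigmaAntidiagonalEquivProd_apply, hp', nsmul_eq_mul]
  ring

end Words

/-! ### Left invariance of the frame. -/

section Translation

variable {E : Type*} [NormedAddCommGroup E] [NormedSpace ℝ E]
  {G : Type*} [TopologicalSpace G] [ChartedSpace E G] [Group G] [LieGroup 𝓘(ℝ, E) ω G]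
  {n : ℕ} (b : Basis (Fin n) ℝ (GroupLieAlgebra 𝓘(ℝ, E) G))

/-- The field at `g` is the image of `b i` under left translation, so the chain rule moves the
translation onto `f` and every Lie derivative is computed at the identity. -/
theorem lieDeriv_leftFrame (i : Fin n) {f : G → ℂ} (hf : ContMDiff 𝓘(ℝ, E) 𝓘(ℝ, ℂ) ω f) (g : G) :
    lieDeriv (leftFrame b i) f g =
      (mfderiv 𝓘(ℝ, E) 𝓘(ℝ, ℂ) (fun y => f (g * y)) (1 : G) (b i) : ℂ) := by
  have h1 : MDifferentiableAt 𝓘(ℝ, E) 𝓘(ℝ, ℂ) f (g * 1) := hf.mdifferentiable (by simp) _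
  have h2 : MDifferentiableAt 𝓘(ℝ, E) 𝓘(ℝ, E) (fun y : G => g * y) 1 :=
    (contMDiff_mul_left (I := 𝓘(ℝ, E)) (n := ω) (a := g)).mdifferentiable (by simp) _
  have h3 := mfderiv_comp (1 : G) h1 h2
  have h4 : mfderiv 𝓘(ℝ, E) 𝓘(ℝ, ℂ) (fun y => f (g * y)) (1 : G) = _ := h3
  rw [h4]
  simp only [lieDeriv, leftFrame, mulInvariantVectorField]
  change _ = mfderiv 𝓘(ℝ, E) 𝓘(ℝ, ℂ) f (g * 1) (mfderiv 𝓘(ℝ, E) 𝓘(ℝ, E) (fun y : G => g * y) 1 (b i))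
  congr 2
  rw [mul_one]

theorem lieDeriv_comp_mul_left (i : Fin n) {f : G → ℂ} (hf : ContMDiff 𝓘(ℝ, E) 𝓘(ℝ, ℂ) ω f)
    (h : G) : lieDeriv (leftFrame b i) (fun y => f (h * y)) =
      fun y => lieDeriv (leftFrame b i) f (h * y) := by
  funext g
  have hf' : ContMDiff 𝓘(ℝ, E) 𝓘(ℝ, ℂ) ω (fun y => f (h * y)) := hf.comp contMDiff_mul_left
  refine (lieDeriv_leftFrame b i hf' g).trans ((lieDeriv_leftFrame b i hf (h * g)).trans ?_).symm
  have h1 : (fun y => f (h * g * y)) = fun y => f (h * (g * y)) := by simp only [mul_assoc]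
  exact congrArg (fun F : G → ℂ => (mfderiv 𝓘(ℝ, E) 𝓘(ℝ, ℂ) F (1 : G) : E → ℂ) (b i)) h1

theorem contMDiff_iterLieDeriv_leftFrame {f : G → ℂ} (hf : ContMDiff 𝓘(ℝ, E) 𝓘(ℝ, ℂ) ω f)
    (α : List (Fin n)) : ContMDiff 𝓘(ℝ, E) 𝓘(ℝ, ℂ) ω (iterLieDeriv (leftFrame b) α f) :=
  contMDiff_iterLieDeriv (fun i => contMDiff_invariantField (b i)) hf α

theorem iterLieDeriv_comp_mul_left {f : G → ℂ} (hf : ContMDiff 𝓘(ℝ, E) 𝓘(ℝ, ℂ) ω f) (h : G)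
    (α : List (Fin n)) : iterLieDeriv (leftFrame b) α (fun y => f (h * y)) =
      fun y => iterLieDeriv (leftFrame b) α f (h * y) := by
  induction α with
  | nil => rfl
  | cons i α ih =>
    rw [iterLieDeriv_cons, ih, iterLieDeriv_cons,
      lieDeriv_comp_mul_left b i (contMDiff_iterLieDeriv_leftFrame b hf α)]

theorem majCoeff_comp_mul_left {f : G → ℂ} (hf : ContMDiff 𝓘(ℝ, E) 𝓘(ℝ, ℂ) ω f) (h g : G) (k : ℕ) :
    majCoeff (leftFrame b) g k (fun y => f (h * y)) = majCoeff (leftFrame b) (h * g) k f := by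
  simp only [majCoeff, iterLieDeriv_comp_mul_left b hf]

theorem lieNorm_comp_mul_left {f : G → ℂ} (hf : ContMDiff 𝓘(ℝ, E) 𝓘(ℝ, ℂ) ω f) (h g : G) (c : ℝ≥0) :
    lieNorm (leftFrame b) c (fun y => f (h * y)) g = lieNorm (leftFrame b) c f (h * g) := by
  simp only [lieNorm, majCoeff_comp_mul_left b hf]

end Translation

/-! ### Analytic estimates in the chart at the identity. -/

section Chart

variable {E : Type*} [NormedAddCommGroup E] [NormedSpace ℝ E]
  {G : Type*} [TopologicalSpace G] [ChartedSpace E G] [Group G] [LieGroup 𝓘(ℝ, E) ω G]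
  {n : ℕ} (b : Basis (Fin n) ℝ (GroupLieAlgebra 𝓘(ℝ, E) G))

variable (E G) in
/-- The chart at the identity. -/
abbrev oneChart : PartialEquiv G E := extChartAt 𝓘(ℝ, E) (1 : G)

variable (E G) in
/-- The multiplication of the group in the chart at the identity. -/
def chartMul (x y : E) : E := oneChart E G ((oneChart E G).symm x * (oneChart E G).symm y)

set_option linter.unusedSectionVars false in
omit [LieGroup 𝓘(ℝ, E) ω G] in
include b in
theorem finiteDimensional_of_lieBasis : FiniteDimensional ℝ E := Module.Finite.of_basis (M := E) b

omit [LieGroup 𝓘(ℝ, E) ω G] in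
theorem isOpen_oneChart_target : IsOpen (oneChart E G).target := isOpen_extChartAt_target _

omit [LieGroup 𝓘(ℝ, E) ω G] in
theorem oneChart_mem_target : oneChart E G 1 ∈ (oneChart E G).target := mem_extChartAt_target _

theorem contMDiffAt_oneChart_symm {x : E} (hx : x ∈ (oneChart E G).target) :
    ContMDiffAt 𝓘(ℝ, E) 𝓘(ℝ, E) ω (oneChart E G).symm x :=
  (contMDiffOn_extChartAt_symm (1 : G)).contMDiffAt (isOpen_oneChart_target.mem_nhds hx)

omit [LieGroup 𝓘(ℝ, E) ω G] in
theorem oneChart_symm_one : (oneChart E G).symm (oneChart E G 1) = 1 :=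
  extChartAt_to_inv (I := 𝓘(ℝ, E)) (1 : G)

theorem contDiffAt_comp_oneChart_symm {f : G → ℂ} (hf : ContMDiff 𝓘(ℝ, E) 𝓘(ℝ, ℂ) ω f) {x : E}
    (hx : x ∈ (oneChart E G).target) :
    ContDiffAt ℝ ω (fun y => f ((oneChart E G).symm y)) x :=
  (ContMDiffAt.comp x (hf _) (contMDiffAt_oneChart_symm hx)).contDiffAt

theorem contMDiffAt_oneChart {g : G} (hg : g ∈ (oneChart E G).source) :
    ContMDiffAt 𝓘(ℝ, E) 𝓘(ℝ, E) ω (oneChart E G) g :=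
  contMDiffAt_extChartAt' (by simpa using hg)

/-- With the second factor at the identity the product is the first factor, so it lies in the domain
of the chart. -/
theorem contDiffAt_chartMul {x : E} (hx : x ∈ (oneChart E G).target) :
    ContDiffAt ℝ ω (Function.uncurry (chartMul E G)) (x, oneChart E G 1) := by
  have h1 : ContMDiffAt 𝓘(ℝ, E × E) 𝓘(ℝ, E) ω
      (fun p : E × E => (oneChart E G).symm p.1) (x, oneChart E G 1) :=
    ContMDiffAt.comp (x, oneChart E G 1) (contMDiffAt_oneChart_symm hx)
      contDiff_fst.contMDiff.contMDiffAt
  have h2 : ContMDiffAt 𝓘(ℝ, E × E) 𝓘(ℝ, E) ω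
      (fun p : E × E => (oneChart E G).symm p.2) (x, oneChart E G 1) :=
    ContMDiffAt.comp (x, oneChart E G 1) (contMDiffAt_oneChart_symm oneChart_mem_target)
      contDiff_snd.contMDiff.contMDiffAt
  have h3 := h1.mul h2
  have h4 : ContMDiffAt 𝓘(ℝ, E) 𝓘(ℝ, E) ω (oneChart E G)
      ((oneChart E G).symm x * (oneChart E G).symm (oneChart E G 1)) := by
    refine contMDiffAt_oneChart ?_
    rw [oneChart_symm_one, mul_one]
    exact (oneChart E G).map_target hx
  exact (ContMDiffAt.comp (x, oneChart E G 1) h4 h3).contDiffAt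

omit [LieGroup 𝓘(ℝ, E) ω G] in
theorem chartMul_one {x : E} (hx : x ∈ (oneChart E G).target) :
    chartMul E G x (oneChart E G 1) = x := by
  rw [chartMul, oneChart_symm_one, mul_one, (oneChart E G).right_inv hx]

omit [LieGroup 𝓘(ℝ, E) ω G] in
theorem mfderiv_one_eq_fderiv {f : G → ℂ} (hf : MDifferentiableAt 𝓘(ℝ, E) 𝓘(ℝ, ℂ) f 1) (v : E) :
    (mfderiv 𝓘(ℝ, E) 𝓘(ℝ, ℂ) f (1 : G) : E → ℂ) v =
      fderiv ℝ (fun y => f ((oneChart E G).symm y)) (oneChart E G 1) v := by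
  have h : (mfderiv 𝓘(ℝ, E) 𝓘(ℝ, ℂ) f (1 : G) : E →L[ℝ] ℂ) =
      fderivWithin ℝ (fun y => f ((oneChart E G).symm y)) (Set.range 𝓘(ℝ, E)) (oneChart E G 1) :=
    hf.mfderiv
  rw [modelWithCornersSelf_coe, Set.range_id, fderivWithin_univ] at h
  exact congrArg (fun L : E →L[ℝ] ℂ => L v) h

/-- The partial derivative of the multiplication in its second variable is the chart expression of
the left invariant field. -/
theorem lieDeriv_oneChart_symm {f : G → ℂ} (hf : ContMDiff 𝓘(ℝ, E) 𝓘(ℝ, ℂ) ω f) {x : E}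
    (hx : x ∈ (oneChart E G).target) (i : Fin n) :
    lieDeriv (leftFrame b i) f ((oneChart E G).symm x) =
      fderiv ℝ (fun y => f ((oneChart E G).symm y)) x
        (fderiv ℝ (chartMul E G x) (oneChart E G 1) (b i : E)) := by
  have : ContinuousMul G := continuousMul_of_contMDiffMul 𝓘(ℝ, E) ω
  set g := (oneChart E G).symm x with hg
  have hf' : ContMDiff 𝓘(ℝ, E) 𝓘(ℝ, ℂ) ω (fun y => f (g * y)) := hf.comp contMDiff_mul_left
  refine (lieDeriv_leftFrame b i hf g).trans ?_
  refine (mfderiv_one_eq_fderiv (hf'.mdifferentiable (by simp) 1) (b i : E)).trans ?_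
  have h1 : (fun y => f (g * (oneChart E G).symm y)) =ᶠ[𝓝 (oneChart E G 1)]
      (fun y => f ((oneChart E G).symm y)) ∘ chartMul E G x := by
    have hc : ContinuousAt (fun y => g * (oneChart E G).symm y) (oneChart E G 1) :=
      continuousAt_const.mul (contMDiffAt_oneChart_symm oneChart_mem_target).continuousAt
    have hs : (oneChart E G).source ∈ 𝓝 (g * (oneChart E G).symm (oneChart E G 1)) := by
      rw [oneChart_symm_one, mul_one]
      exact (isOpen_extChartAt_source (1 : G)).mem_nhds ((oneChart E G).map_target hx)
    filter_upwards [hc hs] with y hy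
    simp only [Function.comp_apply, chartMul]
    rw [(oneChart E G).left_inv hy]
  have h2 : DifferentiableAt ℝ (chartMul E G x) (oneChart E G 1) := by
    have h3 : ContDiffAt ℝ ω (fun y : E => (x, y)) (oneChart E G 1) := by fun_prop
    exact ((contDiffAt_chartMul hx).comp (oneChart E G 1) h3).differentiableAt (by simp)
  have h4 : DifferentiableAt ℝ (fun y => f ((oneChart E G).symm y))
      (chartMul E G x (oneChart E G 1)) := by
    rw [chartMul_one hx]
    exact (contDiffAt_comp_oneChart_symm hf hx).differentiableAt (by simp)
  rw [h1.fderiv_eq, fderiv_comp _ h4 h2, chartMul_one hx]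
  rfl

/-- In the chart at the identity the left invariant frame has an analytic dual coframe. -/
theorem exists_coframe : ∃ θ : Fin n → E → E →L[ℝ] ℂ,
    (∀ i, ContDiffAt ℝ ω (θ i) (oneChart E G 1)) ∧
      ∀ f : G → ℂ, ContMDiff 𝓘(ℝ, E) 𝓘(ℝ, ℂ) ω f →
        fderiv ℝ (fun y => f ((oneChart E G).symm y)) =ᶠ[𝓝 (oneChart E G 1)]
          fun y => ∑ i, lieDeriv (leftFrame b i) f ((oneChart E G).symm y) • θ i y := by
  have : FiniteDimensional ℝ E := finiteDimensional_of_lieBasis b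
  have : CompleteSpace E := FiniteDimensional.complete ℝ E
  let b' : Basis (Fin n) ℝ E := b
  -- `A x` sends a Lie algebra vector to its left invariant field at `x`, in the chart. It is the
  -- identity at the identity element, hence invertible nearby with analytic inverse; the coframe is
  -- the basis coordinates composed with `(A x)⁻¹`.
  let A : E → E →L[ℝ] E := fun x => fderiv ℝ (chartMul E G x) (oneChart E G 1)
  have hA : ContDiffAt ℝ ω A (oneChart E G 1) :=
    ContDiffAt.fderiv (n := ω) (contDiffAt_chartMul oneChart_mem_target) contDiffAt_const le_top
  have hA1 : A (oneChart E G 1) = 1 := by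
    have h : chartMul E G (oneChart E G 1) =ᶠ[𝓝 (oneChart E G 1)] id := by
      filter_upwards [isOpen_oneChart_target.mem_nhds (oneChart_mem_target (E := E) (G := G))]
        with y hy
      rw [chartMul, oneChart_symm_one, one_mul, (oneChart E G).right_inv hy, id]
    simp only [A]
    rw [h.fderiv_eq, fderiv_id]
    rfl
  have hinv : ContDiffAt ℝ ω (fun x => Ring.inverse (A x)) (oneChart E G 1) := by
    have h : ContDiffAt ℝ ω Ring.inverse (A (oneChart E G 1)) := by
      rw [hA1]; exact contDiffAt_ringInverse ℝ (1 : (E →L[ℝ] E)ˣ)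
    exact h.comp _ hA
  have hunit : ∀ᶠ x in 𝓝 (oneChart E G 1), IsUnit (A x) := by
    have h : {u : E →L[ℝ] E | IsUnit u} ∈ 𝓝 (A (oneChart E G 1)) :=
      Units.isOpen.mem_nhds (by rw [hA1]; exact isUnit_one)
    exact hA.continuousAt h
  let c : Fin n → E →L[ℝ] ℂ := fun i =>
    Complex.ofRealCLM.comp (LinearMap.toContinuousLinearMap (b'.coord i))
  refine ⟨fun i x => (c i).comp (Ring.inverse (A x)), fun i => ?_, fun f hf => ?_⟩
  · exact contDiffAt_const.clm_comp hinv
  · filter_upwards [hunit, isOpen_oneChart_target.mem_nhds (oneChart_mem_target (E := E) (G := G))]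
      with x hx hxt
    ext v
    simp only [lieDeriv_oneChart_symm b hf hxt, sum_apply,
      smul_apply, ContinuousLinearMap.comp_apply, c, Complex.ofRealCLM_apply,
      smul_eq_mul, LinearMap.coe_toContinuousLinearMap']
    set w := Ring.inverse (A x) v with hw
    have h1 : A x w = v := by
      have := congrArg (fun L : E →L[ℝ] E => L v) (Ring.mul_inverse_cancel _ hx)
      exact this
    have h2 : v = ∑ i, b'.coord i w • A x (b' i) := by
      rw [← h1]
      conv_lhs => rw [← b'.sum_repr w, map_sum]
      simp only [map_smul, Basis.coord_apply]
    conv_lhs => rw [h2, map_sum]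
    refine Finset.sum_congr rfl fun i _ => ?_
    rw [map_smul, Complex.real_smul, mul_comm]
    rfl

/-- The Taylor majorant in the chart at the identity is controlled by the majorant along the left
invariant frame. -/
theorem exists_taylorNorm_le_lieNorm : ∃ r d : ℝ≥0, 0 < r ∧
    Metric.ball (oneChart E G 1) r ⊆ (oneChart E G).target ∧
      ∀ f : G → ℂ, ContMDiff 𝓘(ℝ, E) 𝓘(ℝ, ℂ) ω f →
        taylorNorm r (fun y => f ((oneChart E G).symm y)) (oneChart E G 1) ≤
          lieNorm (leftFrame b) d f 1 := by
  have : FiniteDimensional ℝ E := finiteDimensional_of_lieBasis b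
  obtain ⟨θ, hθ, hd⟩ := exists_coframe b
  obtain ⟨ε, hε, hball⟩ := Metric.isOpen_iff.1 isOpen_oneChart_target _
    (oneChart_mem_target (E := E) (G := G))
  lift ε to ℝ≥0 using hε.le
  choose s hs hsfin using fun i => exists_taylorNorm_ne_top (hθ i).analyticAt
  obtain ⟨r, hr0, hrε, hrs⟩ : ∃ r : ℝ≥0, 0 < r ∧ r ≤ ε ∧ ∀ i, r ≤ s i := by
    have h1 : ∀ᶠ r : ℝ≥0 in 𝓝[>] 0, ∀ i, r ≤ s i :=
      eventually_all.2 fun i => (eventually_le_nhds (hs i)).filter_mono nhdsWithin_le_nhds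
    have h2 : ∀ᶠ r : ℝ≥0 in 𝓝[>] 0, r ≤ ε :=
      (eventually_le_nhds (by exact_mod_cast hε)).filter_mono nhdsWithin_le_nhds
    obtain ⟨r, h3, h4, h5⟩ := (eventually_mem_nhdsWithin.and (h2.and h1)).exists
    exact ⟨r, h3, h4, h5⟩
  have hfin : ∀ i, taylorNorm r (θ i) (oneChart E G 1) ≠ ⊤ := fun i =>
    ne_top_of_le_ne_top (hsfin i) (taylorNorm_mono (hrs i) _ _)
  have hM' : (∑ i, taylorNorm r (θ i) (oneChart E G 1)) ≠ ⊤ := by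
    simpa [ENNReal.sum_eq_top] using hfin
  obtain ⟨M, hM⟩ : ∃ M : ℝ≥0, (∑ i, taylorNorm r (θ i) (oneChart E G 1)) = M :=
    ⟨_, (ENNReal.coe_toNNReal hM').symm⟩
  -- The comparison along the frame yields powers of `M * t`; at the radius `t = r` this is the
  -- majorant of radius `M * r`.
  refine ⟨r, M * r, hr0, (Metric.ball_subset_ball (by exact_mod_cast hrε)).trans hball,
    fun f hf => taylorNorm_le fun m => ?_⟩
  -- The comparison needs a family closed under the derivatives of the frame; all analytic functions
  -- on `G` form one.
  let 𝓕 := {f : G → ℂ // ContMDiff 𝓘(ℝ, E) 𝓘(ℝ, ℂ) ω f}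
  have key := taylorSum_le_of_frame (𝓕 := 𝓕) (fun f y => f.1 ((oneChart E G).symm y))
    (fun i f => ⟨lieDeriv (leftFrame b i) f.1, contMDiff_iterLieDeriv_leftFrame b f.2 [i]⟩) θ
    (fun f => contDiffAt_comp_oneChart_symm f.2 oneChart_mem_target) hθ (fun f => hd f.1 f.2)
    (r := r) (M := M) (fun i => by
      rw [← hM]
      exact Finset.single_le_sum (f := fun i => taylorNorm r (θ i) (oneChart E G 1))
        (fun _ _ => zero_le) (Finset.mem_univ i))
    (fun k f => majCoeff (leftFrame b) 1 k f.1)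
    (fun f => by rw [majCoeff_zero, oneChart_symm_one])
    (fun k f => majCoeff_succ (leftFrame b) 1 k f.1) m ⟨f, hf⟩ r r.2 le_rfl
  refine (ENNReal.ofReal_le_ofReal key).trans ?_
  rw [ENNReal.ofReal_sum_of_nonneg fun k _ => mul_nonneg (majCoeff_nonneg _ _ _ _)
    (by positivity)]
  exact ENNReal.sum_le_tsum (f := fun k : ℕ => ENNReal.ofReal
    (majCoeff (leftFrame b) 1 k f * ((M * r : ℝ≥0) : ℝ) ^ k)) _

end Chart

/-! ### From the identity to the whole group, and limits of analytic functions. -/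

section Propagation

variable {E : Type*} [NormedAddCommGroup E] [NormedSpace ℝ E]
  {G : Type*} [TopologicalSpace G] [ChartedSpace E G] [Group G] [LieGroup 𝓘(ℝ, E) ω G]
  {n : ℕ} (b : Basis (Fin n) ℝ (GroupLieAlgebra 𝓘(ℝ, E) G))

theorem analyticOnNhd_comp_oneChart_symm (b : Basis (Fin n) ℝ (GroupLieAlgebra 𝓘(ℝ, E) G))
    {f : G → ℂ} (hf : ContMDiff 𝓘(ℝ, E) 𝓘(ℝ, ℂ) ω f) {s : Set E}
    (hs : s ⊆ (oneChart E G).target) : AnalyticOnNhd ℝ (fun y => f ((oneChart E G).symm y)) s := by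
  have : FiniteDimensional ℝ E := finiteDimensional_of_lieBasis b
  have : CompleteSpace E := FiniteDimensional.complete ℝ E
  exact fun y hy => (contDiffAt_comp_oneChart_symm hf (hs hy)).analyticAt

/-- In a chart ball the Taylor majorant bounds values; used for all iterated derivatives of `f`,
this is the input of `lieNorm_le_of_iterLieDeriv`. Because `d` depends neither on `f` nor on `c`,
the bound can be translated and iterated. -/
theorem exists_nhds_one_lieNorm_le : ∃ U ∈ 𝓝 (1 : G), ∃ d : ℝ≥0, ∀ g ∈ U, ∀ f : G → ℂ,
    ContMDiff 𝓘(ℝ, E) 𝓘(ℝ, ℂ) ω f →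
      ∀ c, lieNorm (leftFrame b) c f g ≤ lieNorm (leftFrame b) (c + d) f 1 := by
  obtain ⟨r, d, hr, hball, h⟩ := exists_taylorNorm_le_lieNorm b
  have hr' : (0 : ℝ) < r := by exact_mod_cast hr
  refine ⟨(oneChart E G).source ∩ oneChart E G ⁻¹' Metric.ball (oneChart E G 1) r, ?_, d,
    fun g hg f hf c => lieNorm_le_of_iterLieDeriv _ (fun α => ?_) c⟩
  · exact inter_mem ((isOpen_extChartAt_source (1 : G)).mem_nhds (mem_extChartAt_source 1))
      ((continuousAt_extChartAt (1 : G)) (Metric.ball_mem_nhds _ hr'))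
  · have hα := contMDiff_iterLieDeriv_leftFrame b hf α
    have h1 := enorm_le_taylorNorm hr (analyticOnNhd_comp_oneChart_symm b hα hball) hg.2
    simp only [(oneChart E G).left_inv hg.1] at h1
    exact h1.trans (h _ hα)

/-- On a connected group the majorant at any point is controlled by the majorant at the
identity. -/
theorem exists_lieNorm_le [ConnectedSpace G] (g : G) : ∃ d : ℝ≥0, ∀ f : G → ℂ,
    ContMDiff 𝓘(ℝ, E) 𝓘(ℝ, ℂ) ω f →
      ∀ c, lieNorm (leftFrame b) c f g ≤ lieNorm (leftFrame b) (c + d) f 1 := by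
  have : IsTopologicalGroup G := topologicalGroup_of_lieGroup 𝓘(ℝ, E) ω
  obtain ⟨U, hU, d, h⟩ := exists_nhds_one_lieNorm_le b
  let S : Set G := {g | ∃ d : ℝ≥0, ∀ f : G → ℂ, ContMDiff 𝓘(ℝ, E) 𝓘(ℝ, ℂ) ω f →
      ∀ c, lieNorm (leftFrame b) c f g ≤ lieNorm (leftFrame b) (c + d) f 1}
  -- The estimate near the identity is applied to the translate of `f` by `g`, then the estimate at
  -- `g` to `f`; the increments of the radius add.
  have hmul : ∀ g ∈ S, ∀ u ∈ U, g * u ∈ S := by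
    rintro g ⟨dg, hg⟩ u hu
    refine ⟨d + dg, fun f hf c => ?_⟩
    have hf' : ContMDiff 𝓘(ℝ, E) 𝓘(ℝ, ℂ) ω (fun y => f (g * y)) := hf.comp contMDiff_mul_left
    have h1 := h u hu _ hf' c
    rw [lieNorm_comp_mul_left b hf, lieNorm_comp_mul_left b hf, mul_one] at h1
    exact h1.trans ((hg f hf _).trans_eq (by rw [add_assoc]))
  -- Stability under right multiplication by `U` gives openness. For closedness, a point `g` outside
  -- `S` has no `y ∈ S` with `y⁻¹ * g ∈ U`.
  have hS : IsClopen S := by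
    constructor
    · rw [← isOpen_compl_iff, isOpen_iff_mem_nhds]
      intro g hg
      have hc : Tendsto (fun y : G => y⁻¹ * g) (𝓝 g) (𝓝 1) := by
        have : ContinuousAt (fun y : G => y⁻¹ * g) g := by fun_prop
        simpa [ContinuousAt] using this
      filter_upwards [hc hU] with y hy hyS
      refine hg ?_
      have := hmul y hyS _ hy
      rwa [mul_inv_cancel_left] at this
    · rw [isOpen_iff_mem_nhds]
      intro g hg
      have hc : Tendsto (fun y : G => g⁻¹ * y) (𝓝 g) (𝓝 1) := by
        have : ContinuousAt (fun y : G => g⁻¹ * y) g := by fun_prop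
        simpa [ContinuousAt] using this
      filter_upwards [hc hU] with y hy
      have := hmul g hg _ hy
      rwa [mul_inv_cancel_left] at this
  have huniv := hS.eq_univ ⟨1, 0, fun f _ c => by rw [add_zero]⟩
  exact (huniv ▸ Set.mem_univ g : g ∈ S)

theorem taylorNorm_translate_le {r d : ℝ≥0}
    (h : ∀ f : G → ℂ, ContMDiff 𝓘(ℝ, E) 𝓘(ℝ, ℂ) ω f →
        taylorNorm r (fun y => f ((oneChart E G).symm y)) (oneChart E G 1) ≤
          lieNorm (leftFrame b) d f 1) {f : G → ℂ} (hf : ContMDiff 𝓘(ℝ, E) 𝓘(ℝ, ℂ) ω f) (g : G) :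
    taylorNorm r (fun y => f (g * (oneChart E G).symm y)) (oneChart E G 1) ≤
      lieNorm (leftFrame b) d f g := by
  have h1 := h (fun y => f (g * y)) (hf.comp contMDiff_mul_left)
  rwa [lieNorm_comp_mul_left b hf, mul_one] at h1

theorem contMDiffAt_of_translate {f : G → ℂ} {g : G}
    (hf : ContDiffAt ℝ ω (fun y => f (g * (oneChart E G).symm y)) (oneChart E G 1)) :
    ContMDiffAt 𝓘(ℝ, E) 𝓘(ℝ, ℂ) ω f g := by
  have : IsTopologicalGroup G := topologicalGroup_of_lieGroup 𝓘(ℝ, E) ω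
  have h1 : ContMDiffAt 𝓘(ℝ, E) 𝓘(ℝ, E) ω (fun y : G => oneChart E G (g⁻¹ * y)) g := by
    refine ContMDiffAt.comp g (contMDiffAt_oneChart ?_) contMDiff_mul_left.contMDiffAt
    rw [inv_mul_cancel]
    exact mem_extChartAt_source 1
  have h2 : ContMDiffAt 𝓘(ℝ, E) 𝓘(ℝ, ℂ) ω (fun y => f (g * (oneChart E G).symm y))
      (oneChart E G (g⁻¹ * g)) := by
    rw [inv_mul_cancel]; exact hf.contMDiffAt
  refine (ContMDiffAt.comp g h2 h1).congr_of_eventuallyEq ?_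
  have hc : Tendsto (fun y : G => g⁻¹ * y) (𝓝 g) (𝓝 1) := by
    have : ContinuousAt (fun y : G => g⁻¹ * y) g := by fun_prop
    simpa [ContinuousAt] using this
  filter_upwards [hc ((isOpen_extChartAt_source (1 : G)).mem_nhds (mem_extChartAt_source (I := 𝓘(ℝ, E)) 1))]
    with y hy
  simp only [Function.comp_apply]
  rw [(oneChart E G).left_inv hy, mul_inv_cancel_left]

omit [Group G] [LieGroup 𝓘(ℝ, E) ω G] in
theorem sub_contMDiff {f h : G → ℂ} (hf : ContMDiff 𝓘(ℝ, E) 𝓘(ℝ, ℂ) ω f)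
    (hh : ContMDiff 𝓘(ℝ, E) 𝓘(ℝ, ℂ) ω h) : ContMDiff 𝓘(ℝ, E) 𝓘(ℝ, ℂ) ω (f - h) :=
  hf.sub hh

omit [LieGroup 𝓘(ℝ, E) ω G] in
theorem lieDeriv_sub (i : Fin n) {f h : G → ℂ} (hf : ContMDiff 𝓘(ℝ, E) 𝓘(ℝ, ℂ) ω f)
    (hh : ContMDiff 𝓘(ℝ, E) 𝓘(ℝ, ℂ) ω h) :
    lieDeriv (leftFrame b i) (f - h) = lieDeriv (leftFrame b i) f - lieDeriv (leftFrame b i) h := by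
  have h1 := lieDeriv_add (leftFrame b i) (f := f - h) (h := h)
    ((sub_contMDiff hf hh).mdifferentiable (by simp)) (hh.mdifferentiable (by simp))
  rw [sub_add_cancel] at h1
  rw [h1, add_sub_cancel_right]

theorem iterLieDeriv_sub {f h : G → ℂ} (hf : ContMDiff 𝓘(ℝ, E) 𝓘(ℝ, ℂ) ω f)
    (hh : ContMDiff 𝓘(ℝ, E) 𝓘(ℝ, ℂ) ω h) (α : List (Fin n)) :
    iterLieDeriv (leftFrame b) α (f - h) =
      iterLieDeriv (leftFrame b) α f - iterLieDeriv (leftFrame b) α h := by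
  induction α with
  | nil => rfl
  | cons i α ih =>
    rw [iterLieDeriv_cons, ih, lieDeriv_sub b i (contMDiff_iterLieDeriv_leftFrame b hf α)
      (contMDiff_iterLieDeriv_leftFrame b hh α)]
    rfl

variable [ConnectedSpace G]

/-- In the chart translated to `g`, the Taylor majorants are controlled by the majorants at `1`, so
`analyticAt_of_tendsto` applies. The Lie derivative at `g` is a first derivative in that chart. -/
theorem contMDiff_and_tendsto_lieDeriv {ι : Type*} {l : Filter ι} [l.NeBot] {f : ι → G → ℂ}
    {F : G → ℂ} (hf : ∀ i, ContMDiff 𝓘(ℝ, E) 𝓘(ℝ, ℂ) ω (f i))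
    (hfin : ∀ i c, lieNorm (leftFrame b) c (f i) 1 ≠ ⊤)
    (hC : ∀ c, Tendsto (fun p : ι × ι => lieNorm (leftFrame b) c (f p.1 - f p.2) 1) (l ×ˢ l) (𝓝 0))
    (hlim : ∀ g, Tendsto (fun i => f i g) l (𝓝 (F g))) :
    ContMDiff 𝓘(ℝ, E) 𝓘(ℝ, ℂ) ω F ∧ ∀ j g, Tendsto (fun i => lieDeriv (leftFrame b j) (f i) g) l
      (𝓝 (lieDeriv (leftFrame b j) F g)) := by
  obtain ⟨r, d, hr, hball, h⟩ := exists_taylorNorm_le_lieNorm b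
  have key : ∀ g, AnalyticAt ℝ (fun y => F (g * (oneChart E G).symm y)) (oneChart E G 1) ∧
      ∀ v, Tendsto (fun i => fderiv ℝ (fun y => f i (g * (oneChart E G).symm y))
        (oneChart E G 1) v) l
        (𝓝 (fderiv ℝ (fun y => F (g * (oneChart E G).symm y)) (oneChart E G 1) v)) := by
    intro g
    obtain ⟨dg, hg⟩ := exists_lieNorm_le b g
    refine analyticAt_of_tendsto hr (fun i => ?_) (fun i => ?_) ?_ (fun y _ => hlim _)
    · exact analyticOnNhd_comp_oneChart_symm b (f := fun y => f i (g * y))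
        ((hf i).comp contMDiff_mul_left) hball
    · exact ne_top_of_le_ne_top (hfin i (d + dg))
        ((taylorNorm_translate_le b h (hf i) g).trans (hg _ (hf i) _))
    · refine tendsto_of_tendsto_of_tendsto_of_le_of_le tendsto_const_nhds (hC (d + dg))
        (fun _ => zero_le) fun p => ?_
      have hs := sub_contMDiff (hf p.1) (hf p.2)
      exact (taylorNorm_translate_le b h hs g).trans (hg _ hs _)
  have hF : ContMDiff 𝓘(ℝ, E) 𝓘(ℝ, ℂ) ω F := fun g =>
    contMDiffAt_of_translate (key g).1.contDiffAt
  have heq : ∀ {f : G → ℂ}, ContMDiff 𝓘(ℝ, E) 𝓘(ℝ, ℂ) ω f → ∀ j g, lieDeriv (leftFrame b j) f g =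
      fderiv ℝ (fun y => f (g * (oneChart E G).symm y)) (oneChart E G 1) (b j : E) := by
    intro f hf j g
    have hf' : ContMDiff 𝓘(ℝ, E) 𝓘(ℝ, ℂ) ω (fun y => f (g * y)) := hf.comp contMDiff_mul_left
    exact (lieDeriv_leftFrame b j hf g).trans
      (mfderiv_one_eq_fderiv (hf'.mdifferentiable (by simp) 1) (b j : E))
  refine ⟨hF, fun j g => ?_⟩
  rw [heq hF]
  simp only [heq (hf _)]
  exact (key g).2 _

/-- A pointwise limit of analytic functions with entire majorants, Cauchy for the majorants, is
analytic, and its iterated Lie derivatives are the limits of the iterated Lie derivatives. -/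
theorem contMDiff_and_tendsto_iterLieDeriv {ι : Type*} {l : Filter ι} [l.NeBot] {f : ι → G → ℂ}
    {F : G → ℂ} (hf : ∀ i, ContMDiff 𝓘(ℝ, E) 𝓘(ℝ, ℂ) ω (f i))
    (hfin : ∀ i c, lieNorm (leftFrame b) c (f i) 1 ≠ ⊤)
    (hC : ∀ c, Tendsto (fun p : ι × ι => lieNorm (leftFrame b) c (f p.1 - f p.2) 1) (l ×ˢ l) (𝓝 0))
    (hlim : ∀ g, Tendsto (fun i => f i g) l (𝓝 (F g))) :
    ContMDiff 𝓘(ℝ, E) 𝓘(ℝ, ℂ) ω F ∧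
      ∀ α g, Tendsto (fun i => iterLieDeriv (leftFrame b) α (f i) g) l
        (𝓝 (iterLieDeriv (leftFrame b) α F g)) := by
  refine ⟨(contMDiff_and_tendsto_lieDeriv b hf hfin hC hlim).1, fun α => ?_⟩
  -- Each derivative enlarges the radius, which is harmless because the hypotheses hold for all
  -- radii; so they pass to iterated derivatives and the one-derivative result can be repeated.
  have hle : ∀ (α : List (Fin n)) c, ∃ d, ∀ f : G → ℂ, lieNorm (leftFrame b) c
      (iterLieDeriv (leftFrame b) α f) 1 ≤ lieNorm (leftFrame b) d f 1 := by
    intro α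
    induction α with
    | nil => exact fun c => ⟨c, fun f => le_rfl⟩
    | cons i α ih =>
      intro c
      obtain ⟨d, hd⟩ := ih (c + 1)
      exact ⟨d, fun f => (lieNorm_lieDeriv_le _ c _ 1 i).trans (hd f)⟩
  induction α with
  | nil => exact hlim
  | cons j α ih =>
    intro g
    refine (contMDiff_and_tendsto_lieDeriv b (f := fun i => iterLieDeriv (leftFrame b) α (f i))
      (fun i => contMDiff_iterLieDeriv_leftFrame b (hf i) α) (fun i c => ?_) (fun c => ?_)
      ih).2 j g
    · obtain ⟨d, hd⟩ := hle α c
      exact ne_top_of_le_ne_top (hfin i d) (hd _)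
    · obtain ⟨d, hd⟩ := hle α c
      refine tendsto_of_tendsto_of_tendsto_of_le_of_le tendsto_const_nhds (hC d)
        (fun _ => zero_le) fun p => ?_
      simp only
      rw [← iterLieDeriv_sub b (hf p.1) (hf p.2)]
      exact hd _

end Propagation

/-! ### Power series on the dual of the Lie algebra. -/

section SymmetricSeries

variable {E : Type*} [NormedAddCommGroup E] [NormedSpace ℝ E]
  {G : Type*} [TopologicalSpace G] [ChartedSpace E G] [Group G]
  {n : ℕ} (b : Basis (Fin n) ℝ (GroupLieAlgebra 𝓘(ℝ, E) G))

theorem dualVec_apply (i j : Fin n) : dualVec b i (b j) = if j = i then 1 else 0 := by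
  have : FiniteDimensional ℝ E := Module.Finite.of_basis (M := E) b
  change b.coord i (b j) = _
  rw [Basis.coord_apply, Basis.repr_self, Finsupp.single_apply]

/-- Evaluation of a linear form at the `i`-th basis vector. -/
def basisEval (i : Fin n) : StrongDual ℝ E →L[ℝ] ℝ :=
  ContinuousLinearMap.apply ℝ ℝ (show E from b i)

theorem basisEval_apply (i : Fin n) (η : StrongDual ℝ E) : basisEval b i η = η (b i) := rfl

/-- At a linear form with equal coordinates all monomials of one degree coincide, so pointwise
absolute convergence controls the sums of the absolute values of the coefficients. -/
theorem exists_dual_eq (t : ℝ) : ∃ η : StrongDual ℝ E, ∀ i, η (b i) = t := by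
  refine ⟨t • ∑ j, dualVec b j, fun i => ?_⟩
  rw [← basisEval_apply, map_smul, map_sum]
  simp [basisEval_apply, dualVec_apply]

/-- The homogeneous polynomial on the dual space with coefficients `c`, as a multilinear map. -/
def polyForm {k : ℕ} (c : (Fin k → Fin n) → ℂ) :
    ContinuousMultilinearMap ℝ (fun _ : Fin k => StrongDual ℝ E) ℂ :=
  ∑ α, c α • (ContinuousMultilinearMap.mkPiAlgebra ℝ (Fin k) ℂ).compContinuousLinearMap
    fun j => Complex.ofRealCLM.comp (basisEval b (α j))

theorem polyForm_apply {k : ℕ} (c : (Fin k → Fin n) → ℂ) (v : Fin k → StrongDual ℝ E) :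
    polyForm b c v = ∑ α, c α * ∏ j, ((v j (b (α j)) : ℝ) : ℂ) := by
  simp [polyForm, basisEval_apply]

theorem exists_norm_polyForm_le : ∃ K : ℝ, 0 ≤ K ∧ ∀ (k : ℕ) (c : (Fin k → Fin n) → ℂ),
    ‖polyForm b c‖ ≤ ∑ α, ‖c α‖ * K ^ k := by
  refine ⟨∑ i, ‖basisEval b i‖, by positivity, fun k c => ?_⟩
  refine ContinuousMultilinearMap.opNorm_le_bound (by positivity) fun v => ?_
  rw [polyForm_apply, Finset.sum_mul]
  refine (norm_sum_le _ _).trans (Finset.sum_le_sum fun α _ => ?_)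
  rw [norm_mul, norm_prod, mul_assoc]
  refine mul_le_mul_of_nonneg_left ?_ (norm_nonneg _)
  have h : ∀ j ∈ (Finset.univ : Finset (Fin k)), ‖((v j (b (α j)) : ℝ) : ℂ)‖ ≤
      (∑ i, ‖basisEval b i‖) * ‖v j‖ := by
    intro j _
    rw [Complex.norm_real, ← basisEval_apply]
    refine ((basisEval b (α j)).le_opNorm _).trans ?_
    refine mul_le_mul_of_nonneg_right ?_ (norm_nonneg _)
    exact Finset.single_le_sum (f := fun i => ‖basisEval b i‖) (fun _ _ => by positivity)
      (Finset.mem_univ _)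
  refine (Finset.prod_le_prod (fun _ _ => norm_nonneg _) h).trans (le_of_eq ?_)
  rw [Finset.prod_mul_distrib, Finset.prod_const, Finset.card_univ, Fintype.card_fin]

theorem iterLieDeriv_dualFrame {f : StrongDual ℝ E → ℂ} (hf : ContDiff ℝ ω f) {k : ℕ}
    (α : Fin k → Fin n) (η : StrongDual ℝ E) :
    iterLieDeriv (dualFrame b) (List.ofFn α) f η =
      iteratedFDeriv ℝ k f η fun j => dualVec b (α j) := by
  induction k generalizing η with
  | zero => simp [iterLieDeriv]
  | succ k ih =>
    rw [List.ofFn_succ, iterLieDeriv_cons]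
    have h1 : iterLieDeriv (dualFrame b) (List.ofFn fun i => α i.succ) f =
        fun η => iteratedFDeriv ℝ k f η fun j => dualVec b (α j.succ) := funext fun η => ih _ η
    rw [h1, iteratedFDeriv_succ_apply_left]
    have h2 : DifferentiableAt ℝ (iteratedFDeriv ℝ k f) η :=
      (hf.differentiable_iteratedFDeriv (by exact_mod_cast WithTop.coe_lt_top _)) η
    have h3 := h2.hasFDerivAt.continuousMultilinear_apply_const fun j => dualVec b (α j.succ)
    have h4 := h3.hasMFDerivAt.mfderiv
    simp only [lieDeriv]
    exact congrArg (fun L : StrongDual ℝ E →L[ℝ] ℂ => L (dualVec b (α 0))) h4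

/-- The power series on the dual space with coefficients `c`. -/
def polyFMS (c : ∀ k : ℕ, (Fin k → Fin n) → ℂ) : FormalMultilinearSeries ℝ (StrongDual ℝ E) ℂ :=
  fun k => polyForm b (c k)

variable {c : ∀ k : ℕ, (Fin k → Fin n) → ℂ} {f : StrongDual ℝ E → ℂ}

/-- A function that is the sum of an everywhere absolutely convergent power series on the dual
space is given by a formal multilinear series with infinite radius of convergence. -/
theorem hasFPowerSeriesOnBall_polyForm
    (hs : ∀ η : StrongDual ℝ E, Summable fun α : Σ k : ℕ, Fin k → Fin n =>
      ‖c α.1 α.2 * ∏ j, (η (b (α.2 j)) : ℂ)‖)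
    (hf : ∀ η : StrongDual ℝ E, HasSum (fun α : Σ k : ℕ, Fin k → Fin n =>
      c α.1 α.2 * ∏ j, (η (b (α.2 j)) : ℂ)) (f η)) :
    HasFPowerSeriesOnBall f (polyFMS b c) 0 ⊤ := by
  obtain ⟨K, hK0, hK⟩ := exists_norm_polyForm_le (E := E) (G := G) b
  refine ⟨?_, by simp, fun {y} _ => ?_⟩
  · refine top_le_iff.2 (FormalMultilinearSeries.radius_eq_top_of_summable_norm _ fun r => ?_)
    -- The factor `K` compensates the loss `K ^ k` in the operator norm of the degree `k` term.
    obtain ⟨η, hη⟩ := exists_dual_eq b (K * r)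
    have h1 := (hs η).sigma
    refine Summable.of_nonneg_of_le (fun k => by positivity) (fun k => ?_) h1
    rw [tsum_fintype]
    refine (mul_le_mul_of_nonneg_right (hK k (c k)) (by positivity)).trans (le_of_eq ?_)
    rw [Finset.sum_mul]
    refine Finset.sum_congr rfl fun α _ => ?_
    simp only [hη, norm_mul, Complex.norm_real, Finset.prod_const, Finset.card_univ,
      Fintype.card_fin, Real.norm_eq_abs, abs_of_nonneg hK0, NNReal.abs_eq, norm_pow]
    ring
  · rw [zero_add]
    refine (hf y).sigma fun k => ?_
    rw [polyFMS, polyForm_apply]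
    exact hasSum_fintype _

theorem contDiff_of_hasSum
    (hs : ∀ η : StrongDual ℝ E, Summable fun α : Σ k : ℕ, Fin k → Fin n =>
      ‖c α.1 α.2 * ∏ j, (η (b (α.2 j)) : ℂ)‖)
    (hf : ∀ η : StrongDual ℝ E, HasSum (fun α : Σ k : ℕ, Fin k → Fin n =>
      c α.1 α.2 * ∏ j, (η (b (α.2 j)) : ℂ)) (f η)) : ContDiff ℝ ω f := by
  have h := hasFPowerSeriesOnBall_polyForm b hs hf
  refine contDiff_iff_contDiffAt.2 fun x => (h.analyticAt_of_mem ?_).contDiffAt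
  simp

/-- The `k`-th derivative at `0` sums the degree `k` form over all permutations of its arguments. On
dual basis vectors each summand is a permuted coefficient, and symmetry makes them equal. The
factorial cancels the one in `majCoeff`. -/
theorem iterLieDeriv_dualFrame_zero (hc : ∀ k α (σ : Equiv.Perm (Fin k)), c k (α ∘ σ) = c k α)
    (hs : ∀ η : StrongDual ℝ E, Summable fun α : Σ k : ℕ, Fin k → Fin n =>
      ‖c α.1 α.2 * ∏ j, (η (b (α.2 j)) : ℂ)‖)
    (hf : ∀ η : StrongDual ℝ E, HasSum (fun α : Σ k : ℕ, Fin k → Fin n =>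
      c α.1 α.2 * ∏ j, (η (b (α.2 j)) : ℂ)) (f η)) {k : ℕ} (α : Fin k → Fin n) :
    iterLieDeriv (dualFrame b) (List.ofFn α) f 0 = k.factorial * c k α := by
  rw [iterLieDeriv_dualFrame b (contDiff_of_hasSum b hs hf),
    (hasFPowerSeriesOnBall_polyForm b hs hf).iteratedFDeriv_eq_sum_of_completeSpace]
  have h1 : ∀ σ : Equiv.Perm (Fin k),
      polyFMS b c k (fun j => dualVec b (α (σ j))) = c k α := by
    intro σ
    rw [polyFMS, polyForm_apply, Finset.sum_eq_single (α ∘ σ), hc]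
    · simp [dualVec_apply]
    · intro β _ hβ
      obtain ⟨j, hj⟩ := Function.ne_iff.1 hβ
      have : ∏ j, ((dualVec b (α (σ j)) (b (β j)) : ℝ) : ℂ) = 0 := by
        refine Finset.prod_eq_zero (Finset.mem_univ j) ?_
        rw [dualVec_apply, if_neg (by simpa using hj), Complex.ofReal_zero]
      rw [this, mul_zero]
    · simp
  simp only [h1, Finset.sum_const, Finset.card_univ, Fintype.card_perm, Fintype.card_fin,
    nsmul_eq_mul]

/-- Symmetric coefficients of everywhere absolutely convergent power series on the dual space are
determined by the sum. -/
theorem coeff_unique {c' : ∀ k : ℕ, (Fin k → Fin n) → ℂ}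
    (hc : ∀ k α (σ : Equiv.Perm (Fin k)), c k (α ∘ σ) = c k α)
    (hs : ∀ η : StrongDual ℝ E, Summable fun α : Σ k : ℕ, Fin k → Fin n =>
      ‖c α.1 α.2 * ∏ j, (η (b (α.2 j)) : ℂ)‖)
    (hf : ∀ η : StrongDual ℝ E, HasSum (fun α : Σ k : ℕ, Fin k → Fin n =>
      c α.1 α.2 * ∏ j, (η (b (α.2 j)) : ℂ)) (f η))
    (hc' : ∀ k α (σ : Equiv.Perm (Fin k)), c' k (α ∘ σ) = c' k α)
    (hs' : ∀ η : StrongDual ℝ E, Summable fun α : Σ k : ℕ, Fin k → Fin n =>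
      ‖c' α.1 α.2 * ∏ j, (η (b (α.2 j)) : ℂ)‖)
    (hf' : ∀ η : StrongDual ℝ E, HasSum (fun α : Σ k : ℕ, Fin k → Fin n =>
      c' α.1 α.2 * ∏ j, (η (b (α.2 j)) : ℂ)) (f η)) {k : ℕ} (α : Fin k → Fin n) :
    c k α = c' k α := by
  have h := (iterLieDeriv_dualFrame_zero b hc hs hf α).symm.trans
    (iterLieDeriv_dualFrame_zero b hc' hs' hf' α)
  exact mul_left_cancel₀ (by exact_mod_cast k.factorial_ne_zero) h

theorem majCoeff_dualFrame (hc : ∀ k α (σ : Equiv.Perm (Fin k)), c k (α ∘ σ) = c k α)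
    (hs : ∀ η : StrongDual ℝ E, Summable fun α : Σ k : ℕ, Fin k → Fin n =>
      ‖c α.1 α.2 * ∏ j, (η (b (α.2 j)) : ℂ)‖)
    (hf : ∀ η : StrongDual ℝ E, HasSum (fun α : Σ k : ℕ, Fin k → Fin n =>
      c α.1 α.2 * ∏ j, (η (b (α.2 j)) : ℂ)) (f η)) (k : ℕ) :
    majCoeff (dualFrame b) 0 k f = ∑ α, ‖c k α‖ := by
  simp only [majCoeff, iterLieDeriv_dualFrame_zero b hc hs hf, norm_mul, Complex.norm_natCast]
  rw [← Finset.mul_sum, inv_mul_cancel_left₀ (by exact_mod_cast k.factorial_ne_zero)]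

end SymmetricSeries

/-! ### Symmetric tensors in coordinates: the projective norm as an `ℓ¹`-norm. -/

section SymmetricTensors

variable {n : ℕ}

/-- Words in `n` letters, of arbitrary length. -/
abbrev Word (n : ℕ) : Type := Σ k : ℕ, Fin k → Fin n

/-- The basis of the tensor power given by the tensor products of basis vectors. -/
def tensorBasis (n k : ℕ) : Basis (Fin k → Fin n) ℂ (⨂[ℂ] _ : Fin k, L1Space n) :=
  Basis.piTensorProduct fun _ => PiLp.basisFun 1 ℂ (Fin n)

theorem tensorBasis_repr_tprod {k : ℕ} (m : Fin k → L1Space n) (α : Fin k → Fin n) :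
    (tensorBasis n k).repr (PiTensorProduct.tprod ℂ m) α = ∏ j, m j (α j) := by
  simp [tensorBasis, Basis.piTensorProduct_repr_tprod_apply]

theorem tensorBasis_apply {k : ℕ} (α : Fin k → Fin n) :
    tensorBasis n k α = PiTensorProduct.tprod ℂ fun j => PiLp.basisFun 1 ℂ (Fin n) (α j) :=
  Basis.piTensorProduct_apply _ _

theorem norm_tensorBasis_le {k : ℕ} (α : Fin k → Fin n) : ‖tensorBasis n k α‖ ≤ 1 := by
  rw [tensorBasis_apply]
  refine (PiTensorProduct.projectiveSeminorm_tprod_le _).trans ?_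
  refine Finset.prod_le_one (fun _ _ => norm_nonneg _) fun j _ => ?_
  simp [PiLp.basisFun_apply]

/-- For a pure tensor the sum of absolute coefficients is the product of the `ℓ¹`-norms of the
factors, so by the triangle inequality no decomposition costs less than the coefficients do. -/
theorem sum_norm_repr_le {k : ℕ} (t : ⨂[ℂ] _ : Fin k, L1Space n) :
    ∑ α, ‖(tensorBasis n k).repr t α‖ ≤ ‖t‖ := by
  rw [PiTensorProduct.norm_def]
  refine le_ciInf fun ⟨p, hp⟩ => ?_
  rw [PiTensorProduct.mem_lifts_iff] at hp
  change ∑ α, ‖(tensorBasis n k).repr t α‖ ≤ PiTensorProduct.projectiveSeminormAux p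
  rw [← hp]
  simp only [PiTensorProduct.projectiveSeminormAux]
  generalize p.toList = l
  induction l with
  | nil => simp
  | cons x l ih =>
    simp only [List.map_cons, List.sum_cons, map_add, Finsupp.add_apply, map_smul,
      Finsupp.smul_apply, tensorBasis_repr_tprod]
    refine (Finset.sum_le_sum fun α _ => norm_add_le _ _).trans ?_
    rw [Finset.sum_add_distrib]
    refine add_le_add (le_of_eq ?_) ih
    simp only [norm_smul, norm_prod, ← Finset.mul_sum]
    congr 1
    have h : ∀ j, ‖x.2 j‖ = ∑ i, ‖x.2 j i‖ := fun j => PiLp.norm_eq_of_L1 _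
    simp only [h, Finset.prod_univ_sum, Fintype.piFinset_univ]

theorem tensorBasis_repr_reindex {k : ℕ} (σ : Equiv.Perm (Fin k))
    (t : ⨂[ℂ] _ : Fin k, L1Space n) (α : Fin k → Fin n) :
    (tensorBasis n k).repr (PiTensorProduct.reindex ℂ (fun _ : Fin k => L1Space n) σ t) α =
      (tensorBasis n k).repr t (α ∘ σ) := by
  induction t using PiTensorProduct.induction_on with
  | smul_tprod r m =>
    rw [map_smul, map_smul, map_smul, Finsupp.smul_apply, Finsupp.smul_apply,
      PiTensorProduct.reindex_tprod, tensorBasis_repr_tprod, tensorBasis_repr_tprod]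
    congr 1
    exact Fintype.prod_equiv σ.symm _ _ fun j => by simp
  | add x y hx hy => simp only [map_add, Finsupp.add_apply, hx, hy]

theorem tensorBasis_repr_perm {k : ℕ} (t : SymPower n k) (σ : Equiv.Perm (Fin k))
    (α : Fin k → Fin n) :
    (tensorBasis n k).repr (t : ⨂[ℂ] _ : Fin k, L1Space n) (α ∘ σ) =
      (tensorBasis n k).repr (t : ⨂[ℂ] _ : Fin k, L1Space n) α := by
  rw [← tensorBasis_repr_reindex, t.2 σ]

theorem reindex_tensorBasis {k : ℕ} (σ : Equiv.Perm (Fin k)) (α : Fin k → Fin n) :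
    PiTensorProduct.reindex ℂ (fun _ : Fin k => L1Space n) σ (tensorBasis n k α) =
      tensorBasis n k (α ∘ σ.symm) := by
  rw [tensorBasis_apply, tensorBasis_apply, PiTensorProduct.reindex_tprod]
  rfl

/-- The symmetrization of a tensor product of basis vectors. -/
def symTensor {k : ℕ} (α : Fin k → Fin n) : SymPower n k :=
  ⟨((k.factorial : ℂ)⁻¹) • ∑ σ : Equiv.Perm (Fin k), tensorBasis n k (α ∘ σ), fun τ => by
    rw [map_smul, map_sum]
    congr 1
    simp only [reindex_tensorBasis]
    exact Fintype.sum_equiv (Equiv.mulRight τ⁻¹) _ _ fun σ => rfl⟩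

theorem coe_symTensor {k : ℕ} (α : Fin k → Fin n) :
    (symTensor α : ⨂[ℂ] _ : Fin k, L1Space n) =
      ((k.factorial : ℂ)⁻¹) • ∑ σ : Equiv.Perm (Fin k), tensorBasis n k (α ∘ σ) := rfl

theorem norm_symTensor_le {k : ℕ} (α : Fin k → Fin n) :
    ‖(symTensor α : ⨂[ℂ] _ : Fin k, L1Space n)‖ ≤ 1 := by
  rw [coe_symTensor, norm_smul, norm_inv, Complex.norm_natCast,
    inv_mul_le_iff₀ (by positivity), mul_one]
  refine (norm_sum_le _ _).trans ((Finset.sum_le_sum fun σ _ => norm_tensorBasis_le _).trans ?_)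
  simp [Fintype.card_perm]

/-- The coefficients of a symmetric tensor are constant on permuted words, so averaging the basis
tensors over permutations does not change the sum. -/
theorem sum_repr_smul_symTensor {k : ℕ} (t : SymPower n k) :
    ∑ α, (tensorBasis n k).repr (t : ⨂[ℂ] _ : Fin k, L1Space n) α • symTensor α = t := by
  apply Subtype.ext
  rw [Submodule.coe_sum]
  simp only [Submodule.coe_smul, coe_symTensor]
  have h1 : ∀ σ : Equiv.Perm (Fin k), ∑ α, (tensorBasis n k).repr
      (t : ⨂[ℂ] _ : Fin k, L1Space n) α • tensorBasis n k (α ∘ σ) = t := by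
    intro σ
    conv_rhs => rw [← (tensorBasis n k).sum_repr (t : ⨂[ℂ] _ : Fin k, L1Space n)]
    refine Fintype.sum_equiv (Equiv.arrowCongr σ.symm (Equiv.refl (Fin n))) _ _ fun α => ?_
    have : (Equiv.arrowCongr σ.symm (Equiv.refl (Fin n))) α = α ∘ σ := by
      funext j; simp [Equiv.arrowCongr]
    rw [this, tensorBasis_repr_perm]
  simp only [smul_comm _ ((k.factorial : ℂ)⁻¹), Finset.smul_sum]
  rw [Finset.sum_comm]
  simp only [← Finset.smul_sum, h1]
  rw [Finset.sum_const, Finset.card_univ, Fintype.card_perm, Fintype.card_fin,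
    ← Nat.cast_smul_eq_nsmul ℂ, smul_smul,
    inv_mul_cancel₀ (by exact_mod_cast k.factorial_ne_zero), one_smul]

theorem evalTensor_tensorBasis {k : ℕ} (y : Fin n → ℝ) (α : Fin k → Fin n) :
    evalTensor y k (tensorBasis n k α) = ∏ j, (y (α j) : ℂ) := by
  rw [tensorBasis_apply, evalTensor, PiTensorProduct.lift.tprod]
  simp [PiLp.basisFun_apply]

theorem evalTensor_symTensor {k : ℕ} (y : Fin n → ℝ) (α : Fin k → Fin n) :
    evalTensor y k (symTensor α : ⨂[ℂ] _ : Fin k, L1Space n) = ∏ j, (y (α j) : ℂ) := by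
  rw [coe_symTensor, map_smul, map_sum]
  have h : ∀ σ : Equiv.Perm (Fin k), evalTensor y k (tensorBasis n k (α ∘ σ)) =
      ∏ j, (y (α j) : ℂ) := fun σ => by
    rw [evalTensor_tensorBasis]
    exact Equiv.prod_comp σ fun j => (y (α j) : ℂ)
  simp only [h, Finset.sum_const, Finset.card_univ, Fintype.card_perm, Fintype.card_fin,
    nsmul_eq_mul, smul_eq_mul]
  rw [inv_mul_cancel_left₀ (by exact_mod_cast k.factorial_ne_zero)]

/-- The coefficient of an element of the symmetric algebra at a word. -/
def symCoeff (w : Word n) : SymAlg n →ₗ[ℂ] ℂ :=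
  (tensorBasis n w.1).coord w.2 ∘ₗ (SymPower n w.1).subtype ∘ₗ
    DirectSum.component ℂ ℕ (fun k => SymPower n k) w.1

theorem symCoeff_apply (w : Word n) (v : SymAlg n) : symCoeff w v =
    (tensorBasis n w.1).repr (v w.1 : ⨂[ℂ] _ : Fin w.1, L1Space n) w.2 := rfl

/-- The monomial of the symmetric algebra given by a word. -/
def symMonomial (w : Word n) : SymAlg n :=
  DirectSum.lof ℂ ℕ (fun k => SymPower n k) w.1 (symTensor w.2)

theorem evalSym_symMonomial (y : Fin n → ℝ) (w : Word n) :
    evalSym y (symMonomial w) = ∏ j, (y (w.2 j) : ℂ) := by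
  rw [evalSym, symMonomial, DirectSum.toModule_lof, LinearMap.comp_apply, Submodule.subtype_apply,
    evalTensor_symTensor]

/-- Only the component of degree `w.1` survives, and symmetrizing does not push the norm above `1`.
Together with `tsum_symCoeff_le` this makes `symSeminorm` the weighted `ℓ¹`-norm of the
coefficients. -/
theorem symSeminorm_symMonomial_le (R' : ℝ) (c : ℝ≥0) (w : Word n) :
    symSeminorm n R' c (symMonomial w) ≤ (w.1.factorial : ℝ) ^ R' * (c : ℝ) ^ w.1 := by
  change ∑ᶠ k : ℕ, (k.factorial : ℝ) ^ R' * (c : ℝ) ^ k *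
    ‖(symMonomial w k : ⨂[ℂ] _ : Fin k, L1Space n)‖ ≤ _
  rw [finsum_eq_single _ w.1]
  · have h : symMonomial w w.1 = symTensor w.2 := DirectSum.of_eq_same _ _
    rw [h]
    exact mul_le_of_le_one_right (by positivity) (norm_symTensor_le _)
  · intro k hk
    have h : symMonomial w k = 0 := DirectSum.of_eq_of_ne _ _ _ hk
    rw [h, Submodule.coe_zero, norm_zero, mul_zero]

theorem tsum_symCoeff_le (R' : ℝ) (c : ℝ≥0) (v : SymAlg n) :
    ∑' w : Word n, ENNReal.ofReal ((w.1.factorial : ℝ) ^ R' * (c : ℝ) ^ w.1 * ‖symCoeff w v‖) ≤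
      ENNReal.ofReal (symSeminorm n R' c v) := by
  have hfin := finite_support_symSeminorm n R' c v
  have h : symSeminorm n R' c v = ∑ k ∈ hfin.toFinset, (k.factorial : ℝ) ^ R' * (c : ℝ) ^ k *
      ‖(v k : ⨂[ℂ] _ : Fin k, L1Space n)‖ := finsum_eq_sum_of_support_subset _ (by simp)
  rw [ENNReal.tsum_sigma', h, ENNReal.ofReal_sum_of_nonneg fun _ _ => by positivity]
  refine (ENNReal.tsum_le_tsum fun k => ?_).trans_eq
    (tsum_eq_sum (s := hfin.toFinset) (f := fun k : ℕ => ENNReal.ofReal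
      ((k.factorial : ℝ) ^ R' * (c : ℝ) ^ k * ‖(v k : ⨂[ℂ] _ : Fin k, L1Space n)‖)) ?_)
  · rw [tsum_fintype, ← ENNReal.ofReal_sum_of_nonneg fun _ _ => by positivity]
    refine ENNReal.ofReal_le_ofReal ?_
    simp only [symCoeff_apply]
    rw [← Finset.mul_sum]
    exact mul_le_mul_of_nonneg_left (sum_norm_repr_le _) (by positivity)
  · intro k hk
    rw [Set.Finite.mem_toFinset, Function.mem_support, not_not] at hk
    rw [hk, ENNReal.ofReal_zero]

/-- Words are not taken up to reordering: the expansion is redundant, all permutations of a word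
sharing one coefficient, but it costs nothing in the `ℓ¹`-norm. -/
theorem exists_sum_symMonomial (v : SymAlg n) : ∃ s : Finset (Word n),
    (∀ w ∉ s, symCoeff w v = 0) ∧ v = ∑ w ∈ s, symCoeff w v • symMonomial w := by
  classical
  refine ⟨(DFinsupp.support v).sigma fun k => Finset.univ, fun w hw => ?_, ?_⟩
  · have h : v w.1 = 0 := by
      by_contra h0
      exact hw (Finset.mem_sigma.2 ⟨(DFinsupp.mem_support_toFun _ _).2 h0, Finset.mem_univ _⟩)
    rw [symCoeff_apply, h]
    simp
  · conv_lhs => rw [← DirectSum.sum_support_of v]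
    rw [Finset.sum_sigma]
    refine Finset.sum_congr rfl fun k _ => ?_
    conv_lhs => rw [← sum_repr_smul_symTensor (v k)]
    simp only [symMonomial, symCoeff_apply, ← map_smul]
    exact map_sum (DirectSum.lof ℂ ℕ (fun k => SymPower n k) k) _ _

theorem symCoeff_perm {k : ℕ} (α : Fin k → Fin n) (σ : Equiv.Perm (Fin k)) (v : SymAlg n) :
    symCoeff ⟨k, α ∘ σ⟩ v = symCoeff ⟨k, α⟩ v :=
  tensorBasis_repr_perm (v k) σ α

end SymmetricTensors

/-! ### Weighted norms of families of analytic functions -/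

section Families

variable {E : Type*} [NormedAddCommGroup E] [NormedSpace ℝ E]
  {G : Type*} [TopologicalSpace G] [ChartedSpace E G] [Group G] [LieGroup 𝓘(ℝ, E) ω G]
  {n : ℕ} (b : Basis (Fin n) ℝ (GroupLieAlgebra 𝓘(ℝ, E) G)) (R R' : ℝ)

/-- The sum `∑ j!^R c_j(f) c^j` with values in `[0, ∞]`. -/
def entireNorm (c : ℝ≥0) (f : G → ℂ) : ℝ≥0∞ :=
  ∑' j : ℕ, ENNReal.ofReal ((j.factorial : ℝ) ^ R * majCoeff (leftFrame b) 1 j f * (c : ℝ) ^ j)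

/-- The weight `k!^{R'} c^k` of a word of length `k`. -/
def wordWeight (c : ℝ≥0) (w : Word n) : ℝ≥0∞ :=
  ENNReal.ofReal ((w.1.factorial : ℝ) ^ R' * (c : ℝ) ^ w.1)

/-- The weighted `ℓ¹`-norm of a family of functions indexed by words. -/
def familyNorm (i : ℝ≥0 × ℝ≥0) (a : Word n → G → ℂ) : ℝ≥0∞ :=
  ∑' w, wordWeight R' i.2 w * entireNorm b R i.1 (a w)

theorem one_le_factorial_rpow {s : ℝ} (hs : 0 ≤ s) (k : ℕ) : (1 : ℝ) ≤ (k.factorial : ℝ) ^ s :=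
  Real.one_le_rpow (by exact_mod_cast Nat.one_le_iff_ne_zero.2 k.factorial_ne_zero) hs

variable {R R'}

omit [LieGroup 𝓘(ℝ, E) ω G] in
-- For `R ≥ 0` the weights `j!^R` are at least `1`, so the seminorms dominate the unweighted
-- majorants to which the estimates on the group apply.
theorem lieNorm_le_entireNorm (hR : 0 ≤ R) (c : ℝ≥0) (f : G → ℂ) :
    lieNorm (leftFrame b) c f 1 ≤ entireNorm b R c f := by
  refine ENNReal.tsum_le_tsum fun j => ENNReal.ofReal_le_ofReal ?_
  rw [mul_assoc]
  exact le_mul_of_one_le_left (mul_nonneg (majCoeff_nonneg _ _ _ _) (by positivity))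
    (one_le_factorial_rpow hR j)

theorem pow_le_wordWeight (hR' : 0 ≤ R') (c : ℝ≥0) (w : Word n) :
    (c : ℝ≥0∞) ^ w.1 ≤ wordWeight R' c w := by
  rw [wordWeight, ← ENNReal.coe_pow, ← ENNReal.ofReal_coe_nnreal]
  refine ENNReal.ofReal_le_ofReal ?_
  rw [NNReal.coe_pow]
  exact le_mul_of_one_le_left (by positivity) (one_le_factorial_rpow hR' _)

omit [LieGroup 𝓘(ℝ, E) ω G] in
theorem entireNorm_le_familyNorm (hR' : 0 ≤ R') (c : ℝ≥0) (a : Word n → G → ℂ) (w : Word n) :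
    entireNorm b R c (a w) ≤ familyNorm b R R' (c, 1) a := by
  refine le_trans ?_ (ENNReal.le_tsum w)
  refine le_mul_of_one_le_left zero_le ?_
  simpa using pow_le_wordWeight hR' 1 w

omit [LieGroup 𝓘(ℝ, E) ω G] in
-- As one sum over pairs of a word and a degree, the norm is ready for Fatou's lemma and the
-- termwise triangle inequality.
theorem familyNorm_eq_tsum_prod (i : ℝ≥0 × ℝ≥0) (a : Word n → G → ℂ) :
    familyNorm b R R' i a = ∑' x : Word n × ℕ, ENNReal.ofReal
      ((x.1.1.factorial : ℝ) ^ R' * (i.2 : ℝ) ^ x.1.1 *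
        ((x.2.factorial : ℝ) ^ R * majCoeff (leftFrame b) 1 x.2 (a x.1) * (i.1 : ℝ) ^ x.2)) := by
  rw [familyNorm, ENNReal.tsum_prod']
  refine tsum_congr fun w => ?_
  rw [entireNorm, ← ENNReal.tsum_mul_left]
  refine tsum_congr fun j => ?_
  rw [wordWeight, ← ENNReal.ofReal_mul (by positivity)]

theorem familyNorm_add_le {a a' : Word n → G → ℂ} (ha : ∀ w, ContMDiff 𝓘(ℝ, E) 𝓘(ℝ, ℂ) ω (a w))
    (ha' : ∀ w, ContMDiff 𝓘(ℝ, E) 𝓘(ℝ, ℂ) ω (a' w)) (i : ℝ≥0 × ℝ≥0) :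
    familyNorm b R R' i (a + a') ≤ familyNorm b R R' i a + familyNorm b R R' i a' := by
  simp only [familyNorm_eq_tsum_prod]
  rw [← ENNReal.tsum_add]
  refine ENNReal.tsum_le_tsum fun x => ?_
  have h0 := fun f => majCoeff_nonneg (leftFrame b) 1 x.2 f
  rw [← ENNReal.ofReal_add (mul_nonneg (by positivity) (mul_nonneg (mul_nonneg (by positivity)
    (h0 _)) (by positivity))) (mul_nonneg (by positivity) (mul_nonneg (mul_nonneg (by positivity)
    (h0 _)) (by positivity))), ← mul_add, ← add_mul, ← mul_add]
  refine ENNReal.ofReal_le_ofReal ?_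
  have h1 : majCoeff (leftFrame b) 1 x.2 ((a + a') x.1) ≤ _ :=
    majCoeff_add_le (fun i => contMDiff_invariantField (b i)) 1 x.2 (ha x.1) (ha' x.1)
  gcongr
  exact h1

omit [LieGroup 𝓘(ℝ, E) ω G] in
theorem tendsto_majCoeff {ι : Type*} {l : Filter ι} {f : ι → G → ℂ} {F : G → ℂ} {g : G}
    (h : ∀ α, Tendsto (fun i => iterLieDeriv (leftFrame b) α (f i) g) l
      (𝓝 (iterLieDeriv (leftFrame b) α F g))) (k : ℕ) :
    Tendsto (fun i => majCoeff (leftFrame b) g k (f i)) l (𝓝 (majCoeff (leftFrame b) g k F)) :=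
  (tendsto_finsetSum _ fun α _ => (h (List.ofFn α)).norm).const_mul _

omit [LieGroup 𝓘(ℝ, E) ω G] in
theorem familyNorm_le_of_tendsto {ι : Type*} {l : Filter ι} [l.NeBot] {f : ι → Word n → G → ℂ}
    {a : Word n → G → ℂ} (h : ∀ w α, Tendsto (fun i => iterLieDeriv (leftFrame b) α (f i w) 1) l
      (𝓝 (iterLieDeriv (leftFrame b) α (a w) 1))) {i : ℝ≥0 × ℝ≥0} {M : ℝ≥0∞}
    (hM : ∀ᶠ x in l, familyNorm b R R' i (f x) ≤ M) : familyNorm b R R' i a ≤ M := by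
  simp only [familyNorm_eq_tsum_prod] at hM ⊢
  exact tsum_le_of_tendsto (fun x => ENNReal.tendsto_ofReal
    (((((tendsto_majCoeff b (h x.1) x.2).const_mul _).mul_const _).const_mul _))) hM

omit [LieGroup 𝓘(ℝ, E) ω G] in
theorem tsum_lieNorm_le_familyNorm (hR : 0 ≤ R) (i : ℝ≥0 × ℝ≥0) (a : Word n → G → ℂ) :
    ∑' w, wordWeight R' i.2 w * lieNorm (leftFrame b) i.1 (a w) 1 ≤ familyNorm b R R' i a :=
  ENNReal.tsum_le_tsum fun _ => mul_le_mul_right (lieNorm_le_entireNorm b hR _ _) _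

/-- A value at `g` is the zeroth term of the majorant there, and the increment `d` that leads back
to `1` is the same for all words. -/
theorem exists_tsum_enorm_le_familyNorm [ConnectedSpace G] (hR : 0 ≤ R) (g : G) :
    ∃ d : ℝ≥0, ∀ a : Word n → G → ℂ, (∀ w, ContMDiff 𝓘(ℝ, E) 𝓘(ℝ, ℂ) ω (a w)) → ∀ c,
      ∑' w, wordWeight R' c w * ‖a w g‖ₑ ≤ familyNorm b R R' (d, c) a := by
  obtain ⟨d, hd⟩ := exists_lieNorm_le b g
  refine ⟨d, fun a ha c => le_trans (ENNReal.tsum_le_tsum fun w => ?_)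
    (tsum_lieNorm_le_familyNorm b hR (d, c) a)⟩
  refine mul_le_mul_right ?_ _
  refine (enorm_le_lieNorm (leftFrame b) 0 (a w) g).trans ((hd _ (ha w) 0).trans_eq ?_)
  rw [zero_add]

theorem summable_of_tsum_ofReal_ne_top {κ : Type*} {u : κ → ℝ} (hu : ∀ x, 0 ≤ u x)
    (h : ∑' x, ENNReal.ofReal (u x) ≠ ⊤) : Summable u :=
  (ENNReal.summable_toReal h).congr fun x => ENNReal.toReal_ofReal (hu x)

omit [LieGroup 𝓘(ℝ, E) ω G] in
theorem isREntire_of_entireNorm_ne_top {f : G → ℂ} (hf : ContMDiff 𝓘(ℝ, E) 𝓘(ℝ, ℂ) ω f)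
    (h : ∀ c, entireNorm b R c f ≠ ⊤) : IsREntire (leftFrame b) 1 R f := by
  refine ⟨hf, fun c hc => ?_⟩
  lift c to ℝ≥0 using hc
  exact summable_of_tsum_ofReal_ne_top (fun j => mul_nonneg (mul_nonneg (by positivity)
    (majCoeff_nonneg _ _ _ _)) (by positivity)) (h c)

theorem ofReal_entireSeminorm (c : ℝ≥0) (φ : EntireSpace b R) :
    ENNReal.ofReal (entireSeminorm b R c φ) = entireNorm b R c φ :=
  ENNReal.ofReal_tsum_of_nonneg (fun j => mul_nonneg (mul_nonneg (by positivity)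
    (majCoeff_nonneg _ _ _ _)) (by positivity)) (φ.2.2 c c.2)

end Families

/-! ### Coefficients of polynomial observables -/

section PolCoefficients

theorem projSeminorm_tmul_le {A B : Type*} [AddCommGroup A] [Module ℂ A] [AddCommGroup B]
    [Module ℂ B] (q : Seminorm ℂ A) (p : Seminorm ℂ B) (a : A) (b : B) :
    projSeminorm q p (a ⊗ₜ[ℂ] b) ≤ q a * p b :=
  ciInf_le_of_le (projSeminorm_bddBelow q p (a ⊗ₜ[ℂ] b)) ⟨[(a, b)], by simp⟩ (by simp)

/-- Some decomposition of `t` exists, so `m` is finite and the bound can be compared with a real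
infimum. -/
theorem le_ofReal_projSeminorm {A B : Type*} [AddCommGroup A] [Module ℂ A] [AddCommGroup B]
    [Module ℂ B] (q : Seminorm ℂ A) (p : Seminorm ℂ B) (t : A ⊗[ℂ] B) {m : ℝ≥0∞}
    (h : ∀ l : List (A × B), (l.map fun x => x.1 ⊗ₜ[ℂ] x.2).sum = t →
      m ≤ ENNReal.ofReal (l.map fun x => q x.1 * p x.2).sum) :
    m ≤ ENNReal.ofReal (projSeminorm q p t) := by
  have hne := projSeminorm_nonempty t
  have hm : m ≠ ⊤ := ne_top_of_le_ne_top ENNReal.ofReal_ne_top (h hne.some.1 hne.some.2)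
  rw [ENNReal.le_ofReal_iff_toReal_le hm (apply_nonneg _ _)]
  exact le_ciInf fun l =>
    (ENNReal.le_ofReal_iff_toReal_le hm (projSeminorm_nonneg q p l.1)).1 (h l.1 l.2)

variable {E : Type*} [NormedAddCommGroup E] [NormedSpace ℝ E]
  {G : Type*} [TopologicalSpace G] [ChartedSpace E G] [Group G] [LieGroup 𝓘(ℝ, E) ω G]
  {n : ℕ} (b : Basis (Fin n) ℝ (GroupLieAlgebra 𝓘(ℝ, E) G)) (R R' : ℝ)

/-- The coefficient of a polynomial observable at a word. -/
def polCoeff (w : Word n) : Pol b R R' →ₗ[ℂ] EntireSpace b R :=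
  (TensorProduct.rid ℂ (EntireSpace b R)).toLinearMap ∘ₗ
    LinearMap.lTensor (EntireSpace b R) (symCoeff w)

/-- The pure tensor `φ ⊗ v`. -/
def polTmul (φ : EntireSpace b R) (v : SymAlg n) : Pol b R R' := φ ⊗ₜ[ℂ] v

variable {R R'}

theorem polCoeff_polTmul (w : Word n) (φ : EntireSpace b R) (v : SymAlg n) :
    polCoeff b R R' w (polTmul b R R' φ v) = symCoeff w v • φ := rfl

theorem polEval_polTmul (g : G) (η : StrongDual ℝ E) (φ : EntireSpace b R) (v : SymAlg n) :
    polEval b R R' g η (polTmul b R R' φ v) = (φ : G → ℂ) g * evalSym (fun i => η (b i)) v := rfl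

theorem add_polTmul (φ ψ : EntireSpace b R) (v : SymAlg n) :
    polTmul b R R' (φ + ψ) v = polTmul b R R' φ v + polTmul b R R' ψ v :=
  TensorProduct.add_tmul φ ψ v

theorem zero_polTmul (v : SymAlg n) : polTmul b R R' 0 v = 0 := TensorProduct.zero_tmul _ v

theorem pol_induction {p : Pol b R R' → Prop} (h0 : p 0) (ht : ∀ φ v, p (polTmul b R R' φ v))
    (hadd : ∀ P Q, p P → p Q → p (P + Q)) (P : Pol b R R') : p P :=
  TensorProduct.induction_on (motive := p) P h0 ht hadd

theorem exists_sum_polTmul (P : Pol b R R') : ∃ s : Finset (Word n),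
    (∀ w ∉ s, polCoeff b R R' w P = 0) ∧
      P = ∑ w ∈ s, polTmul b R R' (polCoeff b R R' w P) (symMonomial w) := by
  classical
  induction P using pol_induction with
  | h0 => exact ⟨∅, fun w _ => map_zero _, by rw [Finset.sum_empty]⟩
  | ht φ v =>
    obtain ⟨s, hs, hv⟩ := exists_sum_symMonomial v
    refine ⟨s, fun w hw => ?_, ?_⟩
    · rw [polCoeff_polTmul, hs w hw, zero_smul]
    · simp only [polCoeff_polTmul]
      conv_lhs => rw [hv]
      refine (TensorProduct.tmul_sum _ _ _).trans ?_
      exact Finset.sum_congr rfl fun w _ => (TensorProduct.smul_tmul _ _ _).symm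
  | hadd P Q hP hQ =>
    obtain ⟨s, hs, hP⟩ := hP
    obtain ⟨t, ht, hQ⟩ := hQ
    refine ⟨s ∪ t, fun w hw => ?_, ?_⟩
    · rw [Finset.notMem_union] at hw
      rw [map_add, hs w hw.1, ht w hw.2, add_zero]
    · simp only [map_add, add_polTmul, Finset.sum_add_distrib]
      rw [← Finset.sum_subset Finset.subset_union_left
        (fun w _ hw => by rw [hs w hw, zero_polTmul]),
        ← Finset.sum_subset Finset.subset_union_right
        (fun w _ hw => by rw [ht w hw, zero_polTmul]), ← hP, ← hQ]

theorem polEval_eq_sum {P : Pol b R R'} {s : Finset (Word n)}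
    (hP : P = ∑ w ∈ s, polTmul b R R' (polCoeff b R R' w P) (symMonomial w)) (g : G)
    (η : StrongDual ℝ E) : polEval b R R' g η P =
      ∑ w ∈ s, (polCoeff b R R' w P : G → ℂ) g * ∏ j, (η (b (w.2 j)) : ℂ) := by
  conv_lhs => rw [hP]
  rw [map_sum]
  refine Finset.sum_congr rfl fun w _ => ?_
  rw [polEval_polTmul, evalSym_symMonomial]

theorem polSeminorm_polTmul_le (i : ℝ≥0 × ℝ≥0) (φ : EntireSpace b R) (v : SymAlg n) :
    polSeminorm b R R' i (polTmul b R R' φ v) ≤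
      entireSeminorm b R i.1 φ * symSeminorm n R' i.2 v :=
  projSeminorm_tmul_le _ _ φ v

/-- The expansion into symmetrized monomials is one admissible decomposition, and its cost is at
most the weighted `ℓ¹`-norm of the coefficients. -/
theorem ofReal_polSeminorm_le_familyNorm (i : ℝ≥0 × ℝ≥0) (P : Pol b R R') :
    ENNReal.ofReal (polSeminorm b R R' i P) ≤
      familyNorm b R R' i fun w => polCoeff b R R' w P := by
  obtain ⟨s, -, hP⟩ := exists_sum_polTmul b P
  refine le_trans ?_ (ENNReal.sum_le_tsum s)
  have h1 : polSeminorm b R R' i P ≤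
      ∑ w ∈ s, ((w.1.factorial : ℝ) ^ R' * (i.2 : ℝ) ^ w.1) *
        entireSeminorm b R i.1 (polCoeff b R R' w P) := by
    conv_lhs => rw [hP]
    refine (Finset.le_sum_of_subadditive _ (map_zero _).le (map_add_le_add (polSeminorm b R R' i)) _
      _).trans (Finset.sum_le_sum fun w _ => ?_)
    refine (polSeminorm_polTmul_le b i _ _).trans ?_
    rw [mul_comm]
    exact mul_le_mul_of_nonneg_right (symSeminorm_symMonomial_le _ _ _) (apply_nonneg _ _)
  refine (ENNReal.ofReal_le_ofReal h1).trans (le_of_eq ?_)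
  rw [ENNReal.ofReal_sum_of_nonneg fun w _ => mul_nonneg (by positivity) (apply_nonneg _ _)]
  refine Finset.sum_congr rfl fun w _ => ?_
  rw [ENNReal.ofReal_mul (by positivity), ofReal_entireSeminorm]
  rfl

theorem familyNorm_polTmul_le (i : ℝ≥0 × ℝ≥0) (φ : EntireSpace b R) (v : SymAlg n) :
    familyNorm b R R' i (fun w => polCoeff b R R' w (polTmul b R R' φ v)) ≤
      ENNReal.ofReal (entireSeminorm b R i.1 φ * symSeminorm n R' i.2 v) := by
  rw [ENNReal.ofReal_mul (apply_nonneg _ _)]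
  refine le_trans (le_of_eq ?_) (mul_le_mul_right (tsum_symCoeff_le R' i.2 v) _)
  rw [← ENNReal.tsum_mul_left]
  refine tsum_congr fun w => ?_
  rw [← ofReal_entireSeminorm, polCoeff_polTmul, map_smul_eq_mul, wordWeight,
    ← ENNReal.ofReal_mul (by positivity), ← ENNReal.ofReal_mul (apply_nonneg _ _)]
  congr 1
  ring

/-- Pure tensors satisfy the bound by `tsum_symCoeff_le`, and the triangle inequality carries it to
every decomposition. With the reverse estimate, the projective seminorm is the `ℓ¹`-norm of the
coefficient family. -/
theorem familyNorm_polCoeff_le (i : ℝ≥0 × ℝ≥0) (P : Pol b R R') :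
    familyNorm b R R' i (fun w => polCoeff b R R' w P) ≤
      ENNReal.ofReal (polSeminorm b R R' i P) := by
  have h1 : ∀ l : List (EntireSpace b R × SymAlg n),
      familyNorm b R R' i (fun w => polCoeff b R R' w
        (l.map fun x => polTmul b R R' x.1 x.2).sum) ≤
      ENNReal.ofReal (l.map fun x => entireSeminorm b R i.1 x.1 * symSeminorm n R' i.2 x.2).sum := by
    intro l
    induction l with
    | nil =>
      have : ∀ w, entireNorm b R i.1 ((polCoeff b R R' w 0 : EntireSpace b R) : G → ℂ) = 0 := by
        intro w
        rw [← ofReal_entireSeminorm, map_zero, map_zero, ENNReal.ofReal_zero]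
      simp only [List.map_nil, List.sum_nil, familyNorm, this, mul_zero, tsum_zero, zero_le]
    | cons x l ih =>
      simp only [List.map_cons, List.sum_cons, map_add]
      rw [ENNReal.ofReal_add (mul_nonneg (apply_nonneg _ _) (apply_nonneg _ _))
        (projSeminorm_nonneg _ _ l)]
      refine le_trans ?_ (add_le_add (familyNorm_polTmul_le b i x.1 x.2) ih)
      exact familyNorm_add_le b (fun w => (polCoeff b R R' w _).2.1)
        (fun w => (polCoeff b R R' w _).2.1) i
  refine le_ofReal_projSeminorm (entireSeminorm b R i.1) (symSeminorm n R' i.2) _ fun l hl => ?_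
  have h4 : (l.map fun x => polTmul b R R' x.1 x.2).sum = P := hl
  have h3 := h1 l
  rwa [h4] at h3

end PolCoefficients

/-! ### Limits of polynomial observables -/

section Limits

variable {E : Type*} [NormedAddCommGroup E] [NormedSpace ℝ E]
  {G : Type*} [TopologicalSpace G] [ChartedSpace E G] [Group G] [LieGroup 𝓘(ℝ, E) ω G]
  {n : ℕ} (b : Basis (Fin n) ℝ (GroupLieAlgebra 𝓘(ℝ, E) G)) {R R' : ℝ}

theorem exists_tsum_enorm_monomial_le [ConnectedSpace G] (hR : 0 ≤ R) (hR' : 0 ≤ R') (g : G)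
    (η : StrongDual ℝ E) : ∃ i : ℝ≥0 × ℝ≥0, ∀ a : Word n → G → ℂ,
      (∀ w, ContMDiff 𝓘(ℝ, E) 𝓘(ℝ, ℂ) ω (a w)) →
      ∑' w, ‖a w g * ∏ j, (η (b (w.2 j)) : ℂ)‖ₑ ≤ familyNorm b R R' i a := by
  obtain ⟨d, hd⟩ := exists_tsum_enorm_le_familyNorm (R := R) (R' := R') b hR g
  -- `κ` bounds every coordinate of `η`, so a monomial of degree `k` is at most `κ ^ k`, which the
  -- word weight dominates.
  set κ : ℝ≥0 := ∑ i, ‖η (b i)‖₊ with hκ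
  refine ⟨(d, κ), fun a ha => (ENNReal.tsum_le_tsum fun w => ?_).trans (hd a ha κ)⟩
  rw [enorm_mul, mul_comm]
  gcongr
  refine le_trans ?_ (pow_le_wordWeight hR' κ w)
  rw [enorm_eq_nnnorm, nnnorm_prod, ← ENNReal.coe_pow, ENNReal.coe_le_coe]
  refine (Finset.prod_le_pow_card _ _ κ fun j _ => ?_).trans_eq (by simp)
  rw [Complex.nnnorm_real]
  exact Finset.single_le_sum (f := fun i => ‖η (b i)‖₊) (fun _ _ => zero_le) (Finset.mem_univ _)

theorem polCoeff_sub_coe (w : Word n) (P Q : Pol b R R') :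
    ((polCoeff b R R' w (P - Q) : EntireSpace b R) : G → ℂ) =
      (polCoeff b R R' w P : G → ℂ) - (polCoeff b R R' w Q : G → ℂ) := by
  rw [map_sub, Submodule.coe_sub]

variable {F : Filter (Pol b R R')}

theorem tendsto_familyNorm_sub (hC : ∀ i, Tendsto (fun p : Pol b R R' × Pol b R R' =>
      polSeminorm b R R' i (p.1 - p.2)) (F ×ˢ F) (𝓝 0)) (i : ℝ≥0 × ℝ≥0) :
    Tendsto (fun p : Pol b R R' × Pol b R R' => familyNorm b R R' i fun w =>
      (polCoeff b R R' w p.1 : G → ℂ) - (polCoeff b R R' w p.2 : G → ℂ)) (F ×ˢ F) (𝓝 0) := by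
  have h1 := ENNReal.tendsto_ofReal (hC i)
  rw [ENNReal.ofReal_zero] at h1
  refine tendsto_of_tendsto_of_tendsto_of_le_of_le tendsto_const_nhds h1 (fun _ => zero_le)
    fun p => ?_
  simp only [← polCoeff_sub_coe]
  exact familyNorm_polCoeff_le b i (p.1 - p.2)

theorem familyNorm_polCoeff_ne_top (i : ℝ≥0 × ℝ≥0) (P : Pol b R R') :
    familyNorm b R R' i (fun w => polCoeff b R R' w P) ≠ ⊤ :=
  ne_top_of_le_ne_top ENNReal.ofReal_ne_top (familyNorm_polCoeff_le b i P)

theorem exists_tendsto_of_enorm_sub {ι : Type*} {l : Filter ι} [l.NeBot] {f : ι → ℂ}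
    (h : Tendsto (fun p : ι × ι => ‖f p.1 - f p.2‖ₑ) (l ×ˢ l) (𝓝 0)) :
    ∃ z, Tendsto f l (𝓝 z) := by
  refine cauchy_map_iff_exists_tendsto.1 (cauchy_map_iff.2 ⟨inferInstance, ?_⟩)
  rw [tendsto_uniformity_iff_dist_tendsto_zero]
  refine ((ENNReal.tendsto_toReal ENNReal.zero_ne_top).comp h).congr fun p => ?_
  rw [Function.comp_apply, toReal_enorm, dist_eq_norm]

/-- This is completeness of the weighted `ℓ¹`-space: coefficients converge pointwise, their
derivatives at `1` follow, and Fatou turns the Cauchy condition into convergence in norm. -/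
theorem exists_limit_family [ConnectedSpace G] [F.NeBot] (hR : 0 ≤ R) (hR' : 0 ≤ R')
    (hC : ∀ i, Tendsto (fun p : Pol b R R' × Pol b R R' =>
      polSeminorm b R R' i (p.1 - p.2)) (F ×ˢ F) (𝓝 0)) :
    ∃ a : Word n → G → ℂ, (∀ w, ContMDiff 𝓘(ℝ, E) 𝓘(ℝ, ℂ) ω (a w)) ∧
      (∀ w g, Tendsto (fun P => (polCoeff b R R' w P : G → ℂ) g) F (𝓝 (a w g))) ∧
      (∀ i, familyNorm b R R' i a ≠ ⊤) ∧
      ∀ i (ε : ℝ≥0∞), 0 < ε → ∀ᶠ P in F,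
        familyNorm b R R' i (fun w => (polCoeff b R R' w P : G → ℂ) - a w) ≤ ε := by
  have hfam := tendsto_familyNorm_sub b hC
  have hlie : ∀ w c, Tendsto (fun p : Pol b R R' × Pol b R R' => lieNorm (leftFrame b) c
      ((polCoeff b R R' w p.1 : G → ℂ) - (polCoeff b R R' w p.2 : G → ℂ)) 1) (F ×ˢ F) (𝓝 0) :=
    fun w c => tendsto_of_tendsto_of_tendsto_of_le_of_le tendsto_const_nhds (hfam (c, 1))
      (fun _ => zero_le) fun p => (lieNorm_le_entireNorm b hR c _).trans
        (entireNorm_le_familyNorm b hR' c (fun w => (polCoeff b R R' w p.1 : G → ℂ) -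
          (polCoeff b R R' w p.2 : G → ℂ)) w)
  have hana : ∀ w (P : Pol b R R'), ContMDiff 𝓘(ℝ, E) 𝓘(ℝ, ℂ) ω (polCoeff b R R' w P : G → ℂ) :=
    fun w P => (polCoeff b R R' w P).2.1
  have hpt : ∀ w g, ∃ z, Tendsto (fun P => (polCoeff b R R' w P : G → ℂ) g) F (𝓝 z) := by
    intro w g
    obtain ⟨d, hd⟩ := exists_lieNorm_le b g
    refine exists_tendsto_of_enorm_sub (tendsto_of_tendsto_of_tendsto_of_le_of_le
      tendsto_const_nhds (hlie w (0 + d)) (fun _ => zero_le) fun p => ?_)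
    exact (enorm_le_lieNorm (leftFrame b) 0 _ g).trans
      (hd _ (sub_contMDiff (hana w p.1) (hana w p.2)) 0)
  choose a ha using hpt
  have hlim : ∀ w, ContMDiff 𝓘(ℝ, E) 𝓘(ℝ, ℂ) ω (a w) ∧ ∀ α g,
      Tendsto (fun P => iterLieDeriv (leftFrame b) α (polCoeff b R R' w P : G → ℂ) g) F
        (𝓝 (iterLieDeriv (leftFrame b) α (a w) g)) := fun w =>
    contMDiff_and_tendsto_iterLieDeriv b (hana w) (fun P c => ne_top_of_le_ne_top
      (familyNorm_polCoeff_ne_top b (c, 1) P) ((lieNorm_le_entireNorm b hR c _).trans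
        (entireNorm_le_familyNorm b hR' c (fun w => polCoeff b R R' w P) w))) (hlie w) (ha w)
  have happ : ∀ i (ε : ℝ≥0∞), 0 < ε → ∀ᶠ P in F,
      familyNorm b R R' i (fun w => (polCoeff b R R' w P : G → ℂ) - a w) ≤ ε := by
    intro i ε hε
    filter_upwards [((hfam i).eventually (Iic_mem_nhds hε)).curry] with P hP
    refine familyNorm_le_of_tendsto b (l := F)
      (f := fun Q w => (polCoeff b R R' w P : G → ℂ) - (polCoeff b R R' w Q : G → ℂ))
      (fun w α => ?_) hP
    rw [iterLieDeriv_sub b (hana w P) (hlim w).1]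
    simp only [iterLieDeriv_sub b (hana w P) (hana w _)]
    exact ((hlim w).2 α 1).const_sub _
  refine ⟨a, fun w => (hlim w).1, ha, fun i => ?_, happ⟩
  -- The swap of the factors fixes the subtracted term: one `P` has distance at most `1` from
  -- eventually all `Q`, and `Q` is written as `P + (Q - P)`.
  obtain ⟨P, hP⟩ := (((hfam i).comp (tendsto_snd.prodMk tendsto_fst)).eventually
    (Iic_mem_nhds one_pos)).curry.exists
  refine ne_top_of_le_ne_top (ENNReal.add_ne_top.2
    ⟨familyNorm_polCoeff_ne_top b i P, ENNReal.one_ne_top⟩)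
    (familyNorm_le_of_tendsto b (l := F) (f := fun Q w => (polCoeff b R R' w Q : G → ℂ))
      (fun w α => (hlim w).2 α 1) ?_)
  filter_upwards [hP] with Q hQ
  refine le_trans (le_of_eq ?_) ((familyNorm_add_le b (hana · P)
    (fun w => sub_contMDiff (hana w Q) (hana w P)) i).trans (add_le_add_right hQ _))
  congr 1
  funext w
  exact (add_sub_cancel _ _).symm

theorem summable_of_familyNorm_ne_top [ConnectedSpace G] (hR : 0 ≤ R) (hR' : 0 ≤ R')
    {a : Word n → G → ℂ} (ha : ∀ w, ContMDiff 𝓘(ℝ, E) 𝓘(ℝ, ℂ) ω (a w))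
    (hfin : ∀ i, familyNorm b R R' i a ≠ ⊤) (g : G) (η : StrongDual ℝ E) :
    Summable fun w : Word n => ‖a w g * ∏ j, (η (b (w.2 j)) : ℂ)‖ := by
  obtain ⟨i, hi⟩ := exists_tsum_enorm_monomial_le (R := R) (R' := R') b hR hR' g η
  exact summable_of_tsum_enorm_ne_top (ne_top_of_le_ne_top (hfin i) (hi a ha))

theorem hasSum_polEval (g : G) (η : StrongDual ℝ E) (P : Pol b R R') :
    HasSum (fun w : Word n => (polCoeff b R R' w P : G → ℂ) g * ∏ j, (η (b (w.2 j)) : ℂ))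
      (polEval b R R' g η P) := by
  obtain ⟨s, hs, hP⟩ := exists_sum_polTmul b P
  rw [polEval_eq_sum b hP]
  refine hasSum_sum_of_ne_finset_zero fun w hw => ?_
  rw [hs w hw, Submodule.coe_zero, Pi.zero_apply, zero_mul]

/-- The error between `P` and the series at `(g, η)` is at most the norm of the difference of the
coefficient families, which becomes arbitrarily small along `F`. -/
theorem hasSum_limit [ConnectedSpace G] [F.NeBot] (hR : 0 ≤ R) (hR' : 0 ≤ R')
    {a : Word n → G → ℂ} (ha : ∀ w, ContMDiff 𝓘(ℝ, E) 𝓘(ℝ, ℂ) ω (a w))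
    (hfin : ∀ i, familyNorm b R R' i a ≠ ⊤)
    (happ : ∀ i (ε : ℝ≥0∞), 0 < ε → ∀ᶠ P in F,
        familyNorm b R R' i (fun w => (polCoeff b R R' w P : G → ℂ) - a w) ≤ ε)
    {g : G} {η : StrongDual ℝ E} {z : ℂ}
    (hz : Tendsto (fun P => polEval b R R' g η P) F (𝓝 z)) :
    HasSum (fun w : Word n => a w g * ∏ j, (η (b (w.2 j)) : ℂ)) z := by
  obtain ⟨i, hi⟩ := exists_tsum_enorm_monomial_le (R := R) (R' := R') b hR hR' g η
  have hs := (summable_of_familyNorm_ne_top b hR hR' ha hfin g η).of_norm.hasSum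
  refine tendsto_nhds_unique hz ?_ ▸ hs
  rw [tendsto_iff_edist_tendsto_0, ENNReal.tendsto_nhds_zero]
  intro ε hε
  filter_upwards [happ i ε hε] with P hP
  rw [edist_eq_enorm_sub, ← ((hasSum_polEval b g η P).sub hs).tsum_eq]
  refine enorm_tsum_le_tsum_enorm.trans ((hi _ fun w =>
    sub_contMDiff (polCoeff b R R' w P).2.1 (ha w)).trans' (le_of_eq ?_) |>.trans hP)
  simp only [Pi.sub_apply, sub_mul]

/-! ### Joint analyticity on the group times the dual space. -/

section Smoothness

theorem taylorNorm_prod_le {V : Type*} [NormedAddCommGroup V] [NormedSpace ℝ V] {κ : Type*}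
    (s : Finset κ) {f : κ → V → ℂ} {x : V} (hf : ∀ i ∈ s, ContDiffAt ℝ ω (f i) x) (r : ℝ≥0) :
    taylorNorm r (fun y => ∏ i ∈ s, f i y) x ≤ ∏ i ∈ s, taylorNorm r (f i) x := by
  classical
  induction s using Finset.induction_on with
  | empty => simp [taylorNorm_const]
  | insert i s hi ih =>
    simp only [Finset.prod_insert hi]
    have h1 : ∀ j ∈ s, ContDiffAt ℝ ω (f j) x := fun j hj => hf j (Finset.mem_insert_of_mem hj)
    refine (taylorNorm_mul_le (hf i (Finset.mem_insert_self i s)) (contDiffAt_prod h1) r).trans ?_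
    gcongr
    exact ih h1

/-- A coordinate function on `𝔤*`, as a complex valued linear form on `E × 𝔤*`. -/
def letterForm (i : Fin n) : E × StrongDual ℝ E →L[ℝ] ℂ :=
  Complex.ofRealCLM ∘L basisEval b i ∘L ContinuousLinearMap.snd ℝ E (StrongDual ℝ E)

omit [LieGroup 𝓘(ℝ, E) ω G] in
theorem letterForm_apply (i : Fin n) (z : E × StrongDual ℝ E) :
    letterForm b i z = (z.2 (b i) : ℂ) := rfl

theorem contDiffAt_translate_fst {f : G → ℂ} (hf : ContMDiff 𝓘(ℝ, E) 𝓘(ℝ, ℂ) ω f) (g : G)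
    {z : E × StrongDual ℝ E} (hz : z.1 ∈ (oneChart E G).target) :
    ContDiffAt ℝ ω (fun z : E × StrongDual ℝ E => f (g * (oneChart E G).symm z.1)) z :=
  ContDiffAt.comp (g := fun y : E => f (g * (oneChart E G).symm y)) z
    (contDiffAt_comp_oneChart_symm (f := fun y => f (g * y)) (hf.comp contMDiff_mul_left) hz)
    contDiffAt_fst

/-- Taylor majorants are submultiplicative. In each term the coefficient depends on the group
variable only and is controlled along the frame; the monomial contributes at most `κ ^ k`, absorbed
by the word weight. -/
theorem exists_taylorNorm_polEval_le [ConnectedSpace G] (hR : 0 ≤ R) (hR' : 0 ≤ R') {r d : ℝ≥0}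
    (h : ∀ f : G → ℂ, ContMDiff 𝓘(ℝ, E) 𝓘(ℝ, ℂ) ω f →
        taylorNorm r (fun y => f ((oneChart E G).symm y)) (oneChart E G 1) ≤
          lieNorm (leftFrame b) d f 1) (g : G) (η : StrongDual ℝ E) :
    ∃ i : ℝ≥0 × ℝ≥0, ∀ P : Pol b R R',
      taylorNorm r (fun z : E × StrongDual ℝ E =>
        polEval b R R' (g * (oneChart E G).symm z.1) z.2 P) (oneChart E G 1, η) ≤
      familyNorm b R R' i fun w => polCoeff b R R' w P := by
  obtain ⟨e, he⟩ := exists_lieNorm_le b g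
  set κ : ℝ≥0 := ∑ i, (‖letterForm b i (oneChart E G 1, η)‖₊ + r * ‖letterForm b i‖₊) with hκ
  have hletter : ∀ i, taylorNorm r (fun z => letterForm b i z) (oneChart E G 1, η) ≤ κ := by
    intro i
    refine (taylorNorm_clm_le _ _ _).trans ?_
    simp only [enorm_eq_nnnorm]
    rw [← ENNReal.coe_mul, ← ENNReal.coe_add, ENNReal.coe_le_coe]
    exact Finset.single_le_sum (f := fun i => ‖letterForm b i (oneChart E G 1, η)‖₊ +
      r * ‖letterForm b i‖₊) (fun _ _ => zero_le) (Finset.mem_univ i)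
  refine ⟨(d + e, κ), fun P => ?_⟩
  obtain ⟨s, -, hP⟩ := exists_sum_polTmul b P
  simp only [polEval_eq_sum b hP, ← letterForm_apply]
  have h1 : ∀ w : Word n, ContDiffAt ℝ ω (fun y : E => (polCoeff b R R' w P : G → ℂ)
      (g * (oneChart E G).symm y)) (oneChart E G 1) := fun w =>
    contDiffAt_comp_oneChart_symm (f := fun y => (polCoeff b R R' w P : G → ℂ) (g * y))
      ((polCoeff b R R' w P).2.1.comp contMDiff_mul_left) oneChart_mem_target
  have h1' : ∀ w : Word n, ContDiffAt ℝ ω (fun z : E × StrongDual ℝ E =>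
      (polCoeff b R R' w P : G → ℂ) (g * (oneChart E G).symm z.1)) (oneChart E G 1, η) :=
    fun w => contDiffAt_translate_fst (polCoeff b R R' w P).2.1 g oneChart_mem_target
  have h2 : ∀ w : Word n, ContDiffAt ℝ ω (fun z : E × StrongDual ℝ E =>
      ∏ j, letterForm b (w.2 j) z) (oneChart E G 1, η) :=
    fun w => contDiffAt_prod fun j _ => (letterForm b (w.2 j)).contDiff.contDiffAt
  refine (taylorNorm_sum_le s (fun w _ => (h1' w).mul (h2 w)) r).trans ?_
  refine le_trans (Finset.sum_le_sum fun w _ => ?_) (ENNReal.sum_le_tsum s)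
  refine (taylorNorm_mul_le (h1' w) (h2 w) r).trans ?_
  rw [mul_comm]
  refine mul_le_mul' ?_ ?_
  · refine (taylorNorm_prod_le _ (fun j _ => (letterForm b (w.2 j)).contDiff.contDiffAt) r).trans ?_
    refine (Finset.prod_le_pow_card _ _ (κ : ℝ≥0∞) fun j _ => hletter _).trans ?_
    simpa using pow_le_wordWeight hR' κ w
  · have h3 := taylorNorm_comp_clm_le (ContinuousLinearMap.fst ℝ E (StrongDual ℝ E))
      (ContinuousLinearMap.norm_fst_le ..) (x := (oneChart E G 1, η)) (h1 w) r
    refine h3.trans ((taylorNorm_translate_le b h (polCoeff b R R' w P).2.1 g).trans ?_)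
    exact (he _ (polCoeff b R R' w P).2.1 d).trans (lieNorm_le_entireNorm b hR _ _)

theorem contMDiffAt_of_translate_prod {f : G × StrongDual ℝ E → ℂ} {g : G} {η : StrongDual ℝ E}
    (hf : ContDiffAt ℝ ω (fun z : E × StrongDual ℝ E => f (g * (oneChart E G).symm z.1, z.2))
      (oneChart E G 1, η)) :
    ContMDiffAt (𝓘(ℝ, E).prod 𝓘(ℝ, StrongDual ℝ E)) 𝓘(ℝ, ℂ) ω f (g, η) := by
  have : IsTopologicalGroup G := topologicalGroup_of_lieGroup 𝓘(ℝ, E) ω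
  have h0 : ContMDiffAt 𝓘(ℝ, E) 𝓘(ℝ, E) ω (fun y : G => oneChart E G (g⁻¹ * y)) g := by
    refine ContMDiffAt.comp g (contMDiffAt_oneChart ?_) contMDiff_mul_left.contMDiffAt
    rw [inv_mul_cancel]
    exact mem_extChartAt_source 1
  have h1 : ContMDiffAt (𝓘(ℝ, E).prod 𝓘(ℝ, StrongDual ℝ E)) 𝓘(ℝ, E × StrongDual ℝ E) ω
      (fun y : G × StrongDual ℝ E => (oneChart E G (g⁻¹ * y.1), y.2)) (g, η) :=
    (ContMDiffAt.comp (g, η) h0 contMDiffAt_fst).prodMk_space contMDiffAt_snd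
  have h2 : ContMDiffAt 𝓘(ℝ, E × StrongDual ℝ E) 𝓘(ℝ, ℂ) ω
      (fun z : E × StrongDual ℝ E => f (g * (oneChart E G).symm z.1, z.2))
      (oneChart E G (g⁻¹ * g), η) := by
    rw [inv_mul_cancel]; exact hf.contMDiffAt
  refine (ContMDiffAt.comp (g, η) h2 h1).congr_of_eventuallyEq ?_
  have hc : Tendsto (fun y : G × StrongDual ℝ E => g⁻¹ * y.1) (𝓝 (g, η)) (𝓝 1) := by
    have : ContinuousAt (fun y : G × StrongDual ℝ E => g⁻¹ * y.1) (g, η) := by fun_prop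
    simpa [ContinuousAt] using this
  filter_upwards [hc ((isOpen_extChartAt_source (1 : G)).mem_nhds
    (mem_extChartAt_source (I := 𝓘(ℝ, E)) 1))] with y hy
  simp only [Function.comp_apply]
  rw [(oneChart E G).left_inv hy, mul_inv_cancel_left]

/-- In the translated chart times the dual space, the observables are Cauchy for the Taylor
majorant, so `analyticAt_of_tendsto` applies once more. -/
theorem contMDiff_limit [ConnectedSpace G] [F.NeBot] (hR : 0 ≤ R) (hR' : 0 ≤ R')
    (hC : ∀ i, Tendsto (fun p : Pol b R R' × Pol b R R' =>
      polSeminorm b R R' i (p.1 - p.2)) (F ×ˢ F) (𝓝 0)) {f : G × StrongDual ℝ E → ℂ}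
    (hf : ∀ g η, Tendsto (fun P => polEval b R R' g η P) F (𝓝 (f (g, η)))) :
    ContMDiff (𝓘(ℝ, E).prod 𝓘(ℝ, StrongDual ℝ E)) 𝓘(ℝ, ℂ) ω f := by
  have : FiniteDimensional ℝ E := finiteDimensional_of_lieBasis b
  have : CompleteSpace E := FiniteDimensional.complete ℝ E
  rintro ⟨g, η⟩
  obtain ⟨r, d, hr, hball, h⟩ := exists_taylorNorm_le_lieNorm b
  obtain ⟨i, hi⟩ := exists_taylorNorm_polEval_le (R := R) (R' := R') b hR hR' h g η
  refine contMDiffAt_of_translate_prod (AnalyticAt.contDiffAt (analyticAt_of_tendsto hr (l := F)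
    (F := fun P (z : E × StrongDual ℝ E) => polEval b R R' (g * (oneChart E G).symm z.1) z.2 P)
    (fun P => ?_) (fun P => ?_) ?_ fun z _ => hf _ _).1)
  · intro z hz
    obtain ⟨s, -, hP⟩ := exists_sum_polTmul b P
    simp only [polEval_eq_sum b hP, ← letterForm_apply]
    refine (ContDiffAt.sum fun w _ => ContDiffAt.mul ?_ (contDiffAt_prod fun j _ =>
      (letterForm b (w.2 j)).contDiff.contDiffAt)).analyticAt
    refine contDiffAt_translate_fst (polCoeff b R R' w P).2.1 g (hball ?_)
    -- The product carries the maximum norm, so the ball projects into the chart ball.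
    rw [← ball_prod_same] at hz
    exact hz.1
  · exact ne_top_of_le_ne_top (familyNorm_polCoeff_ne_top b i P) (hi P)
  · have h1 := ENNReal.tendsto_ofReal (hC i)
    rw [ENNReal.ofReal_zero] at h1
    refine tendsto_of_tendsto_of_tendsto_of_le_of_le tendsto_const_nhds h1 (fun _ => zero_le)
      fun p => le_trans (le_of_eq ?_) ((hi (p.1 - p.2)).trans (familyNorm_polCoeff_le b i _))
    congr 1
    funext z
    simp only [Pi.sub_apply, map_sub]

end Smoothness

end Limits

/-! ### Extension to the completion -/

section Observables

variable {E : Type*} [NormedAddCommGroup E] [NormedSpace ℝ E]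
  {G : Type*} [TopologicalSpace G] [ChartedSpace E G] [Group G] [LieGroup 𝓘(ℝ, E) ω G]
  [ConnectedSpace G] {n : ℕ} (b : Basis (Fin n) ℝ (GroupLieAlgebra 𝓘(ℝ, E) G)) {R R' : ℝ}

theorem isREntire_dual_of_familyNorm_ne_top (hR : 0 ≤ R) (hR' : 0 ≤ R') {a : Word n → G → ℂ}
    (ha : ∀ w, ContMDiff 𝓘(ℝ, E) 𝓘(ℝ, ℂ) ω (a w)) (hfin : ∀ i, familyNorm b R R' i a ≠ ⊤)
    (hperm : ∀ k (α : Fin k → Fin n) (σ : Equiv.Perm (Fin k)), a ⟨k, α ∘ σ⟩ = a ⟨k, α⟩) (g : G)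
    {f : StrongDual ℝ E → ℂ} (hf : ∀ η : StrongDual ℝ E,
      HasSum (fun w : Word n => a w g * ∏ j, (η (b (w.2 j)) : ℂ)) (f η)) :
    IsREntire (dualFrame b) 0 R' f := by
  have hs := summable_of_familyNorm_ne_top b hR hR' ha hfin g
  refine ⟨(contDiff_of_hasSum b (c := fun k α => a ⟨k, α⟩ g) hs hf).contMDiff, fun c hc => ?_⟩
  lift c to ℝ≥0 using hc
  simp only [majCoeff_dualFrame b (c := fun k α => a ⟨k, α⟩ g)
    (fun k α σ => congrFun (hperm k α σ) g) hs hf]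
  obtain ⟨d, hd⟩ := exists_tsum_enorm_le_familyNorm (R := R) (R' := R') b hR g
  have h1 := ne_top_of_le_ne_top (hfin (d, c)) (hd a ha c)
  rw [ENNReal.tsum_sigma'] at h1
  refine summable_of_tsum_ofReal_ne_top (fun k => by positivity) (ne_of_eq_of_ne ?_ h1)
  refine tsum_congr fun k => ?_
  rw [tsum_fintype, mul_right_comm, Finset.mul_sum,
    ENNReal.ofReal_sum_of_nonneg fun _ _ => by positivity]
  refine Finset.sum_congr rfl fun α _ => ?_
  rw [ENNReal.ofReal_mul (by positivity), ofReal_norm]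
  rfl

omit [ConnectedSpace G] in
theorem polCoeff_perm {k : ℕ} (α : Fin k → Fin n) (σ : Equiv.Perm (Fin k)) :
    polCoeff b R R' ⟨k, α ∘ σ⟩ = polCoeff b R R' ⟨k, α⟩ := by
  unfold polCoeff
  rw [LinearMap.ext (symCoeff_perm α σ)]

variable {F : Filter (Pol b R R')} [F.NeBot]

/-- All parts come from the limit family; its symmetry passes to the limit from the observables. The
last part carries injectivity: a vanishing limit has vanishing coefficients, so the seminorm of `P`
is bounded by a norm that becomes small along `F`. -/
theorem regularity_of_limit (hR : 0 ≤ R) (hR' : 0 ≤ R')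
    (hC : ∀ i, Tendsto (fun p : Pol b R R' × Pol b R R' =>
      polSeminorm b R R' i (p.1 - p.2)) (F ×ˢ F) (𝓝 0)) {f : G × StrongDual ℝ E → ℂ}
    (hf : ∀ g η, Tendsto (fun P => polEval b R R' g η P) F (𝓝 (f (g, η)))) :
    (∃! c : (k : ℕ) → (Fin k → Fin n) → G → ℂ,
      (∀ k α, IsREntire (leftFrame b) 1 R (c k α)) ∧
      (∀ k α (σ : Equiv.Perm (Fin k)), c k (α ∘ σ) = c k α) ∧
      ∀ (g : G) (η : StrongDual ℝ E),
        (Summable fun α : Σ k : ℕ, Fin k → Fin n =>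
          ‖c α.1 α.2 g * ∏ j, (η (b (α.2 j)) : ℂ)‖) ∧
        HasSum (fun α : Σ k : ℕ, Fin k → Fin n => c α.1 α.2 g * ∏ j, (η (b (α.2 j)) : ℂ))
          (f (g, η))) ∧
    (∀ g : G, IsREntire (dualFrame b) 0 R' (fun η => f (g, η))) ∧
    (f = 0 → ∀ i, Tendsto (polSeminorm b R R' i) F (𝓝 0)) := by
  obtain ⟨a, ha, hlim, hfin, happ⟩ := exists_limit_family b hR hR' hC
  have hperm : ∀ k (α : Fin k → Fin n) (σ : Equiv.Perm (Fin k)), a ⟨k, α ∘ σ⟩ = a ⟨k, α⟩ :=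
    fun k α σ => funext fun g => tendsto_nhds_unique (hlim ⟨k, α ∘ σ⟩ g)
      (by simpa only [polCoeff_perm] using hlim ⟨k, α⟩ g)
  have hs := summable_of_familyNorm_ne_top b hR hR' ha hfin
  have hsum := fun g η => hasSum_limit b hR hR' ha hfin happ (hf g η)
  refine ⟨⟨fun k α => a ⟨k, α⟩, ⟨fun k α => ?_, hperm, fun g η => ⟨hs g η, hsum g η⟩⟩, ?_⟩,
    fun g => isREntire_dual_of_familyNorm_ne_top b hR hR' ha hfin hperm g (hsum g), ?_⟩
  · exact isREntire_of_entireNorm_ne_top b (ha _) fun c =>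
      ne_top_of_le_ne_top (hfin (c, 1)) (entireNorm_le_familyNorm b hR' c a _)
  · rintro c ⟨-, hc, hcs⟩
    funext k α g
    exact coeff_unique b (c := fun k α => c k α g) (c' := fun k α => a ⟨k, α⟩ g)
      (fun k α σ => congrFun (hc k α σ) g) (fun η => (hcs g η).1) (fun η => (hcs g η).2)
      (fun k α σ => congrFun (hperm k α σ) g) (hs g) (hsum g) α
  · rintro rfl i
    have h0 : a = 0 := by
      funext ⟨k, α⟩ g
      exact coeff_unique b (c := fun k α => a ⟨k, α⟩ g) (c' := fun k α => 0)
        (fun k α σ => congrFun (hperm k α σ) g) (hs g) (hsum g) (fun _ _ _ => rfl)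
        (fun η => by simp) (fun η => by simp) α
    have h1 : Tendsto (fun P => ENNReal.ofReal (polSeminorm b R R' i P)) F (𝓝 0) := by
      refine ENNReal.tendsto_nhds_zero.2 fun ε hε => ?_
      filter_upwards [happ i ε hε] with P hP
      refine (ofReal_polSeminorm_le_familyNorm b i P).trans (le_trans (le_of_eq ?_) hP)
      simp only [h0, Pi.zero_apply, sub_zero]
    refine ((ENNReal.tendsto_toReal ENNReal.zero_ne_top).comp h1).congr fun P => ?_
    exact ENNReal.toReal_ofReal (apply_nonneg _ _)

/-- The absolute value at a point is bounded by a single seminorm, and continuity at `0` suffices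
for an additive map. -/
theorem continuous_polEval (hR : 0 ≤ R) (hR' : 0 ≤ R') (g : G) (η : StrongDual ℝ E) :
    Continuous (polEval b R R' g η) := by
  obtain ⟨i, hi⟩ := exists_tsum_enorm_monomial_le (R := R) (R' := R') b hR hR' g η
  have hb : ∀ P, ‖polEval b R R' g η P‖ ≤ polSeminorm b R R' i P := fun P => by
    rw [← ENNReal.ofReal_le_ofReal_iff (apply_nonneg _ _), ofReal_norm,
      ← (hasSum_polEval b g η P).tsum_eq]
    exact enorm_tsum_le_tsum_enorm.trans ((hi _ fun w => (polCoeff b R R' w P).2.1).trans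
      (familyNorm_polCoeff_le b i P))
  refine continuous_of_continuousAt_zero (polEval b R R' g η) ?_
  rw [ContinuousAt, map_zero]
  refine squeeze_zero_norm hb ?_
  have h1 := ((pol_withSeminorms b R R').continuous_seminorm i).tendsto 0
  rwa [map_zero] at h1

/-- The evaluation of polynomial observables as a map into the functions on `G × 𝔤*`. -/
def polFun (hR : 0 ≤ R) (hR' : 0 ≤ R') : Pol b R R' →L[ℂ] (G × StrongDual ℝ E → ℂ) :=
  ContinuousLinearMap.pi fun x => ⟨polEval b R R' x.1 x.2, continuous_polEval b hR hR' x.1 x.2⟩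

variable (R R') in
/-- The inclusion of the polynomial observables into their completion. -/
def polIncl : Pol b R R' →L[ℂ] PolCompletion b R R' :=
  { toFun := fun P => (P : PolCompletion b R R')
    map_add' := fun P Q => UniformSpace.Completion.coe_add P Q
    map_smul' := fun a P => UniformSpace.Completion.coe_smul a P
    cont := UniformSpace.Completion.continuous_coe _ }

/-- The continuous extension of the evaluation of polynomial observables to the completion. -/
def completionFun (hR : 0 ≤ R) (hR' : 0 ≤ R') :
    PolCompletion b R R' →L[ℂ] (G × StrongDual ℝ E → ℂ) :=
  (polFun b hR hR').extend (polIncl b R R')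

theorem completionFun_coe (hR : 0 ≤ R) (hR' : 0 ≤ R') (P : Pol b R R') :
    completionFun b hR hR' (P : PolCompletion b R R') = polFun b hR hR' P :=
  ContinuousLinearMap.extend_eq _ UniformSpace.Completion.denseRange_coe
    (UniformSpace.Completion.isUniformInducing_coe _) P

end Observables

/-! ### Points of the completion as Cauchy filters of observables. -/

section Traces

variable {E : Type*} [NormedAddCommGroup E] [NormedSpace ℝ E]
  {G : Type*} [TopologicalSpace G] [ChartedSpace E G] [Group G] [LieGroup 𝓘(ℝ, E) ω G]
  {n : ℕ} {b : Basis (Fin n) ℝ (GroupLieAlgebra 𝓘(ℝ, E) G)} {R R' : ℝ}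

/-- The trace on the polynomial observables of the neighbourhoods of a point of the completion. -/
def polTrace (χ : PolCompletion b R R') : Filter (Pol b R R') :=
  comap (fun P : Pol b R R' => (P : PolCompletion b R R')) (𝓝 χ)

instance (χ : PolCompletion b R R') : (polTrace χ).NeBot :=
  (UniformSpace.Completion.isDenseInducing_coe (α := Pol b R R')).comap_nhds_neBot χ

/-- The embedding induces the uniformity, so the trace is a Cauchy filter, and every seminorm is
continuous at `0`. -/
theorem tendsto_polSeminorm_sub_polTrace (χ : PolCompletion b R R') (i : ℝ≥0 × ℝ≥0) :
    Tendsto (fun p : Pol b R R' × Pol b R R' => polSeminorm b R R' i (p.1 - p.2))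
      (polTrace χ ×ˢ polTrace χ) (𝓝 0) := by
  have h1 : Cauchy (polTrace χ) :=
    have : (polTrace χ).NeBot := inferInstance
    Cauchy.comap' cauchy_nhds (UniformSpace.Completion.isUniformInducing_coe _).comap_uniformity.le this
  have h2 : Tendsto (fun p : Pol b R R' × Pol b R R' => p.1 - p.2)
      (polTrace χ ×ˢ polTrace χ) (𝓝 0) := by
    have h3 := h1.2
    rw [uniformity_eq_comap_nhds_zero_swapped] at h3
    exact tendsto_comap.mono_left h3
  have h4 := ((pol_withSeminorms b R R').continuous_seminorm i).tendsto 0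
  rw [map_zero] at h4
  exact h4.comp h2

end Traces

end LieObs

end

theorem mainTheorem8
    {E : Type*} [NormedAddCommGroup E] [NormedSpace ℝ E]
    {G : Type*} [TopologicalSpace G] [ChartedSpace E G] [Group G] [LieGroup 𝓘(ℝ, E) ω G]
    [ConnectedSpace G]
    {n : ℕ} (b : Basis (Fin n) ℝ (GroupLieAlgebra 𝓘(ℝ, E) G))
    (R R' : ℝ) (hR : 0 ≤ R) (hR' : 0 ≤ R') :
    ∃ Ψ : LieObs.PolCompletion b R R' →L[ℂ] (G × StrongDual ℝ E → ℂ),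
      (∀ (P : LieObs.Pol b R R') (g : G) (η : StrongDual ℝ E),
        Ψ (P : LieObs.PolCompletion b R R') (g, η) = LieObs.polEval b R R' g η P) ∧
      Function.Injective Ψ ∧
      ∀ χ : LieObs.PolCompletion b R R',
        ContMDiff (𝓘(ℝ, E).prod 𝓘(ℝ, StrongDual ℝ E)) 𝓘(ℝ, ℂ) ∞ (Ψ χ) ∧
        (∃! c : (k : ℕ) → (Fin k → Fin n) → G → ℂ,
          (∀ k α, LieObs.IsREntire (LieObs.leftFrame b) 1 R (c k α)) ∧
          (∀ k α (σ : Equiv.Perm (Fin k)), c k (α ∘ σ) = c k α) ∧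
          ∀ (g : G) (η : StrongDual ℝ E),
            (Summable fun α : Σ k : ℕ, Fin k → Fin n =>
              ‖c α.1 α.2 g * ∏ j, (η (b (α.2 j)) : ℂ)‖) ∧
            HasSum (fun α : Σ k : ℕ, Fin k → Fin n => c α.1 α.2 g * ∏ j, (η (b (α.2 j)) : ℂ))
              (Ψ χ (g, η))) ∧
        ∀ g : G, LieObs.IsREntire (LieObs.dualFrame b) 0 R' (fun η => Ψ χ (g, η)) := by
  have hΨ : ∀ (P : LieObs.Pol b R R') (g : G) (η : StrongDual ℝ E),
      LieObs.completionFun b hR hR' (P : LieObs.PolCompletion b R R') (g, η) =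
        LieObs.polEval b R R' g η P := fun P g η => by
    rw [LieObs.completionFun_coe]
    rfl
  have hlim : ∀ (χ : LieObs.PolCompletion b R R') g η,
      Filter.Tendsto (fun P => LieObs.polEval b R R' g η P) (LieObs.polTrace χ)
        (nhds (LieObs.completionFun b hR hR' χ (g, η))) := fun χ g η => by
    have h1 : Filter.Tendsto (fun χ => LieObs.completionFun b hR hR' χ (g, η)) (nhds χ)
        (nhds (LieObs.completionFun b hR hR' χ (g, η))) :=
      ((continuous_apply (g, η)).comp (LieObs.completionFun b hR hR').continuous).tendsto χ
    simp only [← hΨ]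
    exact h1.comp Filter.tendsto_comap
  have hreg := fun χ : LieObs.PolCompletion b R R' => LieObs.regularity_of_limit b hR hR'
    (LieObs.tendsto_polSeminorm_sub_polTrace χ) (hlim χ)
  refine ⟨LieObs.completionFun b hR hR', hΨ, ?_, fun χ =>
    ⟨(LieObs.contMDiff_limit b hR hR' (LieObs.tendsto_polSeminorm_sub_polTrace χ)
      (hlim χ)).of_le (by simp), (hreg χ).1, (hreg χ).2.1⟩⟩
  -- If the function of `χ` vanishes, the trace of `χ` converges to `0` among the observables. Its
  -- image in the completion converges to `χ` and to `0`, which agree because the completion is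
  -- Hausdorff.
  refine (injective_iff_map_eq_zero _).2 fun χ hχ => ?_
  have h1 : Filter.Tendsto id (LieObs.polTrace χ) (nhds (0 : LieObs.Pol b R R')) := by
    rw [(LieObs.pol_withSeminorms b R R').tendsto_nhds]
    intro i ε hε
    simpa using ((hreg χ).2.2 hχ i).eventually (gt_mem_nhds hε)
  have h2 := ((UniformSpace.Completion.continuous_coe (LieObs.Pol b R R')).tendsto 0).comp h1
  exact tendsto_nhds_unique (l := LieObs.polTrace χ) Filter.tendsto_comap h2
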